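/- Notation. For $\tau$ in the upper half plane let $\Lambda_\tau=\mathbb Z+\mathbb Z\tau$, let $\wp(u)=\wp(u\mid 1,\tau)$ be the Weierstrass function with primitive periods $1,\tau$, let $$\theta_1(u)=-\sum_{n\in\mathbb Z}\exp\bigl(\pi i\tau(n+\tfrac12)^2+2\pi i(n+\tfrac12)(u+\tfrac12)\bigr),\qquad \rho(u)=\frac{\theta_1'(u)}{\theta_1(u)},\qquad \sigma(u,z)=\frac{\theta_1(u-z)\,\theta_1'(0)}{\theta_1(z)\,\theta_1(u)} .$$ **(A) General simple Lie algebras.** Let $\mathfrak g$ be a complex (finite dimensional) simple Lie algebra of rank $\ell$, $\mathfrak h$ a Cartan subalgebra, $\Delta$ its root system, $h_1,\dots,h_\ell$ a basis of $\mathfrak h$ orthonormal for the Killing form, and $e_\alpha$ ($\alpha\in\Delta$) root vectors with $[e_\alpha,e_{-\alpha}]=h_\alpha:=\sum_\mu\alpha(h_\mu)h_\mu$; let $[e_\alpha,e_\beta]=N_{\alpha,\beta}e_{\alpha+\beta}$ for $\alpha,\beta,\alpha+\beta\in\Delta$. Consider the phase space with canonical coordinates $q_\mu,p_\mu$ and spin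 variables $F_\alpha,G_\mu$ with the Kostant–Kirillov brackets $\{F_\alpha,F_{-\alpha}\}=\sum_\mu\alpha(h_\mu)G_\mu$, $\{F_\alpha,F_\beta\}=N_{\alpha,\beta}F_{\alpha+\beta}$ ($\alpha+\beta\ne0$; this is $0$ if $\alpha+\beta\notin\Delta$), $\{G_\mu,F_\alpha\}=\alpha(h_\mu)F_\alpha$, $\{G_\mu,G_\nu\}=0$. Put $\alpha\cdot q=\sum_\mu\alpha(h_\mu)q_\mu$ and $$\mathcal H=\tfrac12\sum_\mu p_\mu^2-\tfrac12\sum_{\alpha\in\Delta}\wp(\alpha\cdot q)F_{-\alpha}F_\alpha .$$ Let $U$ be an open subset of the upper half plane and let $q,p,F,G$ be a holomorphic solution on $U$ of the non-autonomous Hamiltonian system $2\pi i\,\frac{d}{d\tau}=\{\,\cdot\,,\mathcal H\}$ with the constraints $G_\mu=0$, such that $\alpha\cdot q(\tau)\notin\Lambda_\tau$ for all $\alpha\in\Delta$, $\tau\in U$. Let $V$ be a finite dimensional representation of $\mathfrak g$, let $E_\alpha,H_\mu$ be the endomorphisms of $V$ representing $e_\alpha,h_\mu$, and put $P=\sum_\mu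 p_\mu H_\mu$, $Q=\sum_\mu q_\mu H_\mu$, $$L(z)=P+\sum_{\alpha\in\Delta}\sigma(\alpha\cdot q,z)F_{-\alpha}E_\alpha,\qquad M(z)=-\sum_{\alpha\in\Delta}\sigma(\alpha\cdot q,z)\bigl(\rho(\alpha\cdot q)+\rho(z-\alpha\cdot q)\bigr)F_{-\alpha}E_\alpha=\sum_{\alpha\in\Delta}\frac{\partial\sigma}{\partial u}(\alpha\cdot q,z)F_{-\alpha}E_\alpha ,$$ where the last expression extends $M$ holomorphically across the removable singularities $z\in\alpha\cdot q+\Lambda_\tau$. Then: 1. The equations of motion on the constraint surface are $$2\pi i\frac{dq_\mu}{d\tau}=p_\mu,\qquad 2\pi i\frac{dp_\mu}{d\tau}=\frac12\sum_{\alpha\in\Delta}\alpha(h_\mu)\wp'(\alpha\cdot q)F_{-\alpha}F_\alpha,\qquad 2\pi i\frac{dF_\alpha}{d\tau}=-\sum_{\beta\in\Delta,\ \alpha-\beta\in\Delta}\wp(\beta\cdot q)F_{\alpha-\beta}F_\beta N_{\alpha,-\beta}.$$ 2. $2\pi i\,\dfrac{\partial L}{\partial\tau}+\dfrac{\partial M}{\partial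 z}=[L,M]$ for all $\tau\in U$, $z\notin\Lambda_\tau$. 3. For $\tau\in U$ and $z\notin\Lambda_\tau$: $L(z+1)=L(z)$, $M(z+1)=M(z)$, $L(z+\tau)=e^{2\pi iQ}L(z)e^{-2\pi iQ}$, $M(z+\tau)=e^{2\pi iQ}\bigl(M(z)+2\pi iL(z)\bigr)e^{-2\pi iQ}-2\pi iP$. 4. $dY/dz=LY$ has on the torus $\mathbb C/\Lambda_\tau$ a regular singularity at $z=0$ only: $L$ is holomorphic off $\Lambda_\tau$ and has at most a simple pole at $z=0$. 5. The monodromy data of $dY/dz=LY$ do not depend on $\tau$. Precisely, in the real coordinates $z=x+y\tau$ the lattice $\Lambda_\tau$ is $\mathbb Z^2$ for every $\tau$. Let $b\in\mathbb R^2\setminus\mathbb Z^2$, and call a path $c$ in $\mathbb R^2\setminus\mathbb Z^2$ from $b$ to $b+(m,n)$, $m,n\in\mathbb Z$, a cycle of class $m\alpha+n\beta$. The monodromy $\Gamma_c$ of a fundamental ($\mathrm{End}(V)$-valued, invertible) solution $Y$ near the point of coordinates $b$ is defined by $Y(z+m+n\tau)=e^{2\pi inQ}\,Y(z)\,\Gamma_c$,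 where the left side is the analytic continuation of $Y$ along $c$. (For $m=n=0$ and $c$ a loop once around $0$ this is $\Gamma_0$: $Y(ze^{2\pi i})=Y(z)\Gamma_0$; for the $\alpha$-cycle $(1,0)$ it is $\Gamma_\alpha$: $Y(z+1)=Y(z)\Gamma_\alpha$; for the $\beta$-cycle $(0,1)$ it is $\Gamma_\beta$: $Y(z+\tau)=e^{2\pi iQ}Y(z)\Gamma_\beta$.) Then: (a) for every $\tau\in U$, every $Y$ and every $c$, $\Gamma_c$ exists, is unique and is invertible; (b) the linear system $\partial Y/\partial z=LY$, $2\pi i\,\partial Y/\partial\tau+MY=0$ has, locally in $\tau\in U$ near the base point, holomorphic solutions with any invertible initial value; (c) for every holomorphic invertible solution $Y$ of this system over an open set $W\subseteq U$ and every $c$, $d\Gamma_c/d\tau=0$ on $W$; in particular $d\Gamma_0/d\tau=d\Gamma_\alpha/d\tau=d\Gamma_\beta/d\tau=0$; (d) if $U$ is connected, one can choose for each $\tau\in U$ a fundamental solution $Y_\tau$ of $dY/dz=LY$ such that the monodromies $\Gamma_c$ of $Y_\tau$, for all cycles $c$ based at $b$ simultaneously (in particular the data $(\Gamma_0,\Gamma_\alpha,\Gamma_\beta)$),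 are the same for all $\tau\in U$. **(B) $sl(\ell)$ in the vector representation.** The same conclusions hold for the phase space with canonical coordinates $q_j,p_j$ ($1\le j\le\ell$), spin variables $F_{jk}$ with $\{F_{jk},F_{mn}\}=\delta_{mk}F_{jn}-\delta_{jn}F_{mk}$, the Hamiltonian $\mathcal H=\frac12\sum_jp_j^2-\frac12\sum_{j\ne k}\wp(q_j-q_k)F_{jk}F_{kj}$, the constraints $F_{jj}=0$, the condition $q_j-q_k\notin\Lambda_\tau$ ($j\neq k$), the $\ell\times\ell$ matrices $P=\sum_jp_jE_{jj}$, $Q=\sum_jq_jE_{jj}$, $$L(z)=P+\sum_{j\ne k}\sigma(q_j-q_k,z)F_{kj}E_{jk},\qquad M(z)=-\sum_{j\ne k}\sigma(q_j-q_k,z)\bigl(\rho(q_j-q_k)+\rho(z-q_j+q_k)\bigr)F_{kj}E_{jk},$$ ($M$ again extended holomorphically), and the equations of motion $$2\pi i\frac{dq_j}{d\tau}=p_j,\quad 2\pi i\frac{dp_j}{d\tau}=\sum_{k\ne j}\wp'(q_j-q_k)F_{jk}F_{kj},\quad 2\pi i\frac{dF_{jk}}{d\tau}=\sum_{m\ne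 j}\wp(q_j-q_m)F_{jm}F_{mk}-\sum_{m\ne k}\wp(q_m-q_k)F_{jm}F_{mk}.$$ -/

import Mathlib

open Complex Filter Topology LieAlgebra LieModule

noncomputable section

/-! ## Elliptic functions with periods `1` and `τ` -/

/-- The period lattice `ℤ + ℤ τ`. -/
def periodLattice (τ : ℂ) : Set ℂ := {z | ∃ m n : ℤ, z = m + n * τ}

/-- The Jacobi theta function
`θ₁(u | τ) = - ∑ₙ exp (π i τ (n + 1/2)² + 2 π i (n + 1/2) (u + 1/2))`. -/
def theta1 (τ u : ℂ) : ℂ :=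
  -∑' n : ℤ, Complex.exp (Real.pi * I * τ * ((n : ℂ) + 1 / 2) ^ 2
    + 2 * Real.pi * I * ((n : ℂ) + 1 / 2) * (u + 1 / 2))

/-- The logarithmic derivative `ρ(u) = θ₁'(u) / θ₁(u)`. -/
def rhoFun (τ u : ℂ) : ℂ := deriv (theta1 τ) u / theta1 τ u

/-- `σ(u, z) = θ₁(u - z) θ₁'(0) / (θ₁(z) θ₁(u))`. -/
def sigmaFun (τ u z : ℂ) : ℂ :=
  theta1 τ (u - z) * deriv (theta1 τ) 0 / (theta1 τ z * theta1 τ u)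

/-- The partial derivative `∂σ/∂u (u, z)`. It is the holomorphic extension of
`- σ(u, z) (ρ(u) + ρ(z - u))` across the removable singularities `z - u ∈ ℤ + ℤ τ`. -/
def dSigmaFun (τ u z : ℂ) : ℂ := deriv (fun v => sigmaFun τ v z) u

open Classical in
/-- The Weierstrass function `℘(u)` with primitive periods `1` and `τ`
(and the value `0` for the excluded real `τ`). -/
def wpFun (τ u : ℂ) : ℂ :=
  if h : LinearIndependent ℝ ![(1 : ℂ), τ] then (PeriodPair.mk 1 τ h).weierstrassP u else 0

/-- `2 π i df/dτ = v` at the point `τ`, for a holomorphic `f`. -/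
def TwoPiIDeriv {E : Type*} [NormedAddCommGroup E] [NormedSpace ℂ E]
    (f : ℂ → E) (v : E) (τ : ℂ) : Prop :=
  HasDerivAt f ((2 * Real.pi * I : ℂ)⁻¹ • v) τ

/-! ## Lax equation and quasi-periodicity -/

section Lax

variable {E : Type*} [NormedRing E] [NormedAlgebra ℂ E]

/-- The Lax equation `2 π i ∂L/∂τ + ∂M/∂z = [L, M]` at all `τ ∈ U` and all `z ∉ ℤ + ℤ τ`
(the partial derivatives existing). -/
def LaxEquation (U : Set ℂ) (L M : ℂ → ℂ → E) : Prop :=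
  ∀ τ ∈ U, ∀ z, z ∉ periodLattice τ → ∃ Lτ Mz : E,
    HasDerivAt (fun t => L t z) Lτ τ ∧ HasDerivAt (fun w => M τ w) Mz z ∧
    (2 * Real.pi * I : ℂ) • Lτ + Mz = L τ z * M τ z - M τ z * L τ z

/-- The quasi-periodicity of `L` and `M` in `z`. -/
structure LaxQuasiPeriodic (U : Set ℂ) (L M : ℂ → ℂ → E) (P Q : ℂ → E) : Prop where
  L_one : ∀ τ ∈ U, ∀ z, z ∉ periodLattice τ → L τ (z + 1) = L τ z
  M_one : ∀ τ ∈ U, ∀ z, z ∉ periodLattice τ → M τ (z + 1) = M τ z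
  L_tau : ∀ τ ∈ U, ∀ z, z ∉ periodLattice τ →
    L τ (z + τ) = NormedSpace.exp ((2 * Real.pi * I : ℂ) • Q τ) * L τ z *
      NormedSpace.exp (-((2 * Real.pi * I : ℂ) • Q τ))
  M_tau : ∀ τ ∈ U, ∀ z, z ∉ periodLattice τ →
    M τ (z + τ) = NormedSpace.exp ((2 * Real.pi * I : ℂ) • Q τ) *
      (M τ z + (2 * Real.pi * I : ℂ) • L τ z) *
      NormedSpace.exp (-((2 * Real.pi * I : ℂ) • Q τ)) - (2 * Real.pi * I : ℂ) • P τ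

/-- `dY/dz = L Y` has, on the torus, a regular singularity at `z = 0` only: `L` is holomorphic
outside the period lattice and has at most a simple pole at `z = 0`. -/
def OnlyRegularSingularityAtZero (U : Set ℂ) (L : ℂ → ℂ → E) : Prop :=
  ∀ τ ∈ U, (∀ z, z ∉ periodLattice τ → AnalyticAt ℂ (L τ) z) ∧
    ∃ R : ℂ → E, AnalyticAt ℂ R 0 ∧ ∀ᶠ z in 𝓝[≠] (0 : ℂ), L τ z = z⁻¹ • R z

/-! ## Cycles of the once punctured torus

Every torus is marked by its periods `1, τ`. In the real coordinates `(x, y) ↦ x + y τ` the lattice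
becomes `ℤ × ℤ`, independently of `τ`. -/

/-- The point with real coordinates `a = (x, y)`. -/
def torusPoint (τ : ℂ) (a : ℝ × ℝ) : ℂ := a.1 + a.2 * τ

/-- `a` is not a lattice point. -/
def OffLattice (a : ℝ × ℝ) : Prop := ∀ k l : ℤ, a ≠ ((k : ℝ), (l : ℝ))

/-- A path (in real coordinates, avoiding the lattice) from `b` to `b + (m, n)`: a closed curve on
the once punctured torus, of class `m α + n β`. -/
structure TorusCycle (b : ℝ × ℝ) (m n : ℤ) where
  path : Path b (b.1 + m, b.2 + n)
  off : ∀ s, OffLattice (path s)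

/-! ## Analytic continuation and monodromy of `dY/dz = A Y` -/

/-- `Y` is a holomorphic solution of `dY/dz = A Y` in a neighbourhood of `z`. -/
def IsSolutionNear (A : ℂ → E) (Y : ℂ → E) (z : ℂ) : Prop :=
  ∀ᶠ w in 𝓝 z, HasDerivAt Y (A w * Y w) w

/-- `Y` is a fundamental (invertible) solution of `dY/dz = A Y` near `z`. -/
def IsFundamentalNear (A : ℂ → E) (Y : ℂ → E) (z : ℂ) : Prop :=
  IsSolutionNear A Y z ∧ IsUnit (Y z)

/-- `Y₁` is the analytic continuation of `Y` along the curve `γ`, through solutions of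
`dY/dz = A Y`. -/
def ContinuesTo (A : ℂ → E) (γ : unitInterval → ℂ) (Y Y₁ : ℂ → E) : Prop :=
  ∃ y : unitInterval → ℂ → E,
    (∀ s, IsSolutionNear A (y s) (γ s)) ∧
    (∀ s, ∀ᶠ t in 𝓝 s, y t =ᶠ[𝓝 (γ t)] y s) ∧
    y 0 =ᶠ[𝓝 (γ 0)] Y ∧ y 1 =ᶠ[𝓝 (γ 1)] Y₁

/-- `Γ` is the monodromy of `Y` along a cycle `c` of class `m α + n β`: after analytic continuation
along `c`, one has `Y(z + m + n τ) = exp (2 π i n Q) Y(z) Γ`. So `(m, n) = (0, 0)`, with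
`c` a loop around the origin, gives `Γ₀`, and `(1, 0)`, `(0, 1)` give `Γ_α`, `Γ_β`. -/
def HasMonodromy (L : ℂ → ℂ → E) (Q : ℂ → E) (τ : ℂ) {b : ℝ × ℝ} {m n : ℤ}
    (c : TorusCycle b m n) (Y : ℂ → E) (Γ : E) : Prop :=
  ∃ Y₁ : ℂ → E, ContinuesTo (L τ) (fun s => torusPoint τ (c.path s)) Y Y₁ ∧
    ∀ᶠ z in 𝓝 (torusPoint τ b),
      Y₁ (z + (m + n * τ)) = NormedSpace.exp ((2 * Real.pi * I * n : ℂ) • Q τ) * Y z * Γ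

/-- `Y(τ, z)`, for `τ ∈ W` and `z` near the base point with real coordinates `b`, is a holomorphic
fundamental solution of the linear system `∂Y/∂z = L Y`, `2 π i ∂Y/∂τ + M Y = 0`. -/
def IsJointSolution (L M : ℂ → ℂ → E) (W : Set ℂ) (b : ℝ × ℝ) (Y : ℂ → ℂ → E) : Prop :=
  ∀ τ ∈ W,
    AnalyticAt ℂ (fun x : ℂ × ℂ => Y x.1 x.2) (τ, torusPoint τ b) ∧
    IsUnit (Y τ (torusPoint τ b)) ∧
    ∀ᶠ x : ℂ × ℂ in 𝓝 (τ, torusPoint τ b),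
      HasDerivAt (fun w => Y x.1 w) (L x.1 x.2 * Y x.1 x.2) x.2 ∧
      TwoPiIDeriv (fun t => Y t x.2) (-(M x.1 x.2 * Y x.1 x.2)) x.1

end Lax

/-! The three standard cycles, based at `(1 + τ) / 2`. -/

/-- The loop going once counterclockwise around the origin (and around no other lattice point):
the circle `x² + y² = 1/2` in real coordinates. -/
def cycleZero : TorusCycle (1 / 2, 1 / 2) 0 0 where
  path :=
    { toFun := fun s => (1 / 2 * (Real.cos (2 * Real.pi * s) - Real.sin (2 * Real.pi * s)),
        1 / 2 * (Real.cos (2 * Real.pi * s) + Real.sin (2 * Real.pi * s)))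
      continuous_toFun := by fun_prop
      source' := by simp
      target' := by simp }
  off := by
    intro s k l h
    have h1 := congrArg Prod.fst h
    have h2 := congrArg Prod.snd h
    simp only [Path.coe_mk_mk] at h1 h2
    have h3 : (2 : ℝ) * ((k : ℝ) ^ 2 + (l : ℝ) ^ 2) = 1 := by
      rw [← h1, ← h2]
      nlinarith [Real.sin_sq_add_cos_sq (2 * Real.pi * (s : ℝ))]
    have h4 : (2 : ℤ) * (k ^ 2 + l ^ 2) = 1 := by exact_mod_cast h3
    omega

theorem half_ne_intCast (k : ℤ) : (1 / 2 : ℝ) ≠ k := by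
  intro h
  have h1 : (1 : ℝ) = 2 * k := by linarith
  have h2 : (1 : ℤ) = 2 * k := by exact_mod_cast h1
  omega

/-- The straight path from the base point to its translate by `1`. -/
def cycleAlpha : TorusCycle (1 / 2, 1 / 2) 1 0 where
  path :=
    { toFun := fun s => (1 / 2 + s, 1 / 2)
      continuous_toFun := by fun_prop
      source' := by simp
      target' := by simp }
  off := fun _ _ l h => half_ne_intCast l (congrArg Prod.snd h)

/-- The straight path from the base point to its translate by `τ`. -/
def cycleBeta : TorusCycle (1 / 2, 1 / 2) 0 1 where
  path :=
    { toFun := fun s => (1 / 2, 1 / 2 + s)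
      continuous_toFun := by fun_prop
      source' := by simp
      target' := by simp }
  off := fun _ k _ h => half_ne_intCast k (congrArg Prod.fst h)

/-- The monodromy data of `dY/dz = L Y` on the torus with periods `1, τ` do not depend on
`τ ∈ U`. -/
structure Isomonodromic {E : Type*} [NormedRing E] [NormedAlgebra ℂ E]
    (U : Set ℂ) (L M : ℂ → ℂ → E) (Q : ℂ → E) : Prop where
  /-- Each fundamental solution has a unique, invertible, monodromy along each cycle. -/
  monodromy_exists : ∀ τ ∈ U, ∀ (b : ℝ × ℝ) (Y : ℂ → E),
    IsFundamentalNear (L τ) Y (torusPoint τ b) →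
    ∀ (m n : ℤ) (c : TorusCycle b m n),
      ∃ Γ : E, IsUnit Γ ∧ ∀ Γ' : E, HasMonodromy L Q τ c Y Γ' ↔ Γ' = Γ
  /-- The linear system `∂Y/∂z = L Y`, `2 π i ∂Y/∂τ + M Y = 0` has solutions, locally in `τ`,
  with any invertible initial value. -/
  joint_exists : ∀ τ₀ ∈ U, ∀ b : ℝ × ℝ, OffLattice b → ∀ Y₀ : E, IsUnit Y₀ →
    ∃ W : Set ℂ, IsOpen W ∧ τ₀ ∈ W ∧ W ⊆ U ∧ ∃ Y : ℂ → ℂ → E,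
      IsJointSolution L M W b Y ∧ Y τ₀ (torusPoint τ₀ b) = Y₀
  /-- `dΓ/dτ = 0` for the monodromy of a solution of this linear system along any cycle. -/
  deriv_eq_zero : ∀ W : Set ℂ, IsOpen W → W ⊆ U → ∀ (b : ℝ × ℝ) (Y : ℂ → ℂ → E),
    IsJointSolution L M W b Y → ∀ (m n : ℤ) (c : TorusCycle b m n) (Γ : ℂ → E),
      (∀ τ ∈ W, HasMonodromy L Q τ c (Y τ) (Γ τ)) → ∀ τ ∈ W, HasDerivAt Γ 0 τ
  /-- All the equations `dY/dz = L Y`, `τ ∈ U`, have, in suitable fundamental solutions, the same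
  monodromy along all cycles simultaneously. -/
  monodromy_const : IsPreconnected U → ∀ b : ℝ × ℝ, OffLattice b →
    ∃ Γ : ∀ m n : ℤ, TorusCycle b m n → Eˣ, ∀ τ ∈ U, ∃ Y : ℂ → E,
      IsFundamentalNear (L τ) Y (torusPoint τ b) ∧
      ∀ (m n : ℤ) (c : TorusCycle b m n), HasMonodromy L Q τ c Y (Γ m n c)
  /-- In particular so for the standard monodromy data `Γ₀`, `Γ_α`, `Γ_β`. -/
  standard_data_const : IsPreconnected U → ∃ Γ₀ Γα Γβ : Eˣ, ∀ τ ∈ U, ∃ Y : ℂ → E,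
    IsFundamentalNear (L τ) Y (torusPoint τ (1 / 2, 1 / 2)) ∧
    HasMonodromy L Q τ cycleZero Y Γ₀ ∧ HasMonodromy L Q τ cycleAlpha Y Γα ∧
    HasMonodromy L Q τ cycleBeta Y Γβ

/-! ## The spin system of a simple Lie algebra -/

/-- Points of the phase space in coordinates: particles `q`, `p`, and spins `F` (indexed by `Δ`)
and `G`. -/
structure SpinPoint (ι Δ : Type*) where
  q : ι → ℂ
  p : ι → ℂ
  F : Δ → ℂ
  G : ι → ℂ

namespace SpinPoint

variable {ι Δ : Type*}

open Classical in
/-- `∂f/∂q_μ` -/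
def dq (f : SpinPoint ι Δ → ℂ) (μ : ι) (x : SpinPoint ι Δ) : ℂ :=
  deriv (fun s => f { x with q := Function.update x.q μ s }) (x.q μ)

open Classical in
/-- `∂f/∂p_μ` -/
def dp (f : SpinPoint ι Δ → ℂ) (μ : ι) (x : SpinPoint ι Δ) : ℂ :=
  deriv (fun s => f { x with p := Function.update x.p μ s }) (x.p μ)

open Classical in
/-- `∂f/∂F_α` -/
def dF (f : SpinPoint ι Δ → ℂ) (α : Δ) (x : SpinPoint ι Δ) : ℂ :=
  deriv (fun s => f { x with F := Function.update x.F α s }) (x.F α)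

open Classical in
/-- `∂f/∂G_μ` -/
def dG (f : SpinPoint ι Δ → ℂ) (μ : ι) (x : SpinPoint ι Δ) : ℂ :=
  deriv (fun s => f { x with G := Function.update x.G μ s }) (x.G μ)

end SpinPoint

section General

variable {𝔤 : Type*} [LieRing 𝔤] [LieAlgebra ℂ 𝔤] [FiniteDimensional ℂ 𝔤]
  [LieAlgebra.IsSimple ℂ 𝔤] (H : LieSubalgebra ℂ 𝔤) [H.IsCartanSubalgebra]
  (ι : Type*) [Fintype ι] [DecidableEq ι]

/-- A choice of basis `e_α`, `h_μ` of the simple Lie algebra `𝔤`, adapted to the root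
decomposition with respect to the Cartan subalgebra `H`: `h_μ` is an orthonormal basis of `H` for
the Killing form, `e_α` a root vector for the root `α`, and `[e_α, e_{-α}] = h_α = ∑ α(h_μ) h_μ`.
The numbers `N α β` are the structure constants, `[e_α, e_β] = N_{α,β} e_{α+β}`.
(The values of `e` and `N` at the zero weight are irrelevant.) -/
structure RootBasis where
  h : Module.Basis ι ℂ H
  killing_h : ∀ μ ν, killingForm ℂ 𝔤 (h μ : 𝔤) (h ν : 𝔤) = if μ = ν then 1 else 0
  e : Weight ℂ H 𝔤 → 𝔤
  e_mem : ∀ α ∈ H.root, e α ∈ rootSpace H (α : H → ℂ)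
  lie_e_neg : ∀ α ∈ H.root, ⁅e α, e (-α)⁆ = ∑ μ, α (h μ) • (h μ : 𝔤)
  N : Weight ℂ H 𝔤 → Weight ℂ H 𝔤 → ℂ
  lie_e : ∀ α ∈ H.root, ∀ β ∈ H.root, ∀ γ ∈ H.root, (γ : H → ℂ) = α + β →
    ⁅e α, e β⁆ = N α β • e γ

variable {H ι} (B : RootBasis H ι)

namespace RootBasis

/-- The pairing `α · q`, where `q = ∑ q_μ h_μ ∈ H`. -/
def pair (α : Weight ℂ H 𝔤) (q : ι → ℂ) : ℂ := ∑ μ, α (B.h μ) * q μ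

/-- The Hamiltonian `½ p · p - ½ ∑_α ℘(α · q) F_{-α} F_α`. -/
def hamiltonian (τ : ℂ) (x : SpinPoint ι (Weight ℂ H 𝔤)) : ℂ :=
  1 / 2 * ∑ μ, x.p μ ^ 2
    - 1 / 2 * ∑ α ∈ H.root, wpFun τ (B.pair α x.q) * x.F (-α) * x.F α

open Classical in
/-- The Kostant-Kirillov bracket `{F_α, F_β}`: it is `G_α = ∑ α(h_μ) G_μ` if `β = -α`, and
`N_{α,β} F_{α+β}` otherwise (`0` if `α + β` is not a root). -/
def bracketFF (α β : Weight ℂ H 𝔤) (x : SpinPoint ι (Weight ℂ H 𝔤)) : ℂ :=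
  if β = -α then ∑ μ, α (B.h μ) * x.G μ
  else ∑ γ ∈ H.root.filter (fun δ : Weight ℂ H 𝔤 => (δ : H → ℂ) = α + β), B.N α β * x.F γ

/-- `{F_α, f}`, with `{F_α, G_μ} = - α(h_μ) F_α`. -/
def bracketF (α : Weight ℂ H 𝔤) (f : SpinPoint ι (Weight ℂ H 𝔤) → ℂ)
    (x : SpinPoint ι (Weight ℂ H 𝔤)) : ℂ :=
  ∑ β ∈ H.root, B.bracketFF α β x * SpinPoint.dF f β x
    - ∑ μ, α (B.h μ) * x.F α * SpinPoint.dG f μ x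

/-- `{G_μ, f}`, with `{G_μ, F_α} = α(h_μ) F_α` and `{G_μ, G_ν} = 0`. -/
def bracketG (μ : ι) (f : SpinPoint ι (Weight ℂ H 𝔤) → ℂ)
    (x : SpinPoint ι (Weight ℂ H 𝔤)) : ℂ :=
  ∑ α ∈ H.root, α (B.h μ) * x.F α * SpinPoint.dF f α x

/-- `x(τ)`, `τ ∈ U`, is a holomorphic solution of the non-autonomous constrained Hamiltonian
system: `2 π i d/dτ = {· , ℋ}` on the constraint surface `G = 0` (and off the singularities
`α · q ∈ ℤ + ℤ τ` of the Hamiltonian). -/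
structure IsSolution (U : Set ℂ) (x : ℂ → SpinPoint ι (Weight ℂ H 𝔤)) : Prop where
  regular : ∀ τ ∈ U, ∀ α ∈ H.root, B.pair α (x τ).q ∉ periodLattice τ
  constraint : ∀ τ ∈ U, ∀ μ, (x τ).G μ = 0
  deriv_q : ∀ τ ∈ U, ∀ μ,
    TwoPiIDeriv (fun t => (x t).q μ) (SpinPoint.dp (B.hamiltonian τ) μ (x τ)) τ
  deriv_p : ∀ τ ∈ U, ∀ μ,
    TwoPiIDeriv (fun t => (x t).p μ) (-SpinPoint.dq (B.hamiltonian τ) μ (x τ)) τ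
  deriv_F : ∀ τ ∈ U, ∀ α ∈ H.root,
    TwoPiIDeriv (fun t => (x t).F α) (B.bracketF α (B.hamiltonian τ) (x τ)) τ
  deriv_G : ∀ τ ∈ U, ∀ μ,
    TwoPiIDeriv (fun t => (x t).G μ) (B.bracketG μ (B.hamiltonian τ) (x τ)) τ

open Classical in
/-- The equations of motion in explicit form. -/
structure EquationsOfMotion (U : Set ℂ) (x : ℂ → SpinPoint ι (Weight ℂ H 𝔤)) : Prop where
  deriv_q : ∀ τ ∈ U, ∀ μ, TwoPiIDeriv (fun t => (x t).q μ) ((x τ).p μ) τ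
  deriv_p : ∀ τ ∈ U, ∀ μ, TwoPiIDeriv (fun t => (x t).p μ)
    (1 / 2 * ∑ α ∈ H.root, α (B.h μ) * deriv (wpFun τ) (B.pair α (x τ).q) *
      (x τ).F (-α) * (x τ).F α) τ
  deriv_F : ∀ τ ∈ U, ∀ α ∈ H.root, TwoPiIDeriv (fun t => (x t).F α)
    (-∑ β ∈ H.root, ∑ γ ∈ H.root.filter (fun δ : Weight ℂ H 𝔤 => (δ : H → ℂ) = α - β),
      wpFun τ (B.pair β (x τ).q) * (x τ).F γ * (x τ).F β * B.N α (-β)) τ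

variable (V : Type*) [NormedAddCommGroup V] [NormedSpace ℂ V] [FiniteDimensional ℂ V]
  [LieRingModule 𝔤 V] [LieModule ℂ 𝔤 V]

/-- The endomorphism of the representation space `V` that represents an element of `𝔤`. -/
def rep {𝔤 : Type*} [LieRing 𝔤] [LieAlgebra ℂ 𝔤] (V : Type*) [NormedAddCommGroup V]
    [NormedSpace ℂ V] [FiniteDimensional ℂ V] [LieRingModule 𝔤 V] [LieModule ℂ 𝔤 V] (a : 𝔤) :
    V →L[ℂ] V :=
  LinearMap.toContinuousLinearMap (LieModule.toEnd ℂ 𝔤 V a)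

/-- `∑ c_μ H_μ`; this is `P` for `c = p` and `Q` for `c = q`. -/
def cartanOp (c : ι → ℂ) : V →L[ℂ] V := ∑ μ, c μ • rep V (B.h μ : 𝔤)

/-- `L(z) = P + ∑_α σ(α · q, z) F_{-α} E_α`. -/
def laxL (x : ℂ → SpinPoint ι (Weight ℂ H 𝔤)) (τ z : ℂ) : V →L[ℂ] V :=
  B.cartanOp V (x τ).p
    + ∑ α ∈ H.root, (sigmaFun τ (B.pair α (x τ).q) z * (x τ).F (-α)) • rep V (B.e α)

/-- `M(z) = - ∑_α σ(α · q, z) (ρ(α · q) + ρ(z - α · q)) F_{-α} E_α`, holomorphically extended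
across the removable singularities `z ∈ α · q + ℤ + ℤ τ`. -/
def laxM (x : ℂ → SpinPoint ι (Weight ℂ H 𝔤)) (τ z : ℂ) : V →L[ℂ] V :=
  ∑ α ∈ H.root, (dSigmaFun τ (B.pair α (x τ).q) z * (x τ).F (-α)) • rep V (B.e α)

/-- The formula for `M(z)` in terms of `σ` and `ρ`, valid off the removable singularities. -/
def LaxMFormula (U : Set ℂ) (x : ℂ → SpinPoint ι (Weight ℂ H 𝔤)) : Prop :=
  ∀ τ ∈ U, ∀ z, z ∉ periodLattice τ →
    (∀ α ∈ H.root, z - B.pair α (x τ).q ∉ periodLattice τ) →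
    B.laxM V x τ z = -∑ α ∈ H.root, (sigmaFun τ (B.pair α (x τ).q) z *
      (rhoFun τ (B.pair α (x τ).q) + rhoFun τ (z - B.pair α (x τ).q)) *
      (x τ).F (-α)) • rep V (B.e α)

end RootBasis

end General

/-! ## The spin system of `sl(ℓ)` in the vector representation

Spins are indexed by pairs: `F (j, k)` is `F_{jk}`. The coordinates `G` of the general phase space
(the Cartan part of the spin) are the diagonal elements `F_{jj}` here, so that only `q`, `p`, `F`
occur. -/

/-- Points of the phase space of the `sl(ℓ)` spin system. -/
structure SlSpinPoint (l : ℕ) where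
  q : Fin l → ℂ
  p : Fin l → ℂ
  F : Fin l → Fin l → ℂ

namespace SlSpinPoint

variable {l : ℕ}

/-- `∂f/∂q_j` -/
def dq (f : SlSpinPoint l → ℂ) (j : Fin l) (x : SlSpinPoint l) : ℂ :=
  deriv (fun s => f { x with q := Function.update x.q j s }) (x.q j)

/-- `∂f/∂p_j` -/
def dp (f : SlSpinPoint l → ℂ) (j : Fin l) (x : SlSpinPoint l) : ℂ :=
  deriv (fun s => f { x with p := Function.update x.p j s }) (x.p j)

/-- `∂f/∂F_{jk}` -/
def dF (f : SlSpinPoint l → ℂ) (j k : Fin l) (x : SlSpinPoint l) : ℂ :=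
  deriv (fun s => f { x with F := Function.update x.F j (Function.update (x.F j) k s) }) (x.F j k)

/-- The Hamiltonian `½ ∑ p_j² - ½ ∑_{j ≠ k} ℘(q_j - q_k) F_{jk} F_{kj}`. -/
def hamiltonian (τ : ℂ) (x : SlSpinPoint l) : ℂ :=
  1 / 2 * ∑ j, x.p j ^ 2
    - 1 / 2 * ∑ j, ∑ k, if j = k then 0 else wpFun τ (x.q j - x.q k) * x.F j k * x.F k j

/-- `{F_{jk}, f}`, with the Kostant-Kirillov brackets
`{F_{jk}, F_{mn}} = δ_{mk} F_{jn} - δ_{jn} F_{mk}`. -/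
def bracketF (j k : Fin l) (f : SlSpinPoint l → ℂ) (x : SlSpinPoint l) : ℂ :=
  ∑ m, ∑ n, ((if m = k then x.F j n else 0) - (if j = n then x.F m k else 0)) * dF f m n x

/-- `x(τ)`, `τ ∈ U`, is a holomorphic solution of the non-autonomous constrained Hamiltonian
system: `2 π i d/dτ = {· , ℋ}` on the constraint surface `F_{jj} = 0` (and off the singularities
`q_j - q_k ∈ ℤ + ℤ τ` of the Hamiltonian). -/
structure IsSolution (U : Set ℂ) (x : ℂ → SlSpinPoint l) : Prop where
  regular : ∀ τ ∈ U, ∀ j k, j ≠ k → (x τ).q j - (x τ).q k ∉ periodLattice τ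
  constraint : ∀ τ ∈ U, ∀ j, (x τ).F j j = 0
  deriv_q : ∀ τ ∈ U, ∀ j, TwoPiIDeriv (fun t => (x t).q j) (dp (hamiltonian τ) j (x τ)) τ
  deriv_p : ∀ τ ∈ U, ∀ j, TwoPiIDeriv (fun t => (x t).p j) (-dq (hamiltonian τ) j (x τ)) τ
  deriv_F : ∀ τ ∈ U, ∀ j k,
    TwoPiIDeriv (fun t => (x t).F j k) (bracketF j k (hamiltonian τ) (x τ)) τ

/-- The equations of motion in explicit form. -/
structure EquationsOfMotion (U : Set ℂ) (x : ℂ → SlSpinPoint l) : Prop where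
  deriv_q : ∀ τ ∈ U, ∀ j, TwoPiIDeriv (fun t => (x t).q j) ((x τ).p j) τ
  deriv_p : ∀ τ ∈ U, ∀ j, TwoPiIDeriv (fun t => (x t).p j)
    (∑ k, if k = j then 0 else
      deriv (wpFun τ) ((x τ).q j - (x τ).q k) * (x τ).F j k * (x τ).F k j) τ
  deriv_F : ∀ τ ∈ U, ∀ j k, TwoPiIDeriv (fun t => (x t).F j k)
    ((∑ m, if m = j then 0 else wpFun τ ((x τ).q j - (x τ).q m) * (x τ).F j m * (x τ).F m k)
      - ∑ m, if m = k then 0 else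
          wpFun τ ((x τ).q m - (x τ).q k) * (x τ).F j m * (x τ).F m k) τ

/-- `L(z) = ∑ p_j E_{jj} + ∑_{j ≠ k} σ(q_j - q_k, z) F_{kj} E_{jk}`. -/
def laxL (x : ℂ → SlSpinPoint l) (τ z : ℂ) : Matrix (Fin l) (Fin l) ℂ :=
  Matrix.of fun j k => if j = k then (x τ).p j
    else sigmaFun τ ((x τ).q j - (x τ).q k) z * (x τ).F k j

/-- `M(z) = - ∑_{j ≠ k} σ(q_j - q_k, z) (ρ(q_j - q_k) + ρ(z - q_j + q_k)) F_{kj} E_{jk}`,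
holomorphically extended across the removable singularities `z ∈ q_j - q_k + ℤ + ℤ τ`. -/
def laxM (x : ℂ → SlSpinPoint l) (τ z : ℂ) : Matrix (Fin l) (Fin l) ℂ :=
  Matrix.of fun j k => if j = k then 0
    else dSigmaFun τ ((x τ).q j - (x τ).q k) z * (x τ).F k j

/-- The formula for `M(z)` in terms of `σ` and `ρ`, valid off the removable singularities. -/
def LaxMFormula (U : Set ℂ) (x : ℂ → SlSpinPoint l) : Prop :=
  ∀ τ ∈ U, ∀ z, z ∉ periodLattice τ →
    (∀ j k, j ≠ k → z - ((x τ).q j - (x τ).q k) ∉ periodLattice τ) →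
    laxM x τ z = Matrix.of fun j k => if j = k then 0
      else -(sigmaFun τ ((x τ).q j - (x τ).q k) z *
        (rhoFun τ ((x τ).q j - (x τ).q k) + rhoFun τ (z - (x τ).q j + (x τ).q k)) * (x τ).F k j)

end SlSpinPoint

end

/-! The (irrelevant) choice of a norm on the algebra of matrices. -/

attribute [local instance] Matrix.linftyOpNormedRing Matrix.linftyOpNormedAlgebra

/-! The proof has an analytic half (identities for `σ`), an algebraic half (the commutator `[L,
M]`), and a general theorem that Lax pairs on the torus are isomonodromic.

The identities come from Liouville's theorem on the torus. A function holomorphic off the lattice,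
bounded near `0` and of doubly periodic absolute value is constant (`eq_of_norm_periodic`); with
multipliers `1` and `exp (2πi w)`, `w` not a period, it vanishes (`eq_zero_of_quasiperiodic`).
Comparison with the triple product locates the zeros of `θ₁`, all of them on the lattice. Comparing
multipliers and principal parts then gives `σ(u,z)σ(-u,z) = ℘(z) - ℘(u)`, its `u`-derivative, the
addition formula `sigmaFun_mul_dSigmaFun_sub`, and the heat equation `sigmaFun_heat`; the latter
holds because the principal part `1/z` of `σ` depends neither on `u` nor on `τ`.

In the Lax equation the heat equation cancels `∂M/∂z` against the explicit `τ`-dependence of `L`.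
The Cartan part of `[L, M]` is the force on `p`, by the `℘'` identity; the root part is the equation
for `F`, by the addition formula and the symmetries of `N` (`RootBasis.lie_lax`,
`SlSpinPoint.lax_commutator_apply`).

For isomonodromy, the Lax equation is the integrability condition of `∂Y/∂z = L Y`, `2πi ∂Y/∂τ = -M
Y`. Hence local joint solutions with any initial value exist (`IsLaxPair.exists_isJointNear`), and
any solution is a fundamental one times a right factor constant in both variables. Joint solutions
continue along a cycle simultaneously for all nearby `τ` (`IsLaxPair.exists_continuesTo`). By
quasi-periodicity `exp (-2πi n Q) Y(z + m + nτ)` is again a joint solution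
(`IsLaxPair.isJointNear_translate`), so it equals `Y Γ` with `Γ` locally independent of `τ`.
Connectedness of `U` globalizes this. -/

noncomputable section

/-! ## Holomorphic functions of two variables -/

section TwoVariables

open Metric

/-- A continuous function into a Banach space is analytic if its compositions with a separating
family of continuous linear maps are. -/
theorem analyticOnNhd_ball_of_separating {G F κ : Type*} [NormedAddCommGroup G] [NormedSpace ℂ G]
    [CompleteSpace G] [NormedAddCommGroup F] [NormedSpace ℂ F] [CompleteSpace F]
    (ev : κ → G →L[ℂ] F) (hsep : ∀ g g' : G, (∀ k, ev k g = ev k g') → g = g')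
    {f : ℂ → G} {c : ℂ} {R : ℝ} (hR : 0 < R) (hc : ContinuousOn f (closedBall c R))
    (hd : ∀ k, DifferentiableOn ℂ (fun t => ev k (f t)) (closedBall c R)) :
    AnalyticOnNhd ℂ f (ball c R) := by
  lift R to NNReal using hR.le
  have hci : CircleIntegrable f c R :=
    ContinuousOn.circleIntegrable hR.le (hc.mono sphere_subset_closedBall)
  have hps := hasFPowerSeriesOn_cauchy_integral hci (by exact_mod_cast hR)
  -- The Cauchy integral of a merely continuous function is analytic inside the circle. Cauchy's
  -- formula holds after each `ev k`, and these separate points, so the integral is `f` itself.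
  have heq : Set.EqOn (fun w => (2 * Real.pi * I : ℂ)⁻¹ • ∮ z in C(c, R), (z - w)⁻¹ • f z) f
      (ball c R) := by
    intro w hw
    apply hsep
    intro k
    have h1 := DifferentiableOn.circleIntegral_sub_inv_smul (hd k) hw
    have h2 : ev k (∮ z in C(c, R), (z - w)⁻¹ • f z) = ∮ z in C(c, R), (z - w)⁻¹ • ev k (f z) := by
      simp only [circleIntegral]
      rw [← ContinuousLinearMap.intervalIntegral_comp_comm]
      · simp
      · have : CircleIntegrable (fun z => (z - w)⁻¹ • f z) c R := by
          refine ContinuousOn.circleIntegrable hR.le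
            (ContinuousOn.smul ?_ (hc.mono sphere_subset_closedBall))
          refine ContinuousOn.inv₀ (by fun_prop) fun z hz h => ?_
          rw [sub_eq_zero.1 h] at hz
          exact absurd (mem_sphere.1 hz) (mem_ball.1 hw).ne
        exact this.out
    simp only [map_smul, h2, h1]
    rw [smul_smul, inv_mul_cancel₀ (by simp [Real.pi_ne_zero]), one_smul]
  have h3 : AnalyticOnNhd ℂ (fun w => (2 * Real.pi * I : ℂ)⁻¹ • ∮ z in C(c, R), (z - w)⁻¹ • f z)
      (ball c R) := by
    have := hps.analyticOnNhd
    simpa [Metric.eball_coe] using this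
  exact h3.congr isOpen_ball heq

variable {E : Type*} [NormedRing E] [NormedAlgebra ℂ E]

/-- The integral over a circle as a continuous linear map. -/
def circleIntegralCLM (c : ℂ) (R : ℝ) (hR : 0 ≤ R) : C(sphere c R, E) →L[ℂ] E :=
  LinearMap.mkContinuous
    { toFun := fun h => ∫ θ : ℝ in (0)..2 * Real.pi,
        deriv (circleMap c R) θ • h ⟨circleMap c R θ, circleMap_mem_sphere c hR θ⟩
      map_add' := fun h h' => by
        rw [← intervalIntegral.integral_add]
        · simp
        all_goals
          refine Continuous.intervalIntegrable ?_ _ _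
          simp only [deriv_circleMap]
          fun_prop
      map_smul' := fun a h => by
        rw [RingHom.id_apply, ← intervalIntegral.integral_smul]
        simp only [ContinuousMap.smul_apply, smul_comm a] }
    (R * |2 * Real.pi - 0|) (fun h => by
      have : ∀ θ ∈ Set.uIoc 0 (2 * Real.pi), ‖deriv (circleMap c R) θ •
          h ⟨circleMap c R θ, circleMap_mem_sphere c hR θ⟩‖ ≤ R * ‖h‖ := by
        intro θ _
        rw [norm_smul]
        gcongr
        · simp [deriv_circleMap, abs_of_nonneg hR]
        · exact h.norm_coe_le_norm _
      refine (intervalIntegral.norm_integral_le_of_norm_le_const this).trans (le_of_eq ?_)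
      ring)

theorem circleIntegralCLM_apply (c : ℂ) (R : ℝ) (hR : 0 ≤ R) (h : C(sphere c R, E)) (f : ℂ → E)
    (hf : ∀ w : sphere c R, f w = h w) : circleIntegralCLM c R hR h = ∮ w in C(c, R), f w := by
  simp only [circleIntegralCLM, circleIntegral]
  exact intervalIntegral.integral_congr fun θ _ => by
    have := hf ⟨circleMap c R θ, circleMap_mem_sphere c hR θ⟩
    simp only at this
    simp [this]

variable [CompleteSpace E]

/-- The Cauchy integral of a function depending holomorphically on a parameter is jointly
analytic. -/
theorem analyticAt_cauchy_integral {f : ℂ × ℂ → E} {a c : ℂ} {r R : ℝ} (hr : 0 < r) (hR : 0 < R)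
    (hc : ContinuousOn f (closedBall a r ×ˢ sphere c R))
    (hd : ∀ w ∈ sphere c R, DifferentiableOn ℂ (fun t => f (t, w)) (closedBall a r))
    {z : ℂ} (hz : z ∈ ball c R) :
    AnalyticAt ℂ (fun x : ℂ × ℂ => ∮ w in C(c, R), (w - x.2)⁻¹ • f (x.1, w)) (a, z) := by
  classical
  -- The integrand becomes a product in the Banach algebra `C(sphere c R, E)`: `F` carries the
  -- parameter and is holomorphic because evaluations separate, and integration is a continuous
  -- linear map.
  let F' : C(closedBall a r × sphere c R, E) :=
    ⟨fun x => f (x.1, x.2), hc.comp_continuous (by fun_prop) fun x => ⟨x.1.2, x.2.2⟩⟩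
  let F : ℂ → C(sphere c R, E) := fun t =>
    if h : t ∈ closedBall a r then F'.curry ⟨t, h⟩ else 0
  have hFap : ∀ t ∈ closedBall a r, ∀ w, F t w = f (t, w) := by
    intro t ht w
    simp only [F, dif_pos ht]
    rfl
  have hFc : ContinuousOn F (closedBall a r) := by
    rw [continuousOn_iff_continuous_domRestrict]
    refine F'.curry.continuous.congr fun x => ?_
    simp only [F, Set.domRestrict_apply, dif_pos x.2]
  have hFa : AnalyticAt ℂ F a := by
    refine analyticOnNhd_ball_of_separating (fun w : sphere c R =>
      (ContinuousMap.evalCLM ℂ w : C(sphere c R, E) →L[ℂ] E))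
      (fun g g' h => ContinuousMap.ext h) hr hFc (fun w => ?_) a (mem_ball_self hr)
    exact (hd w w.2).congr fun t ht => hFap t ht w
  let ι : C(sphere c R, E) := ⟨fun w => algebraMap ℂ E w, by fun_prop⟩
  -- The function `w ↦ w - x` on the circle, affine in `x`. The Cauchy kernel is its `Ring.inverse`,
  -- so it is analytic in `x` because inversion in a Banach algebra is.
  let S : ℂ → C(sphere c R, E) := fun x => ι - algebraMap ℂ _ x
  have hSu : ∀ x ∈ ball c R, IsUnit (S x) := by
    intro x hx
    have hne : ∀ w : sphere c R, (w : ℂ) - x ≠ 0 := by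
      intro w h
      rw [sub_eq_zero] at h
      have := w.2
      rw [h] at this
      exact absurd (mem_sphere.1 this) (mem_ball.1 hx).ne
    let T : C(sphere c R, E) := ⟨fun w => algebraMap ℂ E ((w : ℂ) - x)⁻¹, by
      refine (algebraMapCLM ℂ E).continuous.comp (Continuous.inv₀ (by fun_prop) hne)⟩
    refine ⟨⟨S x, T, ?_, ?_⟩, rfl⟩ <;> ext w <;>
    · simp only [S, T, ι, ContinuousMap.mul_apply, ContinuousMap.sub_apply, ContinuousMap.coe_mk,
        ContinuousMap.one_apply, ContinuousMap.smul_apply, Algebra.algebraMap_eq_smul_one]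
      rw [← sub_smul]
      simp [smul_smul, hne w]
  have hSinv : ∀ x ∈ ball c R, ∀ w : sphere c R,
      Ring.inverse (S x) w = algebraMap ℂ E ((w : ℂ) - x)⁻¹ := by
    intro x hx w
    have h1 := congrArg (fun g : C(sphere c R, E) => g w) (Ring.inverse_mul_cancel _ (hSu x hx))
    simp only [S, ι, ContinuousMap.mul_apply, ContinuousMap.sub_apply, ContinuousMap.coe_mk,
        ContinuousMap.one_apply, ContinuousMap.smul_apply, Algebra.algebraMap_eq_smul_one] at h1
    rw [← sub_smul] at h1
    have hne : (w : ℂ) - x ≠ 0 := by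
      intro h
      rw [sub_eq_zero] at h
      have := w.2
      rw [h] at this
      exact absurd (mem_sphere.1 this) (mem_ball.1 hx).ne
    rw [mul_smul_comm, mul_one] at h1
    rw [Algebra.algebraMap_eq_smul_one, ← h1, smul_smul, inv_mul_cancel₀ hne, one_smul]
    simp [S, ι, Algebra.algebraMap_eq_smul_one]
  have hSa : AnalyticAt ℂ (fun x => Ring.inverse (S x)) z := by
    obtain ⟨u, hu⟩ := hSu z hz
    have h1 : AnalyticAt ℂ S z := by
      refine analyticAt_const.sub ?_
      exact (algebraMapCLM ℂ C(sphere c R, E)).analyticAt z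
    have h2 : AnalyticAt ℂ Ring.inverse (S z) := hu ▸ analyticAt_inverse u
    exact h2.comp h1
  have hprod : AnalyticAt ℂ (fun x : ℂ × ℂ =>
      circleIntegralCLM c R hR.le (Ring.inverse (S x.2) * F x.1)) (a, z) := by
    have h1 : AnalyticAt ℂ (fun x : ℂ × ℂ => Ring.inverse (S x.2)) (a, z) :=
      AnalyticAt.fun_comp (g := fun x => Ring.inverse (S x)) (f := fun x : ℂ × ℂ => x.2) hSa analyticAt_snd
    have h2 : AnalyticAt ℂ (fun x : ℂ × ℂ => F x.1) (a, z) :=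
      AnalyticAt.fun_comp (f := fun x : ℂ × ℂ => x.1) hFa analyticAt_fst
    exact ((circleIntegralCLM c R hR.le).analyticAt _).comp (h1.mul h2)
  refine hprod.congr ?_
  have hn : ball a r ×ˢ ball c R ∈ 𝓝 (a, z) :=
    prod_mem_nhds (ball_mem_nhds a hr) (isOpen_ball.mem_nhds hz)
  filter_upwards [hn] with x hx
  refine circleIntegralCLM_apply c R hR.le _ _ fun w => ?_
  rw [ContinuousMap.mul_apply, hSinv _ hx.2, hFap _ (ball_subset_closedBall hx.1),
    Algebra.algebraMap_eq_smul_one, smul_mul_assoc, one_mul]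

theorem exists_closedBall_prod_subset {D : Set (ℂ × ℂ)} {a b : ℂ} (hD : D ∈ 𝓝 (a, b)) :
    ∃ R > 0, closedBall a R ×ˢ closedBall b R ⊆ D := by
  obtain ⟨R, hR, h⟩ := nhds_basis_closedBall.mem_iff.1 hD
  exact ⟨R, hR, by rwa [closedBall_prod_same]⟩

/-- Osgood's lemma. -/
theorem analyticAt_of_continuousOn_of_separately_differentiable {f : ℂ × ℂ → E} {D : Set (ℂ × ℂ)}
    {x : ℂ × ℂ} (hD : D ∈ 𝓝 x) (hc : ContinuousOn f D)
    (h₁ : ∀ y ∈ D, DifferentiableAt ℂ (fun t => f (t, y.2)) y.1)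
    (h₂ : ∀ y ∈ D, DifferentiableAt ℂ (fun w => f (y.1, w)) y.2) : AnalyticAt ℂ f x := by
  obtain ⟨a, b⟩ := x
  obtain ⟨R, hR, hsub⟩ := exists_closedBall_prod_subset hD
  -- Cauchy's formula in the second variable only; the first is treated as the parameter.
  have h := (analyticAt_cauchy_integral (E := E) (f := f) (a := a) (c := b) hR hR
    (hc.mono ((Set.prod_mono_right sphere_subset_closedBall).trans hsub))
    (fun w hw t ht => (h₁ (t, w) (hsub ⟨ht, sphere_subset_closedBall hw⟩)).differentiableWithinAt)
    (mem_ball_self hR)).const_smul (c := (2 * Real.pi * I : ℂ)⁻¹)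
  refine h.congr ?_
  filter_upwards [prod_mem_nhds (ball_mem_nhds a hR) (ball_mem_nhds b hR)] with y hy
  have := DifferentiableOn.circleIntegral_sub_inv_smul (f := fun w => f (y.1, w)) (c := b) (R := R)
    (w := y.2) (fun w hw =>
      (h₂ (y.1, w) (hsub ⟨ball_subset_closedBall hy.1, hw⟩)).differentiableWithinAt) hy.2
  simp only [Pi.smul_apply, this]
  rw [smul_smul, inv_mul_cancel₀ (by simp [Real.pi_ne_zero]), one_smul]

/-- A jointly analytic function vanishing for `z = 0` is divisible by `z`. -/
theorem exists_analyticAt_eq_smul {f : ℂ × ℂ → E} {a : ℂ} (hf : AnalyticAt ℂ f (a, 0))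
    (h0 : ∀ᶠ t in 𝓝 a, f (t, 0) = 0) :
    ∃ g : ℂ × ℂ → E, AnalyticAt ℂ g (a, 0) ∧ ∀ᶠ x in 𝓝 (a, (0 : ℂ)), f x = x.2 • g x := by
  have hD : {x : ℂ × ℂ | AnalyticAt ℂ f x ∧ f (x.1, 0) = 0} ∈ 𝓝 (a, (0 : ℂ)) :=
    hf.eventually_analyticAt.and ((continuous_fst.tendsto (a, (0 : ℂ))).eventually h0)
  obtain ⟨R, hR, hsub⟩ := exists_closedBall_prod_subset hD
  have hwne : ∀ w ∈ sphere (0 : ℂ) R, w ≠ 0 := by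
    rintro w hw rfl
    simp at hw
    exact hR.ne hw
  -- The quotient is defined as the Cauchy integral of `f (t, w) / w`, which makes sense at `z = 0`.
  -- On the circle this integrand is that of `dslope`, so Cauchy's formula identifies the two.
  have h := (analyticAt_cauchy_integral (E := E) (f := fun x => (x.2)⁻¹ • f x) (a := a) (c := 0)
    hR hR (ContinuousOn.smul (ContinuousOn.inv₀ (by fun_prop) fun x hx => hwne _ hx.2)
      fun x hx => (hsub ⟨hx.1, sphere_subset_closedBall hx.2⟩).1.continuousAt.continuousWithinAt)
    (fun w hw t ht => ((AnalyticAt.fun_comp (f := fun t : ℂ => (t, w))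
        (hsub (show (t, w) ∈ _ from ⟨ht, sphere_subset_closedBall hw⟩)).1
        (by fun_prop)).differentiableAt.fun_const_smul
          w⁻¹).differentiableWithinAt)
    (mem_ball_self hR)).const_smul (c := (2 * Real.pi * I : ℂ)⁻¹)
  refine ⟨_, h, ?_⟩
  filter_upwards [prod_mem_nhds (ball_mem_nhds a hR) (ball_mem_nhds (0 : ℂ) hR)] with y hy
  have hy0 : f (y.1, 0) = 0 :=
    (hsub (show (y.1, (0 : ℂ)) ∈ _ from ⟨ball_subset_closedBall hy.1, mem_closedBall_self hR.le⟩)).2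
  have hdiff : DifferentiableOn ℂ (fun w => f (y.1, w)) (closedBall 0 R) := fun w hw =>
    (AnalyticAt.fun_comp (f := fun w : ℂ => (y.1, w))
        (hsub (show (y.1, w) ∈ _ from ⟨ball_subset_closedBall hy.1, hw⟩)).1
        (by fun_prop)).differentiableAt.differentiableWithinAt
  have hds : DifferentiableOn ℂ (dslope (fun w => f (y.1, w)) 0) (closedBall 0 R) :=
    (differentiableOn_dslope (closedBall_mem_nhds 0 hR)).2 hdiff
  have hI := DifferentiableOn.circleIntegral_sub_inv_smul hds hy.2
  have hcongr : (∮ w in C(0, R), (w - y.2)⁻¹ • (w⁻¹ • f (y.1, w))) =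
      ∮ w in C(0, R), (w - y.2)⁻¹ • dslope (fun w => f (y.1, w)) 0 w := by
    refine circleIntegral.integral_congr hR.le fun w hw => ?_
    simp only [dslope_of_ne _ (hwne w hw), slope, hy0, vsub_eq_sub, sub_zero]
  simp only [Pi.smul_apply, hcongr, hI]
  rw [smul_smul (2 * Real.pi * I : ℂ)⁻¹, inv_mul_cancel₀ (by simp [Real.pi_ne_zero]), one_smul]
  have := sub_smul_dslope (fun w => f (y.1, w)) 0 y.2
  simp only [sub_zero, hy0] at this
  exact this.symm

end TwoVariables

/-! ## The period lattice and Liouville's theorem -/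

section Lattice

open Asymptotics

theorem neg_mem_periodLattice {τ z : ℂ} (h : z ∈ periodLattice τ) : -z ∈ periodLattice τ := by
  obtain ⟨m, n, rfl⟩ := h
  exact ⟨-m, -n, by push_cast; ring⟩

theorem add_mem_periodLattice {τ z w : ℂ} (h : z ∈ periodLattice τ) (h' : w ∈ periodLattice τ) :
    z + w ∈ periodLattice τ := by
  obtain ⟨m, n, rfl⟩ := h
  obtain ⟨m', n', rfl⟩ := h'
  exact ⟨m + m', n + n', by push_cast; ring⟩

theorem neg_mem_periodLattice_iff {τ z : ℂ} : -z ∈ periodLattice τ ↔ z ∈ periodLattice τ :=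
  ⟨fun h => by simpa using neg_mem_periodLattice h, neg_mem_periodLattice⟩

theorem add_mem_periodLattice_iff {τ z w : ℂ} (h : w ∈ periodLattice τ) :
    z + w ∈ periodLattice τ ↔ z ∈ periodLattice τ :=
  ⟨fun h' => by simpa using add_mem_periodLattice h' (neg_mem_periodLattice h),
    fun h' => add_mem_periodLattice h' h⟩

theorem one_mem_periodLattice (τ : ℂ) : (1 : ℂ) ∈ periodLattice τ := ⟨1, 0, by simp⟩

theorem self_mem_periodLattice (τ : ℂ) : τ ∈ periodLattice τ := ⟨0, 1, by simp⟩

theorem int_mem_periodLattice (τ : ℂ) (m n : ℤ) : (m + n * τ : ℂ) ∈ periodLattice τ := ⟨m, n, rfl⟩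

theorem linearIndependent_one_tau {τ : ℂ} (hτ : 0 < τ.im) :
    LinearIndependent ℝ ![(1 : ℂ), τ] := by
  rw [LinearIndependent.pair_iff]
  intro s t h
  have h1 := congrArg Complex.im h
  have h2 := congrArg Complex.re h
  simp at h1 h2
  rcases h1 with h1 | h1
  · subst h1
    simpa using h2
  · exact absurd h1 hτ.ne'

/-- The period pair `(1, τ)`. -/
def tauPeriodPair {τ : ℂ} (hτ : 0 < τ.im) : PeriodPair :=
  PeriodPair.mk 1 τ (linearIndependent_one_tau hτ)

theorem wpFun_eq {τ : ℂ} (hτ : 0 < τ.im) (u : ℂ) :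
    wpFun τ u = (tauPeriodPair hτ).weierstrassP u := by
  rw [wpFun, dif_pos (linearIndependent_one_tau hτ)]
  rfl

theorem mem_lattice_iff {τ : ℂ} (hτ : 0 < τ.im) (z : ℂ) :
    z ∈ (tauPeriodPair hτ).lattice ↔ z ∈ periodLattice τ := by
  rw [PeriodPair.mem_lattice]
  simp only [tauPeriodPair, periodLattice, Set.mem_ofPred_eq, mul_one, eq_comm]

theorem coe_lattice {τ : ℂ} (hτ : 0 < τ.im) :
    ((tauPeriodPair hτ).lattice : Set ℂ) = periodLattice τ :=
  Set.ext fun z => mem_lattice_iff hτ z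

theorem isClosed_periodLattice {τ : ℂ} (hτ : 0 < τ.im) : IsClosed (periodLattice τ) := by
  rw [← coe_lattice hτ]
  exact (tauPeriodPair hτ).isClosed_lattice

theorem eventually_notMem_periodLattice {τ : ℂ} (hτ : 0 < τ.im) (z : ℂ) :
    ∀ᶠ w in 𝓝[≠] z, w ∉ periodLattice τ := by
  have h := (tauPeriodPair hτ).compl_lattice_sdiff_singleton_mem_nhds z
  rw [coe_lattice] at h
  filter_upwards [mem_nhdsWithin_of_mem_nhds h, self_mem_nhdsWithin] with w hw hwz hw'
  exact hw ⟨hw', hwz⟩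

/-- Every complex number is congruent modulo the period lattice to a point of the fundamental
parallelogram. -/
theorem exists_int_sub_mem_parallelogram {τ : ℂ} (hτ : 0 < τ.im) (z : ℂ) : ∃ m n : ℤ,
    z - (m + n * τ) ∈ (fun a : ℝ × ℝ => torusPoint τ a) '' (Set.Icc 0 1 ×ˢ Set.Icc 0 1) := by
  set y : ℝ := z.im / τ.im with hy
  set x : ℝ := z.re - y * τ.re with hx
  have hz : z = x + y * τ := by
    apply Complex.ext
    · simp [hx]
    · simp [hy, hτ.ne']
  refine ⟨⌊x⌋, ⌊y⌋, (Int.fract x, Int.fract y), ⟨⟨Int.fract_nonneg _, (Int.fract_lt_one _).le⟩,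
    ⟨Int.fract_nonneg _, (Int.fract_lt_one _).le⟩⟩, ?_⟩
  simp only [torusPoint]
  have h1 : (x : ℂ) = ⌊x⌋ + Int.fract x := by exact_mod_cast (Int.floor_add_fract x).symm
  have h2 : (y : ℂ) = ⌊y⌋ + Int.fract y := by exact_mod_cast (Int.floor_add_fract y).symm
  linear_combination -h1 - τ * h2 - hz

theorem periodic_of_one_tau {α : Type*} {τ : ℂ} {f : ℂ → α}
    (h1 : ∀ z, z ∉ periodLattice τ → f (z + 1) = f z)
    (hτ : ∀ z, z ∉ periodLattice τ → f (z + τ) = f z) (m n : ℤ) :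
    ∀ z, z ∉ periodLattice τ → f (z + (m + n * τ)) = f z := by
  have key : ∀ w, w ∈ periodLattice τ → (∀ z, z ∉ periodLattice τ → f (z + w) = f z) →
      ∀ k : ℤ, ∀ z, z ∉ periodLattice τ → f (z + k * w) = f z := by
    intro w hw h k
    have hk : ∀ k : ℤ, (k * w : ℂ) ∈ periodLattice τ := by
      obtain ⟨a, b, rfl⟩ := hw
      exact fun k => ⟨k * a, k * b, by push_cast; ring⟩
    induction k using Int.induction_on with
    | zero => intro z _; simp
    | succ i ih =>
      intro z hz
      rw [← ih z hz, ← h (z + (i : ℤ) * w) (by rwa [add_mem_periodLattice_iff (hk _)])]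
      push_cast
      ring_nf
    | pred i ih =>
      intro z hz
      rw [← ih z hz, ← h (z + ((-(i : ℤ) - 1 : ℤ) : ℂ) * w)
        (by rwa [add_mem_periodLattice_iff (hk _)])]
      push_cast
      ring_nf
  intro z hz
  have e1 : ((m : ℂ)) ∈ periodLattice τ := ⟨m, 0, by simp⟩
  rw [← add_assoc, key τ (self_mem_periodLattice τ) hτ n _
    (by rwa [add_mem_periodLattice_iff e1]), ← mul_one (m : ℂ),
    key 1 (one_mem_periodLattice τ) h1 m z hz]

/-- Liouville's theorem: a function that is holomorphic outside the period lattice, bounded near `0`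
and of doubly periodic absolute value, is constant. -/
theorem eq_of_norm_periodic {τ : ℂ} (hτ : 0 < τ.im) {f : ℂ → ℂ}
    (hd : ∀ z, z ∉ periodLattice τ → DifferentiableAt ℂ f z)
    (h1 : ∀ z, z ∉ periodLattice τ → ‖f (z + 1)‖ = ‖f z‖)
    (h2 : ∀ z, z ∉ periodLattice τ → ‖f (z + τ)‖ = ‖f z‖)
    (h0 : f =O[𝓝[≠] 0] (fun _ => (1 : ℝ))) :
    ∀ z w, z ∉ periodLattice τ → w ∉ periodLattice τ → f z = f w := by
  classical
  have hper := periodic_of_one_tau (f := fun z => ‖f z‖) h1 h2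
  -- Periodicity of the norm carries boundedness near `0` to every lattice point, so all
  -- singularities are removable.
  have hbdd : ∀ c ∈ periodLattice τ, f =O[𝓝[≠] c] (fun _ => (1 : ℝ)) := by
    rintro c ⟨m, n, rfl⟩
    have ht : Tendsto (fun z : ℂ => z - (m + n * τ)) (𝓝[≠] (m + n * τ : ℂ)) (𝓝[≠] 0) := by
      refine tendsto_nhdsWithin_iff.2 ⟨?_, ?_⟩
      · have : ContinuousAt (fun z : ℂ => z - (m + n * τ)) (m + n * τ) := by fun_prop
        simpa using this.tendsto.mono_left nhdsWithin_le_nhds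
      · filter_upwards [self_mem_nhdsWithin] with z hz
        simpa [sub_eq_zero] using hz
    refine isBigO_norm_left.1
      ((isBigO_norm_left.2 (h0.comp_tendsto ht)).congr' ?_ EventuallyEq.rfl)
    filter_upwards [eventually_notMem_periodLattice hτ (m + n * τ)] with z hz
    have hz' : z - (m + n * τ) ∉ periodLattice τ := by
      rwa [sub_eq_add_neg, add_mem_periodLattice_iff (neg_mem_periodLattice ⟨m, n, rfl⟩)]
    simpa using (hper m n _ hz').symm
  -- The entire extension of `f`, with limits as values at the lattice points.
  let g : ℂ → ℂ := fun z => if z ∈ periodLattice τ then limUnder (𝓝[≠] z) f else f z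
  have hgf : ∀ z, z ∉ periodLattice τ → g z = f z := fun z hz => if_neg hz
  have hgd : Differentiable ℂ g := by
    intro z
    by_cases hz : z ∈ periodLattice τ
    · have hs := eventually_notMem_periodLattice hτ z
      have hs' : insert z {w | w ∉ periodLattice τ} ∈ 𝓝 z := by
        rw [insert_mem_nhds_iff]; exact hs
      have := differentiableOn_update_limUnder_insert_of_isLittleO (f := f) hs
        (fun w hw => (hd w hw).differentiableWithinAt) ?_
      · have h3 := this.differentiableAt hs'
        refine h3.congr_of_eventuallyEq ?_
        filter_upwards [hs'] with w hw
        rcases hw with rfl | hw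
        · simp [g, hz]
        · have : w ≠ z := fun h => hw (h ▸ hz)
          rw [Function.update_of_ne this, hgf w hw]
      · have h3 : (fun w => f w - f z) =O[𝓝[≠] z] (fun _ => (1 : ℝ)) :=
          (hbdd z hz).sub (isBigO_const_const _ one_ne_zero _)
        refine h3.trans_isLittleO ?_
        rw [isLittleO_const_left]
        right
        have : Tendsto (fun w : ℂ => w - z) (𝓝[≠] z) (𝓝[≠] 0) := by
          refine tendsto_nhdsWithin_iff.2 ⟨?_, ?_⟩
          · have : ContinuousAt (fun w : ℂ => w - z) z := by fun_prop
            simpa using this.tendsto.mono_left nhdsWithin_le_nhds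
          · filter_upwards [self_mem_nhdsWithin] with w hw
            simpa [sub_eq_zero] using hw
        exact (tendsto_norm_inv_nhdsNE_zero_atTop).comp this
    · refine (hd z hz).congr_of_eventuallyEq ?_
      filter_upwards [(isClosed_periodLattice hτ).isOpen_compl.mem_nhds hz] with w hw
      exact hgf w hw
  -- A bound on one period parallelogram bounds `g` off the lattice by periodicity of the norm, and
  -- then everywhere by continuity.
  have hK : IsCompact ((fun a : ℝ × ℝ => torusPoint τ a) '' (Set.Icc 0 1 ×ˢ Set.Icc 0 1)) := by
    refine (isCompact_Icc.prod isCompact_Icc).image ?_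
    unfold torusPoint
    fun_prop
  obtain ⟨C, hC⟩ := hK.exists_bound_of_continuousOn hgd.continuous.continuousOn
  have hfC : ∀ z, z ∉ periodLattice τ → ‖g z‖ ≤ C := by
    intro z hz
    obtain ⟨m, n, h⟩ := exists_int_sub_mem_parallelogram hτ z
    have hz' : z - (m + n * τ) ∉ periodLattice τ := by
      rw [sub_eq_add_neg, add_mem_periodLattice_iff (neg_mem_periodLattice ⟨m, n, rfl⟩)]
      exact hz
    have := hC _ h
    rw [hgf _ hz', ← hper m n _ hz'] at this
    rw [hgf _ hz]
    simpa using this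
  have hgC : ∀ z, ‖g z‖ ≤ C := by
    intro z
    have ht : Tendsto (fun w => ‖g w‖) (𝓝[≠] z) (𝓝 ‖g z‖) :=
      (hgd.continuous.norm.tendsto z).mono_left nhdsWithin_le_nhds
    exact le_of_tendsto ht ((eventually_notMem_periodLattice hτ z).mono hfC)
  intro z w hz hw
  rw [← hgf z hz, ← hgf w hw]
  refine hgd.apply_eq_apply_of_bounded ?_ z w
  rw [isBounded_iff_forall_norm_le]
  exact ⟨C, by rintro _ ⟨x, rfl⟩; exact hgC x⟩

/-- A function that is holomorphic outside the period lattice, bounded near `0` and quasi-periodic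
with multipliers `1` and `exp (2 π i w)` vanishes if `w` is not a period. -/
theorem eq_zero_of_quasiperiodic {τ : ℂ} (hτ : 0 < τ.im) {w : ℂ} (hw : w ∉ periodLattice τ)
    {f : ℂ → ℂ} (hd : ∀ z, z ∉ periodLattice τ → DifferentiableAt ℂ f z)
    (h1 : ∀ z, z ∉ periodLattice τ → f (z + 1) = f z)
    (h2 : ∀ z, z ∉ periodLattice τ → f (z + τ) = exp (2 * Real.pi * I * w) * f z)
    (h0 : f =O[𝓝[≠] 0] (fun _ => (1 : ℝ))) :
    ∀ z, z ∉ periodLattice τ → f z = 0 := by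
  -- `κ` is real, so `exp (iκz)` keeps its absolute value under `z ↦ z + 1`; under `z ↦ z + τ` it
  -- gains the factor `exp (-κ Im τ) = exp (2π Im w)`, which compensates `|exp (2πi w)|`.
  set κ : ℝ := - 2 * Real.pi * w.im / τ.im with hκ
  have hc : ∀ z, z ∉ periodLattice τ → ∀ z', z' ∉ periodLattice τ →
      exp (κ * I * z) * f z = exp (κ * I * z') * f z' := by
    intro z hz z' hz'
    refine eq_of_norm_periodic hτ (f := fun z => exp (κ * I * z) * f z)
      (fun z hz => ?_) (fun z hz => ?_) (fun z hz => ?_) ?_ z z' hz hz'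
    · have := hd z hz
      fun_prop
    · simp only [h1 z hz, norm_mul, norm_exp]
      simp
    · simp only [h2 z hz, norm_mul, norm_exp, ← mul_assoc, ← Real.exp_add]
      congr 2
      simp [hκ]
      field_simp
      ring
    · have : (fun z : ℂ => exp (κ * I * z)) =O[𝓝[≠] 0] (fun _ => (1 : ℝ)) := by
        refine Tendsto.isBigO_one ℝ (c := exp (κ * I * 0)) ?_
        exact (Continuous.tendsto (by fun_prop) (0 : ℂ)).mono_left nhdsWithin_le_nhds
      simpa using this.mul h0
  intro z hz
  -- If `f z ≠ 0`, constancy of `exp (iκz) f z` gives `exp (iκ) = 1` and `exp (iκτ + 2πi w) = 1`; so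
  -- `κ = 2πm` and `w = n - mτ` is a period.
  by_contra hne
  have a1 := hc (z + 1) (by rwa [add_mem_periodLattice_iff (one_mem_periodLattice τ)]) z hz
  have a2 := hc (z + τ) (by rwa [add_mem_periodLattice_iff (self_mem_periodLattice τ)]) z hz
  rw [h1 z hz, mul_left_inj' hne, mul_add, exp_add] at a1
  rw [h2 z hz, ← mul_assoc, mul_left_inj' hne, mul_add, exp_add, mul_assoc] at a2
  rw [mul_eq_left₀ (exp_ne_zero _), exp_eq_one_iff] at a1
  rw [mul_eq_left₀ (exp_ne_zero _), ← exp_add, exp_eq_one_iff] at a2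
  obtain ⟨m, hm⟩ := a1
  obtain ⟨n, hn⟩ := a2
  refine hw ⟨n, -m, ?_⟩
  have h2pi : (2 * Real.pi * I : ℂ) ≠ 0 := by simp [Real.pi_ne_zero]
  refine mul_left_cancel₀ h2pi ?_
  push_cast
  linear_combination hn - τ * hm

end Lattice

/-! ## The theta function -/

section Theta

open Asymptotics

/-- Expanding `(n + 1/2)²` shows that `θ₁` is an exponential times a translate of `jacobiTheta₂`,
from which it inherits its multipliers and its differentiability. -/
theorem theta1_eq (τ u : ℂ) : theta1 τ u =
    -(exp (Real.pi * I * τ / 4 + Real.pi * I * (u + 1 / 2)) *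
      jacobiTheta₂ (u + 1 / 2 + τ / 2) τ) := by
  rw [theta1, jacobiTheta₂, ← tsum_mul_left]
  congr 1
  refine tsum_congr fun n => ?_
  rw [jacobiTheta₂_term, ← exp_add]
  congr 1
  ring

theorem theta1_add_one (τ u : ℂ) : theta1 τ (u + 1) = -theta1 τ u := by
  rw [theta1_eq, theta1_eq, show u + 1 + 1 / 2 + τ / 2 = u + 1 / 2 + τ / 2 + 1 by ring,
    jacobiTheta₂_add_left, show Real.pi * I * τ / 4 + Real.pi * I * (u + 1 + 1 / 2) =
      Real.pi * I * τ / 4 + Real.pi * I * (u + 1 / 2) + Real.pi * I by ring,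
    exp_add _ (Real.pi * I), exp_pi_mul_I]
  ring

theorem theta1_add_tau (τ u : ℂ) :
    theta1 τ (u + τ) = -exp (-(Real.pi * I * τ) - 2 * Real.pi * I * u) * theta1 τ u := by
  rw [theta1_eq, theta1_eq, show u + τ + 1 / 2 + τ / 2 = u + 1 / 2 + τ / 2 + τ by ring,
    jacobiTheta₂_add_left', ← mul_assoc, ← exp_add]
  have h : ∀ a b c : ℂ, exp a = -(exp b * exp c) → ∀ j : ℂ,
      -(exp a * j) = - exp b * -(exp c * j) := by
    intro a b c h j
    rw [h]; ring
  refine h _ _ _ ?_ _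
  rw [← exp_add, ← exp_add_pi_mul_I, exp_eq_exp_iff_exists_int]
  exact ⟨-1, by push_cast; ring⟩

/-- The substitution `n ↦ -1 - n` changes the sign of `n + 1/2`. Corresponding exponents then differ
by an odd multiple of `πi`, whence the sign. -/
theorem theta1_neg (τ u : ℂ) : theta1 τ (-u) = -theta1 τ u := by
  rw [theta1, theta1, neg_inj, ← (Equiv.subLeft (-1 : ℤ)).tsum_eq (fun n : ℤ =>
    exp (Real.pi * I * τ * ((n : ℂ) + 1 / 2) ^ 2
    + 2 * Real.pi * I * ((n : ℂ) + 1 / 2) * (-u + 1 / 2))), ← tsum_neg]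
  refine tsum_congr fun n => ?_
  rw [← exp_add_pi_mul_I, exp_eq_exp_iff_exists_int]
  refine ⟨-n - 1, ?_⟩
  simp only [Equiv.subLeft_apply]
  push_cast
  ring

theorem theta1_zero (τ : ℂ) : theta1 τ 0 = 0 := by
  have := theta1_neg τ 0
  rw [neg_zero] at this
  exact self_eq_neg.1 this

theorem differentiableAt_theta1_uncurry {x : ℂ × ℂ} (hx : 0 < x.1.im) :
    DifferentiableAt ℂ (fun y : ℂ × ℂ => theta1 y.1 y.2) x := by
  simp only [theta1_eq]
  have h1 : DifferentiableAt ℂ (fun y : ℂ × ℂ => jacobiTheta₂ (y.2 + 1 / 2 + y.1 / 2) y.1) x :=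
    DifferentiableAt.fun_comp' (g := fun p : ℂ × ℂ => jacobiTheta₂ p.1 p.2)
      (f := fun y : ℂ × ℂ => (y.2 + 1 / 2 + y.1 / 2, y.1)) x
      (hasFDerivAt_jacobiTheta₂ _ hx).differentiableAt (by fun_prop)
  fun_prop

theorem isOpen_im_fst_pos : IsOpen {x : ℂ × ℂ | 0 < x.1.im} :=
  isOpen_lt continuous_const (continuous_im.comp continuous_fst)

theorem analyticAt_theta1_uncurry {x : ℂ × ℂ} (hx : 0 < x.1.im) :
    AnalyticAt ℂ (fun y : ℂ × ℂ => theta1 y.1 y.2) x := by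
  refine analyticAt_of_continuousOn_of_separately_differentiable (isOpen_im_fst_pos.mem_nhds hx)
    (fun y hy => (differentiableAt_theta1_uncurry hy).continuousAt.continuousWithinAt)
    (fun y hy => ?_) (fun y hy => ?_)
  · exact DifferentiableAt.fun_comp' (g := fun y : ℂ × ℂ => theta1 y.1 y.2) (f := fun t => (t, y.2))
      y.1 (differentiableAt_theta1_uncurry hy) (by fun_prop)
  · exact DifferentiableAt.fun_comp' (g := fun y : ℂ × ℂ => theta1 y.1 y.2) (f := fun t => (y.1, t))
      y.2 (differentiableAt_theta1_uncurry hy) (by fun_prop)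

theorem analyticAt_theta1 {τ : ℂ} (hτ : 0 < τ.im) (u : ℂ) : AnalyticAt ℂ (theta1 τ) u :=
  AnalyticAt.fun_comp (g := fun y : ℂ × ℂ => theta1 y.1 y.2) (f := fun t => (τ, t))
    (analyticAt_theta1_uncurry (x := (τ, u)) hτ) (by fun_prop)

theorem differentiable_theta1 {τ : ℂ} (hτ : 0 < τ.im) : Differentiable ℂ (theta1 τ) :=
  fun u => (analyticAt_theta1 hτ u).differentiableAt

theorem analyticAt_deriv_theta1_uncurry {x : ℂ × ℂ} (hx : 0 < x.1.im) :
    AnalyticAt ℂ (fun y : ℂ × ℂ => deriv (theta1 y.1) y.2) x := by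
  have h := (analyticAt_theta1_uncurry hx).fderiv
  have h2 : AnalyticAt ℂ (fun y => fderiv ℂ (fun y : ℂ × ℂ => theta1 y.1 y.2) y (0, 1)) x :=
    ((ContinuousLinearMap.apply ℂ ℂ ((0 : ℂ), (1 : ℂ))).analyticAt _).comp h
  refine h2.congr ?_
  filter_upwards [isOpen_im_fst_pos.mem_nhds hx] with y hy
  have h3 := (differentiableAt_theta1_uncurry hy).hasFDerivAt
  have h4 : HasDerivAt (fun t : ℂ => (y.1, t)) ((0 : ℂ), (1 : ℂ)) y.2 :=
    (hasDerivAt_const _ _).prodMk (hasDerivAt_id _)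
  exact (HasFDerivAt.comp_hasDerivAt (f := fun t : ℂ => (y.1, t)) y.2 h3 h4).deriv.symm

/-- The integral of `jacobiTheta₂` over a period is `1`. -/
theorem integral_jacobiTheta₂ {τ : ℂ} (hτ : 0 < τ.im) :
    ∫ x : ℝ in (0)..1, jacobiTheta₂ x τ = 1 := by
  have hs := (summable_jacobiTheta₂_term_iff 0 τ).2 hτ
  have hn : ∀ (n : ℤ) (x : ℝ), ‖jacobiTheta₂_term n x τ‖ = ‖jacobiTheta₂_term n 0 τ‖ := by
    intro n x
    simp [norm_jacobiTheta₂_term]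
  -- The series is a Fourier series in `x`; only its zeroth mode survives integration over a period.
  have hi : ∀ n : ℤ, ∫ x : ℝ in (0)..1, jacobiTheta₂_term n x τ = if n = 0 then 1 else 0 := by
    intro n
    split_ifs with h
    · subst h
      simp [jacobiTheta₂_term]
    · have hne : (2 * Real.pi * I * n : ℂ) ≠ 0 := by simp [Real.pi_ne_zero, h]
      simp only [jacobiTheta₂_term, exp_add]
      rw [intervalIntegral.integral_mul_const, integral_exp_mul_complex hne]
      have : exp (2 * Real.pi * I * n) = 1 := exp_eq_one_iff.2 ⟨n, by ring⟩
      simp [this]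
  have h := intervalIntegral.hasSum_intervalIntegral_of_summable_norm (a := 0)
    (b := 1) (f := fun n : ℤ => (⟨fun x : ℝ => jacobiTheta₂_term n x τ, by
      unfold jacobiTheta₂_term; fun_prop⟩ : C(ℝ, ℂ))) ?_
  · simp only [ContinuousMap.coe_mk, hi] at h
    have h2 := hasSum_ite_eq (0 : ℤ) (1 : ℂ)
    exact h.unique h2
  · refine hs.norm.of_nonneg_of_le (fun _ => norm_nonneg _) fun n => ?_
    rw [ContinuousMap.norm_le _ (norm_nonneg _)]
    intro x
    exact (hn n x).le

/-- This excludes the value `0` for the constant relating `θ₁` to the triple product. A vanishing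
`θ₁` would make `jacobiTheta₂` vanish on the real axis, where its mean over a period is `1`. -/
theorem exists_theta1_ne_zero {τ : ℂ} (hτ : 0 < τ.im) : ∃ u, theta1 τ u ≠ 0 := by
  by_contra! h
  have h1 : ∀ x : ℝ, jacobiTheta₂ x τ = 0 := by
    intro x
    have := h (x - 1 / 2 - τ / 2)
    rw [theta1_eq, neg_eq_zero, mul_eq_zero] at this
    have := this.resolve_left (exp_ne_zero _)
    ring_nf at this
    exact this
  have h2 := integral_jacobiTheta₂ hτ
  simp [h1] at h2

/-! ### Zeros of the theta function -/

/-- `∏ (1 - q ^ n w)`, `n ≥ 1`. -/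
def qProd (q w : ℂ) : ℂ := ∏' n : ℕ, (1 - q ^ (n + 1) * w)

theorem summable_norm_pow_succ_mul {q : ℂ} (hq : ‖q‖ < 1) (w : ℂ) :
    Summable fun n : ℕ => ‖-(q ^ (n + 1) * w)‖ := by
  simp only [norm_neg, norm_mul, norm_pow]
  exact ((summable_nat_add_iff 1).2 (summable_geometric_of_lt_one (norm_nonneg _) hq)).mul_right _

theorem multipliable_qProd {q : ℂ} (hq : ‖q‖ < 1) (w : ℂ) :
    Multipliable fun n : ℕ => 1 - q ^ (n + 1) * w := by
  simp_rw [sub_eq_add_neg]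
  exact multipliable_one_add_of_summable (summable_norm_pow_succ_mul hq w)

theorem qProd_ne_zero {q : ℂ} (hq : ‖q‖ < 1) {w : ℂ} (h : ∀ n : ℕ, q ^ (n + 1) * w ≠ 1) :
    qProd q w ≠ 0 := by
  simp_rw [qProd, sub_eq_add_neg]
  refine tprod_one_add_ne_zero_of_summable (fun n => ?_) (summable_norm_pow_succ_mul hq w)
  rw [← sub_eq_add_neg, sub_ne_zero]
  exact (h n).symm

theorem qProd_eq_mul {q : ℂ} (hq : ‖q‖ < 1) (w : ℂ) : qProd q w = (1 - q * w) * qProd q (q * w) := by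
  have h1 : ∀ n : ℕ, 1 - q ^ (n + 1) * (q * w) = 1 - q ^ (n + 1 + 1) * w := fun n => by ring
  have h2 := multipliable_qProd hq (q * w)
  simp only [h1] at h2
  simp only [qProd, h1]
  rw [tprod_eq_zero_mul' (f := fun n : ℕ => 1 - q ^ (n + 1) * w) h2, zero_add, pow_one]

/-- On a compact set the factors differ from `1` by at most a constant times `‖q‖ ^ (n + 1)`, so the
product converges locally uniformly. -/
theorem differentiable_qProd {q : ℂ} (hq : ‖q‖ < 1) : Differentiable ℂ (qProd q) := by
  rw [← differentiableOn_univ]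
  have h : HasProdLocallyUniformlyOn (fun (n : ℕ) w => 1 - q ^ (n + 1) * w) (qProd q)
      Set.univ := by
    simp_rw [sub_eq_add_neg]
    have : qProd q = fun w => ∏' n : ℕ, (1 + -(q ^ (n + 1) * w)) := by
      ext w; simp only [qProd, sub_eq_add_neg]
    rw [this]
    refine hasProdLocallyUniformlyOn_of_forall_compact isOpen_univ fun K _ hcK => ?_
    obtain ⟨C, hC⟩ := hcK.exists_bound_of_continuousOn (f := fun w : ℂ => w) (by fun_prop)
    refine Summable.hasProdUniformlyOn_nat_one_add hcK (u := fun n => ‖q‖ ^ (n + 1) * C)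
      (((summable_nat_add_iff 1).2 (summable_geometric_of_lt_one (norm_nonneg _) hq)).mul_right _)
      (.of_forall fun n x hx => ?_) (fun _ => by fun_prop)
    rw [norm_neg, norm_mul, norm_pow]
    gcongr
    exact hC x hx
  exact h.differentiableOn (.of_forall fun _ => by
    simpa [Finset.prod_fn] using DifferentiableOn.finsetProd (fun _ _ => by fun_prop)) isOpen_univ

theorem norm_exp_two_pi_I_mul_lt_one {τ : ℂ} (hτ : 0 < τ.im) : ‖exp (2 * Real.pi * I * τ)‖ < 1 := by
  rw [norm_exp]
  simp
  positivity

/-- The product of the factors of the triple product without zero at the origin. -/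
def thetaCofactor (τ z : ℂ) : ℂ :=
  qProd (exp (2 * Real.pi * I * τ)) (exp (2 * Real.pi * I * z)) *
    qProd (exp (2 * Real.pi * I * τ)) (exp (-(2 * Real.pi * I * z)))

/-- The triple product, up to a constant. -/
def thetaProd (τ z : ℂ) : ℂ :=
  (exp (Real.pi * I * z) - exp (-(Real.pi * I * z))) * thetaCofactor τ z

theorem differentiable_thetaCofactor {τ : ℂ} (hτ : 0 < τ.im) :
    Differentiable ℂ (thetaCofactor τ) := by
  have h := differentiable_qProd (norm_exp_two_pi_I_mul_lt_one hτ)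
  unfold thetaCofactor
  exact (h.comp (by fun_prop)).mul (h.comp (by fun_prop))

/-- The factors of the two products vanish exactly at `m - (n + 1)τ` and `m + (n + 1)τ`. The row `n
= 0` of the lattice is left to the sine factor, so the point `z = 0` is allowed, as the derivative
of `thetaProd` at `0` requires. -/
theorem thetaCofactor_ne_zero {τ : ℂ} (hτ : 0 < τ.im) {z : ℂ}
    (h : ∀ m n : ℤ, n ≠ 0 → z ≠ m + n * τ) : thetaCofactor τ z ≠ 0 := by
  have h2pi : (2 * Real.pi * I : ℂ) ≠ 0 := by simp [Real.pi_ne_zero]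
  refine mul_ne_zero (qProd_ne_zero (norm_exp_two_pi_I_mul_lt_one hτ) fun n hn => ?_)
    (qProd_ne_zero (norm_exp_two_pi_I_mul_lt_one hτ) fun n hn => ?_)
  · rw [← exp_nat_mul, ← exp_add, exp_eq_one_iff] at hn
    obtain ⟨m, hm⟩ := hn
    refine h m (-(n + 1)) (by omega) (mul_left_cancel₀ h2pi ?_)
    push_cast at hm ⊢
    linear_combination hm
  · rw [← exp_nat_mul, ← exp_add, exp_eq_one_iff] at hn
    obtain ⟨m, hm⟩ := hn
    refine h (-m) (n + 1) (by omega) (mul_left_cancel₀ h2pi ?_)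
    push_cast at hm ⊢
    linear_combination -hm

theorem thetaProd_ne_zero {τ : ℂ} (hτ : 0 < τ.im) {z : ℂ} (hz : z ∉ periodLattice τ) :
    thetaProd τ z ≠ 0 := by
  refine mul_ne_zero (fun h => hz ?_) (thetaCofactor_ne_zero hτ fun m n _ h => hz ⟨m, n, h⟩)
  rw [sub_eq_zero, exp_eq_exp_iff_exists_int] at h
  obtain ⟨n, hn⟩ := h
  refine ⟨n, 0, mul_left_cancel₀ (b := z) (a := 2 * Real.pi * I) (by simp [Real.pi_ne_zero]) ?_⟩
  push_cast
  linear_combination hn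

theorem thetaProd_add_one (τ z : ℂ) : thetaProd τ (z + 1) = -thetaProd τ z := by
  have e1 : exp (2 * Real.pi * I * (z + 1)) = exp (2 * Real.pi * I * z) :=
    exp_eq_exp_iff_exists_int.2 ⟨1, by push_cast; ring⟩
  have e2 : exp (-(2 * Real.pi * I * (z + 1))) = exp (-(2 * Real.pi * I * z)) :=
    exp_eq_exp_iff_exists_int.2 ⟨-1, by push_cast; ring⟩
  have e3 : exp (Real.pi * I * (z + 1)) = -exp (Real.pi * I * z) := by
    rw [mul_add, exp_add, mul_one, exp_pi_mul_I]; ring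
  have e4 : exp (-(Real.pi * I * (z + 1))) = -exp (-(Real.pi * I * z)) := by
    rw [exp_neg, e3, exp_neg, inv_neg]
  rw [thetaProd, thetaProd, thetaCofactor, thetaCofactor, e1, e2, e3, e4]
  ring

/-- The shift by `τ` multiplies the argument of one `q`-product by `q` and that of the other by
`q⁻¹`. Thus one product loses its first factor and the other gains one, and together with the sine
factor these make up the multiplier. -/
theorem thetaProd_add_tau {τ : ℂ} (hτ : 0 < τ.im) (z : ℂ) :
    thetaProd τ (z + τ) = -exp (-(Real.pi * I * τ) - 2 * Real.pi * I * z) * thetaProd τ z := by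
  have hq := norm_exp_two_pi_I_mul_lt_one hτ
  have h1 := qProd_eq_mul hq (exp (2 * Real.pi * I * z))
  have h2 := qProd_eq_mul hq (exp (-(2 * Real.pi * I * (z + τ))))
  have e1 : exp (2 * Real.pi * I * τ) * exp (2 * Real.pi * I * z) =
      exp (2 * Real.pi * I * (z + τ)) := by rw [← exp_add]; ring_nf
  have e2 : exp (2 * Real.pi * I * τ) * exp (-(2 * Real.pi * I * (z + τ))) =
      exp (-(2 * Real.pi * I * z)) := by rw [← exp_add]; ring_nf
  rw [e1] at h1
  rw [e2] at h2
  rw [thetaProd, thetaProd, thetaCofactor, thetaCofactor, h1, h2]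
  set A := qProd (exp (2 * Real.pi * I * τ)) (exp (2 * Real.pi * I * (z + τ)))
  set B := qProd (exp (2 * Real.pi * I * τ)) (exp (-(2 * Real.pi * I * z)))
  set a := exp (Real.pi * I * z) with ha
  set t := exp (Real.pi * I * τ) with ht
  have ha0 : a ≠ 0 := exp_ne_zero _
  have ht0 : t ≠ 0 := exp_ne_zero _
  have f1 : exp (Real.pi * I * (z + τ)) = a * t := by rw [ha, ht, ← exp_add]; ring_nf
  have f2 : exp (2 * Real.pi * I * (z + τ)) = (a * t) ^ 2 := by
    rw [← f1, ← exp_nat_mul]; push_cast; ring_nf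
  have f3 : exp (2 * Real.pi * I * z) = a ^ 2 := by rw [ha, ← exp_nat_mul]; push_cast; ring_nf
  have f4 : exp (-(Real.pi * I * τ) - 2 * Real.pi * I * z) = t⁻¹ * (a ^ 2)⁻¹ := by
    rw [sub_eq_add_neg, exp_add, exp_neg, exp_neg, f3]
  rw [exp_neg, exp_neg, exp_neg, f1, f2, f3, f4]
  field_simp
  ring

theorem hasDerivAt_thetaProd_zero {τ : ℂ} (hτ : 0 < τ.im) :
    HasDerivAt (thetaProd τ) (2 * Real.pi * I * thetaCofactor τ 0) 0 := by
  have h1 : HasDerivAt (fun z : ℂ => exp (Real.pi * I * z) - exp (-(Real.pi * I * z)))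
      (2 * Real.pi * I) 0 := by
    have ha : HasDerivAt (fun z : ℂ => Real.pi * I * z) (Real.pi * I) 0 := by
      simpa using (hasDerivAt_id (0 : ℂ)).const_mul (Real.pi * I : ℂ)
    refine (ha.cexp.sub ha.neg.cexp).congr_deriv ?_
    simp
    ring
  refine (h1.mul (differentiable_thetaCofactor hτ 0).hasDerivAt).congr_deriv ?_
  simp

theorem thetaCofactor_zero_ne_zero {τ : ℂ} (hτ : 0 < τ.im) : thetaCofactor τ 0 ≠ 0 := by
  refine thetaCofactor_ne_zero hτ fun m n hn h => ?_
  have h1 := congrArg Complex.im h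
  simp at h1
  exact h1.elim hn hτ.ne'

/-- Both functions have the same multipliers, so their quotient is elliptic. It is holomorphic off
the lattice and bounded near `0`, where `θ₁` vanishes and `thetaProd` has a simple zero; Liouville
applies. Only the nonvanishing of the constant matters for the zeros of `θ₁`, not its value. -/
theorem exists_theta1_eq_mul_thetaProd {τ : ℂ} (hτ : 0 < τ.im) :
    ∃ C : ℂ, C ≠ 0 ∧ ∀ z, z ∉ periodLattice τ → theta1 τ z = C * thetaProd τ z := by
  have hd : Differentiable ℂ (thetaProd τ) := by
    have := differentiable_thetaCofactor hτ
    unfold thetaProd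
    fun_prop
  have hne : 2 * Real.pi * I * thetaCofactor τ 0 ≠ 0 :=
    mul_ne_zero (by simp [Real.pi_ne_zero]) (thetaCofactor_zero_ne_zero hτ)
  have hΛ : ∃ z, z ∉ periodLattice τ := (eventually_notMem_periodLattice hτ 0).exists
  have hconst := eq_of_norm_periodic hτ (f := fun z => theta1 τ z / thetaProd τ z)
    (fun z hz => (differentiable_theta1 hτ z).fun_div (hd z) (thetaProd_ne_zero hτ hz))
    (fun z hz => by rw [theta1_add_one, thetaProd_add_one, neg_div_neg_eq])
    (fun z hz => by
      rw [theta1_add_tau, thetaProd_add_tau hτ, mul_div_mul_left _ _ (by simp [exp_ne_zero])]) ?_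
  · obtain ⟨z₀, hz₀⟩ := hΛ
    have hC : ∀ z, z ∉ periodLattice τ →
        theta1 τ z = theta1 τ z₀ / thetaProd τ z₀ * thetaProd τ z := fun z hz => by
      rw [← hconst z z₀ hz hz₀, div_mul_cancel₀ _ (thetaProd_ne_zero hτ hz)]
    refine ⟨_, fun h => ?_, hC⟩
    obtain ⟨u, hu⟩ := exists_theta1_ne_zero hτ
    refine hu ?_
    have ht : Tendsto (theta1 τ) (𝓝[≠] u) (𝓝 (theta1 τ u)) :=
      ((differentiable_theta1 hτ).continuous.tendsto u).mono_left nhdsWithin_le_nhds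
    refine tendsto_nhds_unique (ht.congr' ?_) tendsto_const_nhds
    filter_upwards [eventually_notMem_periodLattice hτ u] with z hz
    rw [hC z hz, h, zero_mul]
  · have h1 : (theta1 τ) =O[𝓝[≠] 0] (fun z : ℂ => z) := by
      have := (differentiable_theta1 hτ 0).hasDerivAt.isBigO_sub
      simp only [theta1_zero, sub_zero] at this
      exact this.mono nhdsWithin_le_nhds
    -- The nonzero derivative at `0` bounds `thetaProd` below by a multiple of `z`.
    have h2 : (fun z : ℂ => z) =O[𝓝[≠] 0] (thetaProd τ) := by
      have := ((hasDerivAt_thetaProd_zero hτ).isTheta_sub hne).isBigO_symm.comp_tendsto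
        (k := fun z => (z, 0)) (l' := 𝓝 0) (by rw [prod_pure]; exact tendsto_map)
      simp only [Function.comp_def, sub_zero] at this
      have h0 : thetaProd τ 0 = 0 := by simp [thetaProd]
      simp only [h0, sub_zero] at this
      exact this.mono nhdsWithin_le_nhds
    have h3 := h1.trans h2
    have h4 := h3.mul (isBigO_refl (fun z => (thetaProd τ z)⁻¹) (𝓝[≠] 0))
    simp only [← div_eq_mul_inv] at h4
    refine h4.trans ?_
    refine IsBigO.of_bound 1 (.of_forall fun z => ?_)
    by_cases h : thetaProd τ z = 0
    · simp [h]
    · simp [div_self h]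

theorem theta1_ne_zero {τ : ℂ} (hτ : 0 < τ.im) {z : ℂ} (hz : z ∉ periodLattice τ) :
    theta1 τ z ≠ 0 := by
  obtain ⟨C, hC, h⟩ := exists_theta1_eq_mul_thetaProd hτ
  rw [h z hz]
  exact mul_ne_zero hC (thetaProd_ne_zero hτ hz)

theorem deriv_theta1_zero_ne_zero {τ : ℂ} (hτ : 0 < τ.im) : deriv (theta1 τ) 0 ≠ 0 := by
  obtain ⟨C, hC, h⟩ := exists_theta1_eq_mul_thetaProd hτ
  have h1 : theta1 τ =ᶠ[𝓝 0] fun z => C * thetaProd τ z := by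
    have := eventually_nhdsWithin_iff.1 (eventually_notMem_periodLattice hτ 0)
    filter_upwards [this] with z hz
    rcases eq_or_ne z 0 with rfl | hz0
    · simp [theta1_zero, thetaProd]
    · exact h z (hz hz0)
  rw [h1.deriv_eq, ((hasDerivAt_thetaProd_zero hτ).const_mul C).deriv]
  exact mul_ne_zero hC (mul_ne_zero (by simp [Real.pi_ne_zero]) (thetaCofactor_zero_ne_zero hτ))

end Theta

/-! ## Identities for `σ`, `ρ` and `℘` -/

section Sigma

open Asymptotics

theorem AnalyticAt.analyticAt_dslope {f : ℂ → ℂ} {c : ℂ} (hf : AnalyticAt ℂ f c) :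
    AnalyticAt ℂ (dslope f c) c := by
  obtain ⟨p, hp⟩ := hf
  exact ⟨_, hp.has_fpower_series_dslope_fslope⟩

theorem AnalyticAt.isBigO_sub_of_deriv_eq_zero {f : ℂ → ℂ} (hf : AnalyticAt ℂ f 0)
    (h : deriv f 0 = 0) : (fun z => f z - f 0) =O[𝓝 0] fun z => z ^ 2 := by
  have h1 : (fun z => dslope f 0 z - dslope f 0 0) =O[𝓝 0] (fun z : ℂ => z - 0) :=
    hf.analyticAt_dslope.differentiableAt.hasDerivAt.isBigO_sub
  simp only [dslope_same, h, sub_zero] at h1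
  refine ((isBigO_refl (fun z : ℂ => z) (𝓝 0)).mul h1).congr (fun z => ?_) fun z => by ring
  simpa using sub_smul_dslope f 0 z

/-- Evenness kills the linear term. Applied to `z²` times an even function with a double pole, it
shows that there is no residue, so that subtracting a multiple of `z⁻²` leaves a bounded function.
-/
theorem AnalyticAt.isBigO_sub_of_even {f : ℂ → ℂ} (hf : AnalyticAt ℂ f 0)
    (h : ∀ᶠ z in 𝓝 0, f (-z) = f z) : (fun z => f z - f 0) =O[𝓝 0] fun z => z ^ 2 := by
  refine hf.isBigO_sub_of_deriv_eq_zero ?_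
  have h1 : deriv (fun z => f (-z)) 0 = deriv f 0 := EventuallyEq.deriv_eq h
  rw [deriv_comp_neg, neg_zero] at h1
  linear_combination -h1 / 2

/-- Dividing an `O(z²)` by `z²`. -/
theorem isBigO_one_of_mul_sq {f : ℂ → ℂ} (h : (fun z => f z * z ^ 2) =O[𝓝[≠] 0] fun z => z ^ 2) :
    f =O[𝓝[≠] 0] fun _ => (1 : ℝ) := by
  have h1 := h.mul (isBigO_refl (fun z : ℂ => (z ^ 2)⁻¹) (𝓝[≠] 0))
  refine (h1.congr' (f₂ := f) (g₂ := fun _ => (1 : ℂ)) ?_ ?_).trans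
    (isBigO_const_const _ one_ne_zero _)
  all_goals
    filter_upwards [self_mem_nhdsWithin] with z hz
    have : z ≠ 0 := hz
    field_simp

variable {τ : ℂ}

theorem theta1_sub_add_tau (τ u z : ℂ) : theta1 τ (u - (z + τ)) =
    -exp (Real.pi * I * τ + 2 * Real.pi * I * (u - z - τ)) * theta1 τ (u - z) := by
  have h := theta1_add_tau τ (u - (z + τ))
  rw [show u - (z + τ) + τ = u - z by ring] at h
  rw [h, ← mul_assoc, neg_mul_neg, ← exp_add]
  have : (Real.pi * I * τ + 2 * Real.pi * I * (u - z - τ) +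
    (-(Real.pi * I * τ) - 2 * Real.pi * I * (u - (z + τ)))) = 0 := by ring
  rw [this, exp_zero, one_mul]

theorem sigmaFun_add_one (τ u z : ℂ) : sigmaFun τ u (z + 1) = sigmaFun τ u z := by
  have h := theta1_add_one τ (u - (z + 1))
  rw [show u - (z + 1) + 1 = u - z by ring] at h
  rw [sigmaFun, sigmaFun, theta1_add_one, h]
  rw [neg_mul, neg_mul, neg_div, div_neg]

theorem sigmaFun_add_tau (τ u z : ℂ) :
    sigmaFun τ u (z + τ) = exp (2 * Real.pi * I * u) * sigmaFun τ u z := by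
  rw [sigmaFun, sigmaFun, theta1_sub_add_tau, theta1_add_tau]
  have h : exp (Real.pi * I * τ + 2 * Real.pi * I * (u - z - τ)) =
      exp (2 * Real.pi * I * u) * exp (-(Real.pi * I * τ) - 2 * Real.pi * I * z) := by
    rw [← exp_add]; ring_nf
  rw [h]
  set e := exp (-(Real.pi * I * τ) - 2 * Real.pi * I * z) with he
  have he0 : e ≠ 0 := exp_ne_zero _
  rw [mul_div_assoc', show -e * theta1 τ z * theta1 τ u = -e * (theta1 τ z * theta1 τ u) by ring,
    show -(exp (2 * Real.pi * I * u) * e) * theta1 τ (u - z) * deriv (theta1 τ) 0 =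
      -e * (exp (2 * Real.pi * I * u) * (theta1 τ (u - z) * deriv (theta1 τ) 0)) by ring,
    mul_div_mul_left _ _ (neg_ne_zero.2 he0)]

theorem hasDerivAt_theta1 (hτ : 0 < τ.im) (u : ℂ) :
    HasDerivAt (theta1 τ) (deriv (theta1 τ) u) u := (differentiable_theta1 hτ u).hasDerivAt

/-- The variable `u` enters only through `θ₁(u - z) / θ₁(u)`. At lattice points `z` both the
function and the stated derivative are `0`, by the convention for division by zero. -/
theorem hasDerivAt_sigmaFun (hτ : 0 < τ.im) {u : ℂ} (hu : u ∉ periodLattice τ) (z : ℂ) :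
    HasDerivAt (fun v => sigmaFun τ v z) (deriv (theta1 τ) 0 / theta1 τ z *
      ((deriv (theta1 τ) (u - z) * theta1 τ u - theta1 τ (u - z) * deriv (theta1 τ) u) /
        theta1 τ u ^ 2)) u := by
  have h1 : HasDerivAt (fun v => theta1 τ (v - z)) (deriv (theta1 τ) (u - z)) u := by
    simpa using (hasDerivAt_theta1 hτ (u - z)).comp_sub_const u z
  have h2 := (h1.div (hasDerivAt_theta1 hτ u) (theta1_ne_zero hτ hu)).const_mul
    (deriv (theta1 τ) 0 / theta1 τ z)
  refine h2.congr_of_eventuallyEq (.of_forall fun v => ?_)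
  simp only [sigmaFun, Pi.div_apply]
  rw [div_mul_div_comm, mul_comm (deriv (theta1 τ) 0)]

theorem dSigmaFun_eq (hτ : 0 < τ.im) {u : ℂ} (hu : u ∉ periodLattice τ) (z : ℂ) :
    dSigmaFun τ u z = deriv (theta1 τ) 0 / theta1 τ z *
      ((deriv (theta1 τ) (u - z) * theta1 τ u - theta1 τ (u - z) * deriv (theta1 τ) u) /
        theta1 τ u ^ 2) :=
  (hasDerivAt_sigmaFun hτ hu z).deriv

theorem hasDerivAt_sigmaFun_dSigmaFun (hτ : 0 < τ.im) {u : ℂ} (hu : u ∉ periodLattice τ) (z : ℂ) :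
    HasDerivAt (fun v => sigmaFun τ v z) (dSigmaFun τ u z) u :=
  (hasDerivAt_sigmaFun hτ hu z).differentiableAt.hasDerivAt

theorem deriv_theta1_neg (τ u : ℂ) : deriv (theta1 τ) (-u) = deriv (theta1 τ) u := by
  have h : (fun v => theta1 τ (-v)) = fun v => -theta1 τ v := funext (theta1_neg τ)
  have h1 := congrArg (fun f => deriv f u) h
  simp only [deriv_comp_neg, deriv.fun_neg] at h1
  exact neg_injective h1

theorem deriv_deriv_theta1_neg (τ u : ℂ) :
    deriv (deriv (theta1 τ)) (-u) = -deriv (deriv (theta1 τ)) u := by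
  have h : (fun v => deriv (theta1 τ) (-v)) = deriv (theta1 τ) := funext (deriv_theta1_neg τ)
  have h1 := congrArg (fun f => deriv f u) h
  simp only [deriv_comp_neg] at h1
  rw [← h1, neg_neg]

theorem rhoFun_neg (τ u : ℂ) : rhoFun τ (-u) = -rhoFun τ u := by
  rw [rhoFun, rhoFun, deriv_theta1_neg, theta1_neg, div_neg]

/-- The logarithmic derivative of `σ` in `u` is `ρ(u - z) - ρ(u)`, and `ρ` is odd. -/
theorem dSigmaFun_eq_rho (hτ : 0 < τ.im) {u z : ℂ} (hu : u ∉ periodLattice τ)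
    (hzu : z - u ∉ periodLattice τ) :
    dSigmaFun τ u z = -(sigmaFun τ u z * (rhoFun τ u + rhoFun τ (z - u))) := by
  have h0 : theta1 τ (u - z) ≠ 0 := theta1_ne_zero hτ (by rwa [← neg_mem_periodLattice_iff, neg_sub])
  have h1 := theta1_ne_zero hτ hu
  rw [dSigmaFun_eq hτ hu, ← neg_sub u z, rhoFun_neg, rhoFun, rhoFun, sigmaFun]
  by_cases hz : theta1 τ z = 0
  · simp [hz]
  · field_simp
    ring

theorem dSigmaFun_add_one (τ u z : ℂ) : dSigmaFun τ u (z + 1) = dSigmaFun τ u z := by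
  simp only [dSigmaFun, sigmaFun_add_one]

/-- The second term comes from differentiating the multiplier `exp (2πi u)` of `σ`; it is the origin
of the `2πi L` in the quasi-periodicity of `M`. -/
theorem dSigmaFun_add_tau (hτ : 0 < τ.im) {u : ℂ} (hu : u ∉ periodLattice τ) (z : ℂ) :
    dSigmaFun τ u (z + τ) = exp (2 * Real.pi * I * u) *
      (dSigmaFun τ u z + 2 * Real.pi * I * sigmaFun τ u z) := by
  have h1 := hasDerivAt_sigmaFun_dSigmaFun hτ hu z
  have h2 : HasDerivAt (fun v : ℂ => exp (2 * Real.pi * I * v))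
      (exp (2 * Real.pi * I * u) * (2 * Real.pi * I)) u := by
    simpa using ((hasDerivAt_id u).const_mul (2 * Real.pi * I : ℂ)).cexp
  rw [dSigmaFun]
  simp only [sigmaFun_add_tau]
  rw [(h2.fun_mul h1).deriv]
  ring

/-! ### Behaviour at the origin -/

theorem dslope_theta1_ne_zero (hτ : 0 < τ.im) : ∀ᶠ z in 𝓝 0, dslope (theta1 τ) 0 z ≠ 0 := by
  refine ((analyticAt_theta1 hτ 0).analyticAt_dslope.continuousAt).eventually_ne ?_
  rw [dslope_same]
  exact deriv_theta1_zero_ne_zero hτ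

theorem mul_dslope_theta1 (τ z : ℂ) : z * dslope (theta1 τ) 0 z = theta1 τ z := by
  simpa [theta1_zero] using sub_smul_dslope (theta1 τ) 0 z

theorem dslope_theta1_neg (τ z : ℂ) : dslope (theta1 τ) 0 (-z) = dslope (theta1 τ) 0 z := by
  rcases eq_or_ne z 0 with rfl | hz
  · simp
  · refine mul_left_cancel₀ hz ?_
    have h1 := mul_dslope_theta1 τ z
    have h2 := mul_dslope_theta1 τ (-z)
    rw [theta1_neg] at h2
    linear_combination -h2 - h1

theorem sigmaFun_sub_inv_isBigO (hτ : 0 < τ.im) {u : ℂ} (hu : u ∉ periodLattice τ) :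
    (fun z => sigmaFun τ u z - z⁻¹) =O[𝓝[≠] 0] fun _ => (1 : ℝ) := by
  set a : ℂ → ℂ := fun z => theta1 τ (u - z) * deriv (theta1 τ) 0 /
    (dslope (theta1 τ) 0 z * theta1 τ u) with ha
  have hd0 := deriv_theta1_zero_ne_zero hτ
  have hu0 := theta1_ne_zero hτ hu
  have han : AnalyticAt ℂ a 0 := by
    refine AnalyticAt.div (AnalyticAt.mul (AnalyticAt.fun_comp (g := theta1 τ)
      (analyticAt_theta1 hτ _) (by fun_prop)) analyticAt_const)
      ((analyticAt_theta1 hτ 0).analyticAt_dslope.mul analyticAt_const) ?_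
    simp [hd0, hu0]
  have ha0 : a 0 = 1 := by simp [ha, hd0, hu0, mul_comm, div_self]
  have h1 : (fun z => dslope a 0 z) =O[𝓝[≠] 0] fun _ => (1 : ℝ) :=
    (han.analyticAt_dslope.continuousAt.tendsto.isBigO_one ℝ).mono nhdsWithin_le_nhds
  refine h1.congr' ?_ EventuallyEq.rfl
  filter_upwards [self_mem_nhdsWithin] with z hz
  have hz' : z ≠ 0 := hz
  rw [dslope_of_ne _ hz', slope_def_field, ha0, sub_zero, ha, sigmaFun, ← mul_dslope_theta1 τ z]
  field_simp

/-- Near `z = 0` one has `σ(u, z) = 1/z - ρ(u) + O(z)`. The polar part is independent of `u`, so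
`∂σ/∂u` has no pole and tends to `-ρ'(u)`. -/
theorem dSigmaFun_add_isBigO (hτ : 0 < τ.im) {u : ℂ} (hu : u ∉ periodLattice τ) :
    (fun z => dSigmaFun τ u z + (deriv (deriv (theta1 τ)) u * theta1 τ u - deriv (theta1 τ) u ^ 2) /
      theta1 τ u ^ 2) =O[𝓝[≠] 0] fun z => z := by
  set m : ℂ → ℂ := fun z => (deriv (theta1 τ) (u - z) * theta1 τ u -
    theta1 τ (u - z) * deriv (theta1 τ) u) / theta1 τ u ^ 2 with hm
  have hd0 := deriv_theta1_zero_ne_zero hτ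
  have hu0 := theta1_ne_zero hτ hu
  have hm0 : m 0 = 0 := by simp [hm, mul_comm]
  have hdm : HasDerivAt m (-((deriv (deriv (theta1 τ)) u * theta1 τ u - deriv (theta1 τ) u ^ 2) /
      theta1 τ u ^ 2)) 0 := by
    have h1 : HasDerivAt (fun z => theta1 τ (u - z)) (-deriv (theta1 τ) u) 0 := by
      simpa using HasDerivAt.comp_const_sub u 0 (by simpa using hasDerivAt_theta1 hτ u)
    have h2 : HasDerivAt (fun z => deriv (theta1 τ) (u - z)) (-deriv (deriv (theta1 τ)) u) 0 := by
      have := (analyticAt_theta1 hτ u).deriv.differentiableAt.hasDerivAt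
      simpa using HasDerivAt.comp_const_sub u 0 (by simpa using this)
    refine (((h2.mul_const _).sub (h1.mul_const _)).div_const _).congr_deriv ?_
    ring
  have hma : AnalyticAt ℂ m 0 := by
    have h1 : AnalyticAt ℂ (fun z => theta1 τ (u - z)) 0 :=
      AnalyticAt.fun_comp (g := theta1 τ) (analyticAt_theta1 hτ _) (by fun_prop)
    have h2 : AnalyticAt ℂ (fun z => deriv (theta1 τ) (u - z)) 0 :=
      AnalyticAt.fun_comp (g := deriv (theta1 τ)) (analyticAt_theta1 hτ _).deriv (by fun_prop)
    exact AnalyticAt.div ((h2.mul analyticAt_const).sub (h1.mul analyticAt_const))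
      analyticAt_const (pow_ne_zero 2 hu0)
  set e : ℂ → ℂ := fun z => deriv (theta1 τ) 0 / dslope (theta1 τ) 0 z * dslope m 0 z with he
  have hea : AnalyticAt ℂ e 0 := by
    refine (AnalyticAt.div analyticAt_const (analyticAt_theta1 hτ 0).analyticAt_dslope ?_).mul
      hma.analyticAt_dslope
    rwa [dslope_same]
  have he0 : e 0 = -((deriv (deriv (theta1 τ)) u * theta1 τ u - deriv (theta1 τ) u ^ 2) /
      theta1 τ u ^ 2) := by
    simp only [he, dslope_same, hdm.deriv]
    rw [div_self hd0, one_mul]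
  have h1 : (fun z => e z - e 0) =O[𝓝 0] (fun z : ℂ => z - 0) :=
    hea.differentiableAt.hasDerivAt.isBigO_sub
  simp only [sub_zero, he0, sub_neg_eq_add] at h1
  refine (h1.mono nhdsWithin_le_nhds).congr' ?_ EventuallyEq.rfl
  filter_upwards [self_mem_nhdsWithin, nhdsWithin_le_nhds (dslope_theta1_ne_zero hτ)] with z hz hz2
  have hz' : z ≠ 0 := hz
  rw [dSigmaFun_eq hτ hu, ← mul_dslope_theta1 τ z]
  congr 1
  have hmz : (deriv (theta1 τ) (u - z) * theta1 τ u -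
    theta1 τ (u - z) * deriv (theta1 τ) u) / theta1 τ u ^ 2 = m z := rfl
  rw [hmz, he]
  simp only
  rw [dslope_of_ne m hz', slope_def_field, hm0, sub_zero, sub_zero]
  field_simp

/-! ### The Weierstrass function -/

theorem wpFun_neg (hτ : 0 < τ.im) (u : ℂ) : wpFun τ (-u) = wpFun τ u := by
  simp [wpFun_eq hτ]

theorem wpFun_add_one (hτ : 0 < τ.im) (u : ℂ) : wpFun τ (u + 1) = wpFun τ u := by
  rw [wpFun_eq hτ, wpFun_eq hτ]
  exact (tauPeriodPair hτ).weierstrassP_add_coe u ⟨1, (mem_lattice_iff hτ 1).2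
    (one_mem_periodLattice τ)⟩

theorem wpFun_add_tau (hτ : 0 < τ.im) (u : ℂ) : wpFun τ (u + τ) = wpFun τ u := by
  rw [wpFun_eq hτ, wpFun_eq hτ]
  exact (tauPeriodPair hτ).weierstrassP_add_coe u ⟨τ, (mem_lattice_iff hτ τ).2
    (self_mem_periodLattice τ)⟩

theorem differentiableAt_wpFun (hτ : 0 < τ.im) {u : ℂ} (hu : u ∉ periodLattice τ) :
    DifferentiableAt ℂ (wpFun τ) u := by
  have h := (tauPeriodPair hτ).differentiableOn_weierstrassP
  rw [coe_lattice] at h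
  rw [show wpFun τ = (tauPeriodPair hτ).weierstrassP from funext (wpFun_eq hτ)]
  exact h.differentiableAt ((isClosed_periodLattice hτ).isOpen_compl.mem_nhds hu)

theorem wpFun_sub_inv_sq_isBigO (hτ : 0 < τ.im) :
    (fun z => wpFun τ z - (z ^ 2)⁻¹) =O[𝓝[≠] 0] fun _ => (1 : ℝ) := by
  have h := (((tauPeriodPair hτ).analyticAt_weierstrassPExcept 0).continuousAt.tendsto.isBigO_one
    ℝ).mono (nhdsWithin_le_nhds (s := {0}ᶜ))
  refine h.congr (fun z => ?_) fun _ => rfl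
  have := (tauPeriodPair hτ).weierstrassPExcept_def 0 z
  simp only [ZeroMemClass.coe_zero] at this
  rw [this, wpFun_eq hτ]
  simp
  ring

/-- The derivative of `ρ`, outside the period lattice. -/
def dRhoFun (τ u : ℂ) : ℂ :=
  (deriv (deriv (theta1 τ)) u * theta1 τ u - deriv (theta1 τ) u ^ 2) / theta1 τ u ^ 2

theorem hasDerivAt_rhoFun (hτ : 0 < τ.im) {u : ℂ} (hu : u ∉ periodLattice τ) :
    HasDerivAt (rhoFun τ) (dRhoFun τ u) u := by
  refine ((analyticAt_theta1 hτ u).deriv.differentiableAt.hasDerivAt.div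
    (hasDerivAt_theta1 hτ u) (theta1_ne_zero hτ hu)).congr_deriv ?_
  rw [dRhoFun]; ring

theorem eventually_notMem_nhds (hτ : 0 < τ.im) {u : ℂ} (hu : u ∉ periodLattice τ) :
    ∀ᶠ v in 𝓝 u, v ∉ periodLattice τ :=
  (isClosed_periodLattice hτ).isOpen_compl.mem_nhds hu

theorem rhoFun_add_one (τ u : ℂ) : rhoFun τ (u + 1) = rhoFun τ u := by
  have h : (fun v => theta1 τ (v + 1)) = fun v => -theta1 τ v := funext (theta1_add_one τ)
  have h1 := congrArg (fun f => deriv f u) h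
  simp only [deriv_comp_add_const, deriv.fun_neg] at h1
  rw [rhoFun, rhoFun, h1, theta1_add_one, neg_div_neg_eq]

theorem rhoFun_add_tau (hτ : 0 < τ.im) {u : ℂ} (hu : u ∉ periodLattice τ) :
    rhoFun τ (u + τ) = rhoFun τ u - 2 * Real.pi * I := by
  have h : (fun v => theta1 τ (v + τ)) =
    fun v => -exp (-(Real.pi * I * τ) - 2 * Real.pi * I * v) * theta1 τ v :=
    funext (theta1_add_tau τ)
  have h1 := congrArg (fun f => deriv f u) h
  have h2 : HasDerivAt (fun v : ℂ => -exp (-(Real.pi * I * τ) - 2 * Real.pi * I * v))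
      (-(exp (-(Real.pi * I * τ) - 2 * Real.pi * I * u) * -(2 * Real.pi * I))) u := by
    simpa using (((hasDerivAt_id u).const_mul (2 * Real.pi * I : ℂ)).const_sub
      (-(Real.pi * I * τ))).cexp.fun_neg
  simp only [deriv_comp_add_const] at h1
  rw [(h2.fun_mul (hasDerivAt_theta1 hτ u)).deriv] at h1
  have h0 := theta1_ne_zero hτ hu
  have he := exp_ne_zero (-(Real.pi * I * τ) - 2 * Real.pi * I * u)
  rw [rhoFun, rhoFun, h1, theta1_add_tau]
  field_simp
  ring

theorem dRhoFun_add_one (hτ : 0 < τ.im) {u : ℂ} (hu : u ∉ periodLattice τ) :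
    dRhoFun τ (u + 1) = dRhoFun τ u := by
  have hu' : u + 1 ∉ periodLattice τ := by rwa [add_mem_periodLattice_iff (one_mem_periodLattice τ)]
  have h1 := (hasDerivAt_rhoFun hτ hu').comp_add_const u 1
  simp only [rhoFun_add_one] at h1
  exact h1.unique (hasDerivAt_rhoFun hτ hu)

theorem dRhoFun_add_tau (hτ : 0 < τ.im) {u : ℂ} (hu : u ∉ periodLattice τ) :
    dRhoFun τ (u + τ) = dRhoFun τ u := by
  have hu' : u + τ ∉ periodLattice τ := by
    rwa [add_mem_periodLattice_iff (self_mem_periodLattice τ)]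
  have h1 := (hasDerivAt_rhoFun hτ hu').comp_add_const u τ
  have h2 : (fun v => rhoFun τ (v + τ)) =ᶠ[𝓝 u] fun v => rhoFun τ v - 2 * Real.pi * I :=
    (eventually_notMem_nhds hτ hu).mono fun v hv => rhoFun_add_tau hτ hv
  exact (h1.congr_of_eventuallyEq h2.symm).unique ((hasDerivAt_rhoFun hτ hu).sub_const _)

/-- The sum `ρ' + ℘` is elliptic, and its double poles at the origin cancel, so it is constant. The
value of that constant drops out of the difference. -/
theorem dRhoFun_sub (hτ : 0 < τ.im) {u v : ℂ} (hu : u ∉ periodLattice τ)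
    (hv : v ∉ periodLattice τ) : dRhoFun τ u - dRhoFun τ v = wpFun τ v - wpFun τ u := by
  suffices h : dRhoFun τ u + wpFun τ u = dRhoFun τ v + wpFun τ v by linear_combination h
  refine eq_of_norm_periodic hτ (f := fun z => dRhoFun τ z + wpFun τ z) (fun z hz => ?_)
    (fun z hz => by rw [dRhoFun_add_one hτ hz, wpFun_add_one hτ])
    (fun z hz => by rw [dRhoFun_add_tau hτ hz, wpFun_add_tau hτ]) ?_ u v hu hv
  · have h1 := differentiableAt_wpFun hτ hz
    have h2 := (analyticAt_theta1 hτ z)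
    have h3 := theta1_ne_zero hτ hz
    refine DifferentiableAt.fun_add ?_ h1
    unfold dRhoFun
    have h4 := h2.deriv.deriv.differentiableAt
    have h5 := h2.deriv.differentiableAt
    have h6 := h2.differentiableAt
    exact ((h4.mul h6).sub (h5.pow 2)).div (h6.pow 2) (pow_ne_zero 2 h3)
  -- This is `-z² ρ'(z)`, extended to `z = 0`: even, with value `1` there.
  · set h : ℂ → ℂ := fun z => (deriv (theta1 τ) z ^ 2 - deriv (deriv (theta1 τ)) z * theta1 τ z) /
      dslope (theta1 τ) 0 z ^ 2 with hh
    have hd0 := deriv_theta1_zero_ne_zero hτ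
    have ha : AnalyticAt ℂ h 0 := by
      have h2 := (analyticAt_theta1 hτ 0)
      refine ((h2.deriv.pow 2).sub (h2.deriv.deriv.mul h2)).div (h2.analyticAt_dslope.pow 2) ?_
      simp [hd0]
    have h0 : h 0 = 1 := by simp [hh, theta1_zero, hd0]
    have hO := (ha.isBigO_sub_of_even (.of_forall fun z => by
      simp only [hh, deriv_theta1_neg, deriv_deriv_theta1_neg, theta1_neg, dslope_theta1_neg]
      ring)).mono (nhdsWithin_le_nhds (s := {0}ᶜ))
    have h1 : (fun z => dRhoFun τ z + (z ^ 2)⁻¹) =O[𝓝[≠] 0] fun _ => (1 : ℝ) := by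
      refine isBigO_one_of_mul_sq (hO.neg_left.congr' ?_ EventuallyEq.rfl)
      filter_upwards [self_mem_nhdsWithin, nhdsWithin_le_nhds (dslope_theta1_ne_zero hτ)] with
        z hz hz2
      have hz' : z ≠ 0 := hz
      rw [h0, hh, dRhoFun]
      simp only
      rw [← mul_dslope_theta1 τ z]
      field_simp
      ring
    refine (h1.add (wpFun_sub_inv_sq_isBigO hτ)).congr_left fun z => ?_
    ring

end Sigma

/-! ### Product and addition formulas for `σ` -/

section SigmaIdentities

open Asymptotics

variable {τ : ℂ}

theorem differentiableAt_sigmaFun (hτ : 0 < τ.im) (u : ℂ) {z : ℂ} (hz : z ∉ periodLattice τ) :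
    DifferentiableAt ℂ (fun w => sigmaFun τ u w) z := by
  have h0 := theta1_ne_zero hτ hz
  have h1 := differentiable_theta1 hτ
  by_cases hu : theta1 τ u = 0
  · simp [sigmaFun, hu]
  · unfold sigmaFun
    exact DifferentiableAt.fun_div ((h1.comp (by fun_prop : Differentiable ℂ fun w : ℂ => u - w)
      |>.differentiableAt).mul_const _) ((h1 z).mul_const _) (mul_ne_zero h0 hu)

theorem differentiableAt_dSigmaFun (hτ : 0 < τ.im) {u z : ℂ} (hu : u ∉ periodLattice τ)
    (hz : z ∉ periodLattice τ) : DifferentiableAt ℂ (fun w => dSigmaFun τ u w) z := by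
  have h0 := theta1_ne_zero hτ hz
  have h1 := differentiable_theta1 hτ
  have h2 : Differentiable ℂ (deriv (theta1 τ)) := h1.deriv
  simp only [dSigmaFun_eq hτ hu]
  have h3 : Differentiable ℂ (fun w => theta1 τ (u - w)) := h1.comp (by fun_prop)
  have h4 : Differentiable ℂ (fun w => deriv (theta1 τ) (u - w)) := h2.comp (by fun_prop)
  exact (DifferentiableAt.fun_div (by fun_prop) (h1 z) h0).fun_mul (by fun_prop)

/-- `σ(u, z) σ(-u, z) = ℘(z) - ℘(u)`. -/
theorem sigmaFun_mul_sigmaFun_neg (hτ : 0 < τ.im) {u z : ℂ} (hu : u ∉ periodLattice τ)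
    (hz : z ∉ periodLattice τ) :
    sigmaFun τ u z * sigmaFun τ (-u) z = wpFun τ z - wpFun τ u := by
  -- The multipliers `exp (2πi u)` and `exp (-2πi u)` cancel and so do the double poles, so the
  -- difference is constant in `z`. Its value is read off at `z = u`, where `σ(u, u) = 0`.
  have hc := eq_of_norm_periodic hτ
    (f := fun z => sigmaFun τ u z * sigmaFun τ (-u) z - wpFun τ z)
    (fun z hz => ((differentiableAt_sigmaFun hτ u hz).mul (differentiableAt_sigmaFun hτ (-u) hz)).sub
      (differentiableAt_wpFun hτ hz))
    (fun z hz => by rw [sigmaFun_add_one, sigmaFun_add_one, wpFun_add_one hτ])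
    (fun z hz => by
      rw [sigmaFun_add_tau, sigmaFun_add_tau, wpFun_add_tau hτ, mul_mul_mul_comm, ← exp_add]
      simp) ?_ z u hz hu
  · have h0 : sigmaFun τ u u = 0 := by simp [sigmaFun, theta1_zero]
    simp only [h0, zero_mul] at hc
    linear_combination hc
  · have hd0 := deriv_theta1_zero_ne_zero hτ
    have hu0 := theta1_ne_zero hτ hu
    set g : ℂ → ℂ := fun z => theta1 τ (u - z) * theta1 τ (u + z) * deriv (theta1 τ) 0 ^ 2 /
      (dslope (theta1 τ) 0 z ^ 2 * theta1 τ u ^ 2) with hg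
    have hga : AnalyticAt ℂ g 0 := by
      have h1 : AnalyticAt ℂ (fun z => theta1 τ (u - z)) 0 :=
        AnalyticAt.fun_comp (g := theta1 τ) (analyticAt_theta1 hτ _) (by fun_prop)
      have h2 : AnalyticAt ℂ (fun z => theta1 τ (u + z)) 0 :=
        AnalyticAt.fun_comp (g := theta1 τ) (analyticAt_theta1 hτ _) (by fun_prop)
      refine ((h1.mul h2).mul analyticAt_const).div
        (((analyticAt_theta1 hτ 0).analyticAt_dslope.pow 2).mul analyticAt_const) ?_
      simp [hd0, hu0]
    have hg0 : g 0 = 1 := by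
      simp only [hg, sub_zero, add_zero, dslope_same]
      field_simp
    have hO := (hga.isBigO_sub_of_even (.of_forall fun z => by
      simp only [hg, dslope_theta1_neg, sub_neg_eq_add, ← sub_eq_add_neg]
      ring)).mono (nhdsWithin_le_nhds (s := {0}ᶜ))
    have h1 : (fun z => sigmaFun τ u z * sigmaFun τ (-u) z - (z ^ 2)⁻¹) =O[𝓝[≠] 0]
        fun _ => (1 : ℝ) := by
      refine isBigO_one_of_mul_sq (hO.congr' ?_ EventuallyEq.rfl)
      filter_upwards [self_mem_nhdsWithin, nhdsWithin_le_nhds (dslope_theta1_ne_zero hτ)] with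
        z hz hz2
      have hz' : z ≠ 0 := hz
      rw [hg0, hg, sigmaFun, sigmaFun, ← neg_add' u z, theta1_neg, theta1_neg]
      simp only
      rw [← mul_dslope_theta1 τ z]
      field_simp
    refine (h1.sub (wpFun_sub_inv_sq_isBigO hτ)).congr_left fun z => ?_
    ring

/-- `σ(u, z) ∂σ(-u, z) - σ(-u, z) ∂σ(u, z) = ℘'(u)`. -/
theorem sigmaFun_mul_dSigmaFun_neg_sub (hτ : 0 < τ.im) {u z : ℂ} (hu : u ∉ periodLattice τ)
    (hz : z ∉ periodLattice τ) :
    sigmaFun τ u z * dSigmaFun τ (-u) z - sigmaFun τ (-u) z * dSigmaFun τ u z =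
      deriv (wpFun τ) u := by
  have h1 := hasDerivAt_sigmaFun_dSigmaFun hτ hu z
  have h2 := (hasDerivAt_sigmaFun_dSigmaFun hτ (neg_mem_periodLattice_iff.not.2 hu) z)
  have h2' : HasDerivAt (fun v => sigmaFun τ (-v) z) (-dSigmaFun τ (-u) z) u := by
    simpa [Function.comp_def] using h2.comp u (hasDerivAt_neg u)
  have h3 := (differentiableAt_wpFun hτ hu).hasDerivAt.const_sub (wpFun τ z)
  -- The product formula differentiated in `u` at fixed `z`.
  have h4 := (h1.fun_mul h2').congr_of_eventuallyEq (f₁ := fun v => wpFun τ z - wpFun τ v) (by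
    filter_upwards [eventually_notMem_nhds hτ hu] with v hv
    exact (sigmaFun_mul_sigmaFun_neg hτ hv hz).symm)
  linear_combination h3.unique h4

/-- `σ(u, z) ∂σ(v, z) - σ(v, z) ∂σ(u, z) = σ(u + v, z) (℘(v) - ℘(u))`. -/
theorem sigmaFun_mul_dSigmaFun_sub (hτ : 0 < τ.im) {u v z : ℂ} (hu : u ∉ periodLattice τ)
    (hv : v ∉ periodLattice τ) (huv : u + v ∉ periodLattice τ) (hz : z ∉ periodLattice τ) :
    sigmaFun τ u z * dSigmaFun τ v z - sigmaFun τ v z * dSigmaFun τ u z =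
      sigmaFun τ (u + v) z * (wpFun τ v - wpFun τ u) := by
  rw [← sub_eq_zero]
  -- All terms have the multiplier `exp (2πi(u + v))`, since the inhomogeneous terms of `∂σ` cancel
  -- by antisymmetry. It remains to compare simple poles at `0`.
  refine eq_zero_of_quasiperiodic hτ huv (f := fun z =>
    sigmaFun τ u z * dSigmaFun τ v z - sigmaFun τ v z * dSigmaFun τ u z -
      sigmaFun τ (u + v) z * (wpFun τ v - wpFun τ u)) (fun z hz => ?_) (fun z hz => ?_)
    (fun z hz => ?_) ?_ z hz
  · exact (((differentiableAt_sigmaFun hτ u hz).mul (differentiableAt_dSigmaFun hτ hv hz)).sub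
      ((differentiableAt_sigmaFun hτ v hz).mul (differentiableAt_dSigmaFun hτ hu hz))).sub
      ((differentiableAt_sigmaFun hτ _ hz).mul_const _)
  · simp only [sigmaFun_add_one, dSigmaFun_add_one]
  · simp only [sigmaFun_add_tau, dSigmaFun_add_tau hτ hu, dSigmaFun_add_tau hτ hv, mul_add, exp_add]
    ring
  · have hinv : Tendsto (fun z : ℂ => z) (𝓝[≠] 0) (𝓝 0) := tendsto_id.mono_left nhdsWithin_le_nhds
    have hid : (fun z : ℂ => z) =O[𝓝[≠] 0] fun _ => (1 : ℝ) := hinv.isBigO_one ℝ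
    have hb : ∀ {u}, u ∉ periodLattice τ → (fun z => dSigmaFun τ u z) =O[𝓝[≠] 0]
        fun _ => (1 : ℝ) := fun {u} hu =>
      (((dSigmaFun_add_isBigO hτ hu).trans hid).sub
        (isBigO_const_const (dRhoFun τ u) one_ne_zero _)).congr_left fun z => by
          rw [dRhoFun]; ring
    have hs := fun {u} (hu : u ∉ periodLattice τ) => sigmaFun_sub_inv_isBigO hτ hu
    have h1 := (hs hu).mul (hb hv)
    have h2 := (hs hv).mul (hb hu)
    have h3 := (hs huv).mul (isBigO_const_const (wpFun τ v - wpFun τ u) one_ne_zero (𝓝[≠] 0) :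
      (fun _ : ℂ => wpFun τ v - wpFun τ u) =O[𝓝[≠] 0] fun _ => (1 : ℝ))
    -- What is left after replacing every `σ` by `1/z`. The bracket is `O(z)` because its value at
    -- `0` is `ρ'(u) - ρ'(v) - (℘(v) - ℘(u)) = 0`.
    have h4 : (fun z => z⁻¹ * (dSigmaFun τ v z - dSigmaFun τ u z - (wpFun τ v - wpFun τ u)))
        =O[𝓝[≠] 0] fun _ => (1 : ℝ) := by
      have := (isBigO_refl (fun z : ℂ => z⁻¹) (𝓝[≠] 0)).mul
        ((dSigmaFun_add_isBigO hτ hv).sub (dSigmaFun_add_isBigO hτ hu))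
      refine (this.congr_left fun z => ?_).trans ?_
      · have := dRhoFun_sub hτ hu hv
        rw [dRhoFun, dRhoFun] at this
        congr 1
        linear_combination -this
      · refine IsBigO.of_bound 1 (.of_forall fun z => ?_)
        by_cases h : z = 0 <;> simp [h]
    simp only [mul_one] at h1 h2 h3
    refine (((h1.sub h2).sub h3).add h4).congr_left fun z => ?_
    ring

end SigmaIdentities

/-! ### The heat equation for `σ` -/

section Heat

open Asymptotics

theorem analyticAt_theta1_comp {X : Type*} [NormedAddCommGroup X] [NormedSpace ℂ X] {f g : X → ℂ}
    {x : X} (hf : AnalyticAt ℂ f x) (hg : AnalyticAt ℂ g x) (h : 0 < (f x).im) :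
    AnalyticAt ℂ (fun y => theta1 (f y) (g y)) x :=
  AnalyticAt.fun_comp (g := fun y : ℂ × ℂ => theta1 y.1 y.2) (f := fun y => (f y, g y))
    (analyticAt_theta1_uncurry h) (hf.prod hg)

theorem analyticAt_deriv_theta1_comp {X : Type*} [NormedAddCommGroup X] [NormedSpace ℂ X]
    {f g : X → ℂ} {x : X} (hf : AnalyticAt ℂ f x) (hg : AnalyticAt ℂ g x) (h : 0 < (f x).im) :
    AnalyticAt ℂ (fun y => deriv (theta1 (f y)) (g y)) x :=
  AnalyticAt.fun_comp (g := fun y : ℂ × ℂ => deriv (theta1 y.1) y.2) (f := fun y => (f y, g y))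
    (analyticAt_deriv_theta1_uncurry h) (hf.prod hg)

theorem analyticAt_sigmaFun_comp {X : Type*} [NormedAddCommGroup X] [NormedSpace ℂ X]
    {f g h : X → ℂ} {x : X} (hf : AnalyticAt ℂ f x) (hg : AnalyticAt ℂ g x) (hh : AnalyticAt ℂ h x)
    (hτ : 0 < (f x).im) (hu : g x ∉ periodLattice (f x)) (hz : h x ∉ periodLattice (f x)) :
    AnalyticAt ℂ (fun y => sigmaFun (f y) (g y) (h y)) x := by
  unfold sigmaFun
  exact ((analyticAt_theta1_comp hf (hg.sub hh) hτ).mul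
    (analyticAt_deriv_theta1_comp hf analyticAt_const hτ)).div
    ((analyticAt_theta1_comp hf hh hτ).mul (analyticAt_theta1_comp hf hg hτ))
    (mul_ne_zero (theta1_ne_zero hτ hz) (theta1_ne_zero hτ hu))

theorem theta1_eq_zero_iff {τ : ℂ} (hτ : 0 < τ.im) (z : ℂ) :
    theta1 τ z = 0 ↔ z ∈ periodLattice τ := by
  refine ⟨fun h => by_contra fun hz => theta1_ne_zero hτ hz h, ?_⟩
  rintro ⟨m, n, rfl⟩
  have h1 : Function.Periodic (fun z => theta1 τ z = 0) 1 := fun z => by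
    simp [theta1_add_one]
  have h2 : Function.Periodic (fun z => theta1 τ z = 0) τ := fun z => by
    simp [theta1_add_tau, exp_ne_zero]
  have h3 := h2.int_mul n m
  have h4 := h1.int_mul m 0
  simp only [mul_one, zero_add, theta1_zero, eq_iff_iff, iff_true] at h3 h4
  exact h3.2 h4

/-- Although the lattice moves with `τ`, its complement is the set where the jointly continuous
function `θ₁` does not vanish. -/
theorem isOpen_offLattice :
    IsOpen {x : ℂ × ℂ | 0 < x.1.im ∧ x.2 ∉ periodLattice x.1} := by
  rw [isOpen_iff_mem_nhds]
  rintro x ⟨hx, hx2⟩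
  filter_upwards [isOpen_im_fst_pos.mem_nhds hx,
    (analyticAt_theta1_uncurry hx).continuousAt.eventually_ne (theta1_ne_zero hx hx2)] with y hy hy2
  exact ⟨hy, fun h => hy2 ((theta1_eq_zero_iff hy _).2 h)⟩

theorem analyticAt_proj₁ (x : ℂ × ℂ × ℂ) : AnalyticAt ℂ (fun y : ℂ × ℂ × ℂ => y.1) x :=
  analyticAt_fst

theorem analyticAt_proj₂ (x : ℂ × ℂ × ℂ) : AnalyticAt ℂ (fun y : ℂ × ℂ × ℂ => y.2.1) x :=
  AnalyticAt.fun_comp (g := fun y : ℂ × ℂ => y.1) analyticAt_fst analyticAt_snd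

theorem analyticAt_proj₃ (x : ℂ × ℂ × ℂ) : AnalyticAt ℂ (fun y : ℂ × ℂ × ℂ => y.2.2) x :=
  AnalyticAt.fun_comp (g := fun y : ℂ × ℂ => y.2) analyticAt_snd analyticAt_snd

theorem analyticAt_fderiv_apply {X F : Type*} [NormedAddCommGroup X] [NormedSpace ℂ X]
    [NormedAddCommGroup F] [NormedSpace ℂ F] [CompleteSpace F]
    {f : X → F} {x : X} (hf : AnalyticAt ℂ f x) (v : X) :
    AnalyticAt ℂ (fun y => fderiv ℂ f y v) x :=
  ((ContinuousLinearMap.apply ℂ F v).analyticAt _).comp hf.fderiv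

theorem analyticAt_dSigmaFun_comp {X : Type*} [NormedAddCommGroup X] [NormedSpace ℂ X]
    {f g h : X → ℂ} {x : X} (hf : AnalyticAt ℂ f x) (hg : AnalyticAt ℂ g x) (hh : AnalyticAt ℂ h x)
    (hτ : 0 < (f x).im) (hu : g x ∉ periodLattice (f x)) (hz : h x ∉ periodLattice (f x)) :
    AnalyticAt ℂ (fun y => dSigmaFun (f y) (g y) (h y)) x := by
  have h1 : AnalyticAt ℂ (fun y : ℂ × ℂ × ℂ => sigmaFun y.1 y.2.1 y.2.2) (f x, g x, h x) :=
    analyticAt_sigmaFun_comp (analyticAt_proj₁ _) (analyticAt_proj₂ _) (analyticAt_proj₃ _) hτ hu hz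
  have h2 : AnalyticAt ℂ (fun y : ℂ × ℂ × ℂ => dSigmaFun y.1 y.2.1 y.2.2) (f x, g x, h x) := by
    refine (analyticAt_fderiv_apply h1 (0, 1, 0)).congr ?_
    filter_upwards [h1.eventually_analyticAt] with y hy
    have h4 : HasDerivAt (fun t : ℂ => (y.1, t, y.2.2)) ((0 : ℂ), (1 : ℂ), (0 : ℂ)) y.2.1 :=
      (hasDerivAt_const _ _).prodMk ((hasDerivAt_id _).prodMk (hasDerivAt_const _ _))
    exact (HasFDerivAt.comp_hasDerivAt (f := fun t : ℂ => (y.1, t, y.2.2)) y.2.1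
      hy.differentiableAt.hasFDerivAt h4).deriv.symm
  exact AnalyticAt.fun_comp (g := fun y : ℂ × ℂ × ℂ => dSigmaFun y.1 y.2.1 y.2.2)
    (f := fun y => (f y, g y, h y)) h2 (hf.prod (hg.prod hh))

/-- `z σ(u, z)` extends analytically to `z = 0`, with the value `1`. -/
theorem exists_regular_part_sigmaFun {τ u : ℂ} (hτ : 0 < τ.im) (hu : u ∉ periodLattice τ) :
    ∃ A : ℂ × ℂ × ℂ → ℂ, AnalyticAt ℂ A (τ, u, 0) ∧
      (∀ᶠ x in 𝓝 (τ, u), A (x.1, x.2, 0) = 1) ∧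
      ∀ᶠ x in 𝓝 (τ, u, (0 : ℂ)), x.2.2 ≠ 0 → sigmaFun x.1 x.2.1 x.2.2 = A x / x.2.2 := by
  -- `k (t, z)` is `θ₁(z) / z`, jointly analytic through `z = 0`.
  obtain ⟨k, hk, hk2⟩ := exists_analyticAt_eq_smul
    (analyticAt_theta1_uncurry (x := (τ, (0 : ℂ))) hτ) (.of_forall fun t => theta1_zero t)
  have hd0 := deriv_theta1_zero_ne_zero hτ
  have hu0 := theta1_ne_zero hτ hu
  -- Needed for all nearby `t`: the regular part must equal `1` along `z = 0` identically, so that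
  -- its `τ`- and `u`-derivatives vanish there.
  have hkd : ∀ᶠ t in 𝓝 τ, k (t, 0) = deriv (theta1 t) 0 := by
    have h1 := (Continuous.tendsto (by fun_prop : Continuous fun t : ℂ => (t, (0 : ℂ))) τ).eventually
      (hk2.eventually_nhds.and hk.eventually_analyticAt)
    filter_upwards [h1] with t ht
    have h2 : theta1 t =ᶠ[𝓝 0] fun z => z * k (t, z) :=
      (Continuous.tendsto (by fun_prop : Continuous fun z : ℂ => (t, z)) 0).eventually ht.1
    have h3 : DifferentiableAt ℂ (fun z => k (t, z)) 0 :=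
      (AnalyticAt.fun_comp (g := k) (f := fun z => (t, z)) ht.2 (by fun_prop)).differentiableAt
    rw [h2.deriv_eq, ((hasDerivAt_id' (0 : ℂ)).fun_mul h3.hasDerivAt).deriv]
    simp
  have hk0 : k (τ, 0) ≠ 0 := by rw [hkd.self_of_nhds]; exact hd0
  refine ⟨fun x => theta1 x.1 (x.2.1 - x.2.2) * deriv (theta1 x.1) 0 /
    (k (x.1, x.2.2) * theta1 x.1 x.2.1), ?_, ?_, ?_⟩
  · have h1 : AnalyticAt ℂ (fun x : ℂ × ℂ × ℂ => k (x.1, x.2.2)) (τ, u, 0) :=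
      AnalyticAt.fun_comp (g := k) (f := fun x : ℂ × ℂ × ℂ => (x.1, x.2.2)) hk
        ((analyticAt_proj₁ _).prod (analyticAt_proj₃ _))
    refine ((analyticAt_theta1_comp (analyticAt_proj₁ _)
        ((analyticAt_proj₂ _).sub (analyticAt_proj₃ _)) hτ).mul
      (analyticAt_deriv_theta1_comp (analyticAt_proj₁ _) analyticAt_const hτ)).div
      (h1.mul (analyticAt_theta1_comp (analyticAt_proj₁ _) (analyticAt_proj₂ _) hτ)) ?_
    exact mul_ne_zero hk0 hu0
  · have h1 : ∀ᶠ x in 𝓝 (τ, u), theta1 x.1 x.2 ≠ 0 :=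
      (analyticAt_theta1_uncurry (x := (τ, u)) hτ).continuousAt.eventually_ne hu0
    have h2 : ∀ᶠ t in 𝓝 τ, k (t, 0) ≠ 0 := by
      have := (Continuous.tendsto (by fun_prop : Continuous fun t : ℂ => (t, (0 : ℂ))) τ).eventually
        (hk.continuousAt.eventually_ne hk0)
      exact this
    filter_upwards [h1, (continuous_fst.tendsto (τ, u)).eventually hkd,
      (continuous_fst.tendsto (τ, u)).eventually h2] with x hx hx2 hx3
    simp only [sub_zero, hx2] at *
    field_simp
  · have h1 := (Continuous.tendsto
      (by fun_prop : Continuous fun x : ℂ × ℂ × ℂ => (x.1, x.2.2)) (τ, u, 0)).eventually hk2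
    filter_upwards [h1] with x hx hx0
    simp only [smul_eq_mul] at hx
    rw [sigmaFun, hx]
    rw [div_div]
    ring_nf

/-- The heat equation `2 π i ∂σ/∂τ + ∂²σ/∂u∂z = 0`. -/
theorem sigmaFun_heat {τ u z : ℂ} (hτ : 0 < τ.im) (hu : u ∉ periodLattice τ)
    (hz : z ∉ periodLattice τ) :
    2 * Real.pi * I * deriv (fun t => sigmaFun t u z) τ + deriv (fun w => dSigmaFun τ u w) z = 0 := by
  set S : ℂ × ℂ × ℂ → ℂ := fun y => sigmaFun y.1 y.2.1 y.2.2 with hS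
  have hSa : ∀ z, z ∉ periodLattice τ → AnalyticAt ℂ S (τ, u, z) := fun z hz =>
    analyticAt_sigmaFun_comp (analyticAt_proj₁ _) (analyticAt_proj₂ _) (analyticAt_proj₃ _) hτ hu hz
  -- Derivative along a line on which `z` moves with speed `c` relative to `τ`: `c = 0` is the
  -- partial derivative, and `c = 1` follows the moving period.
  have hline : ∀ {A : ℂ × ℂ × ℂ → ℂ} {z : ℂ} (c : ℂ), AnalyticAt ℂ A (τ, u, z) →
      HasDerivAt (fun t => A (t, u, z + c * (t - τ))) (fderiv ℂ A (τ, u, z) (1, 0, c)) τ := by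
    intro A z c hA
    have h4 : HasDerivAt (fun t : ℂ => (t, u, z + c * (t - τ))) ((1 : ℂ), (0 : ℂ), c) τ := by
      refine (hasDerivAt_id _).prodMk ((hasDerivAt_const _ _).prodMk ?_)
      simpa using (((hasDerivAt_id τ).sub_const τ).const_mul c).const_add z
    refine HasFDerivAt.comp_hasDerivAt_of_eq τ hA.differentiableAt.hasFDerivAt h4 ?_
    simp
  have hst : ∀ z, z ∉ periodLattice τ →
      HasDerivAt (fun t => sigmaFun t u z) (fderiv ℂ S (τ, u, z) (1, 0, 0)) τ := by
    intro z hz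
    simpa [hS] using hline 0 (hSa z hz)
  have hsz : ∀ z, z ∉ periodLattice τ →
      HasDerivAt (fun w => sigmaFun τ u w) (fderiv ℂ S (τ, u, z) (0, 0, 1)) z := by
    intro z hz
    have h4 : HasDerivAt (fun w : ℂ => (τ, u, w)) ((0 : ℂ), (0 : ℂ), (1 : ℂ)) z :=
      (hasDerivAt_const _ _).prodMk ((hasDerivAt_const _ _).prodMk (hasDerivAt_id _))
    exact HasFDerivAt.comp_hasDerivAt (f := fun w : ℂ => (τ, u, w)) z
      (hSa z hz).differentiableAt.hasFDerivAt h4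
  have hdsz : ∀ z, z ∉ periodLattice τ → HasDerivAt (fun w => dSigmaFun τ u w)
      (deriv (fun w => dSigmaFun τ u w) z) z :=
    fun z hz => (differentiableAt_dSigmaFun hτ hu hz).hasDerivAt
  have hmem1 : ∀ z, z ∉ periodLattice τ → z + 1 ∉ periodLattice τ := fun z hz => by
    rwa [add_mem_periodLattice_iff (one_mem_periodLattice τ)]
  have hmemτ : ∀ z, z ∉ periodLattice τ → z + τ ∉ periodLattice τ := fun z hz => by
    rwa [add_mem_periodLattice_iff (self_mem_periodLattice τ)]
  -- The left side has multiplier `exp (2πi u)` and no pole, so Liouville suffices.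
  refine eq_zero_of_quasiperiodic hτ hu (f := fun z => 2 * Real.pi * I *
    deriv (fun t => sigmaFun t u z) τ + deriv (fun w => dSigmaFun τ u w) z) (fun z hz => ?_)
    (fun z hz => ?_) (fun z hz => ?_) ?_ z hz
  · have h1 : AnalyticAt ℂ (fun w => fderiv ℂ S (τ, u, w) (1, 0, 0)) z :=
      AnalyticAt.fun_comp (f := fun w : ℂ => (τ, u, w))
        (analyticAt_fderiv_apply (hSa z hz) (1, 0, 0)) (by fun_prop)
    have h2 : DifferentiableAt ℂ (fun z => deriv (fun t => sigmaFun t u z) τ) z := by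
      refine h1.differentiableAt.congr_of_eventuallyEq ?_
      filter_upwards [eventually_notMem_nhds hτ hz] with w hw
      exact (hst w hw).deriv
    have h3 : AnalyticAt ℂ (fun w => dSigmaFun τ u w) z :=
      analyticAt_iff_eventually_differentiableAt.2
        ((eventually_notMem_nhds hτ hz).mono fun w hw => differentiableAt_dSigmaFun hτ hu hw)
    exact (h2.const_mul _).add h3.deriv.differentiableAt
  · have h1 := (hdsz _ (hmem1 z hz)).comp_add_const z 1
    simp only [dSigmaFun_add_one] at h1
    rw [h1.unique (hdsz z hz)]
    simp only [sigmaFun_add_one]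
  · have h1 := (hdsz _ (hmemτ z hz)).comp_add_const z τ
    simp only [dSigmaFun_add_tau hτ hu] at h1
    have h2 := h1.unique (((hdsz z hz).add ((hsz z hz).const_mul (2 * Real.pi * I))).const_mul
      (exp (2 * Real.pi * I * u)))
    have h3 := (hsz _ (hmemτ z hz)).comp_add_const z τ
    simp only [sigmaFun_add_tau] at h3
    have h4 := h3.unique ((hsz z hz).const_mul (exp (2 * Real.pi * I * u)))
    -- Differentiating `σ(t, u, z + t) = exp (2πi u) σ(t, u, z)` in `t` also yields a `∂σ/∂z` term.
    -- It cancels the one coming from the inhomogeneous term in `dSigmaFun_add_tau`.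
    have h5 := hline 1 (hSa _ (hmemτ z hz))
    have h6 : (fun t => S (t, u, z + τ + 1 * (t - τ))) =
        fun t => exp (2 * Real.pi * I * u) * sigmaFun t u z := by
      ext t
      simp only [hS]
      rw [← sigmaFun_add_tau]
      ring_nf
    rw [h6] at h5
    have h7 := h5.unique ((hst z hz).const_mul (exp (2 * Real.pi * I * u)))
    rw [show ((1 : ℂ), (0 : ℂ), (1 : ℂ)) = (1, 0, 0) + (0, 0, 1) by simp, map_add, h4] at h7
    rw [(hst z hz).deriv, (hst _ (hmemτ z hz)).deriv, h2]
    linear_combination 2 * Real.pi * I * h7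
  · obtain ⟨A, hA, hA1, hAσ⟩ := exists_regular_part_sigmaFun hτ hu
    have hcont : Continuous fun w : ℂ => (τ, u, w) := by fun_prop
    have hev : ∀ᶠ w in 𝓝[≠] (0 : ℂ), w ≠ 0 ∧ AnalyticAt ℂ A (τ, u, w) ∧
        ∀ᶠ x in 𝓝 (τ, u, w), S x = A x / x.2.2 := by
      have h1 := (hcont.tendsto 0).eventually (hAσ.eventually_nhds.and hA.eventually_analyticAt)
      filter_upwards [self_mem_nhdsWithin, nhdsWithin_le_nhds h1] with w hw hw2
      have hw' : w ≠ 0 := hw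
      refine ⟨hw', hw2.2, ?_⟩
      have h3 : ∀ᶠ x in 𝓝 (τ, u, w), x.2.2 ≠ 0 :=
        ContinuousAt.eventually_ne (g := fun x : ℂ × ℂ × ℂ => x.2.2) (by fun_prop) hw'
      filter_upwards [hw2.1, h3] with x hx hx2 using hx hx2
    have hα : AnalyticAt ℂ (fun w => fderiv ℂ A (τ, u, w) (1, 0, 0)) 0 :=
      AnalyticAt.fun_comp (f := fun w : ℂ => (τ, u, w))
        (analyticAt_fderiv_apply hA (1, 0, 0)) (by fun_prop)
    -- Since `A = 1` along `z = 0`, the `τ`- and `u`-derivatives of `A` vanish there, and dividing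
    -- them by `z` leaves analytic functions.
    have hα0 : fderiv ℂ A (τ, u, 0) (1, 0, 0) = 0 := by
      have h1 := hline 0 hA
      simp only [zero_mul, add_zero] at h1
      refine h1.unique ((hasDerivAt_const τ (1 : ℂ)).congr_of_eventuallyEq ?_)
      exact (Continuous.tendsto (by fun_prop : Continuous fun t : ℂ => (t, u)) τ).eventually hA1
    have hβ : AnalyticAt ℂ (fun w => fderiv ℂ A (τ, u, w) (0, 1, 0)) 0 :=
      AnalyticAt.fun_comp (f := fun w : ℂ => (τ, u, w))
        (analyticAt_fderiv_apply hA (0, 1, 0)) (by fun_prop)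
    have hlineu : ∀ {w : ℂ}, AnalyticAt ℂ A (τ, u, w) →
        HasDerivAt (fun v => A (τ, v, w)) (fderiv ℂ A (τ, u, w) (0, 1, 0)) u := by
      intro w hw
      have h4 : HasDerivAt (fun v : ℂ => (τ, v, w)) ((0 : ℂ), (1 : ℂ), (0 : ℂ)) u :=
        (hasDerivAt_const _ _).prodMk ((hasDerivAt_id _).prodMk (hasDerivAt_const _ _))
      exact HasFDerivAt.comp_hasDerivAt (f := fun v : ℂ => (τ, v, w)) u
        hw.differentiableAt.hasFDerivAt h4
    have hβ0 : fderiv ℂ A (τ, u, 0) (0, 1, 0) = 0 := by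
      refine (hlineu hA).unique ((hasDerivAt_const u (1 : ℂ)).congr_of_eventuallyEq ?_)
      exact (Continuous.tendsto (by fun_prop : Continuous fun v : ℂ => (τ, v)) u).eventually hA1
    set α : ℂ → ℂ := fun w => fderiv ℂ A (τ, u, w) (1, 0, 0) with hαdef
    set β : ℂ → ℂ := fun w => fderiv ℂ A (τ, u, w) (0, 1, 0) with hβdef
    have hb : ∀ {f : ℂ → ℂ}, AnalyticAt ℂ f 0 → f =O[𝓝[≠] 0] fun _ => (1 : ℝ) := fun hf =>
      (hf.continuousAt.tendsto.isBigO_one ℝ).mono nhdsWithin_le_nhds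
    have h1 : (fun z => deriv (fun t => sigmaFun t u z) τ) =O[𝓝[≠] 0] fun _ => (1 : ℝ) := by
      refine (hb hα.analyticAt_dslope).congr' ?_ EventuallyEq.rfl
      filter_upwards [hev] with w ⟨hw0, hwA, hwS⟩
      rw [dslope_of_ne _ hw0, slope_def_field]
      simp only [hαdef, hα0, sub_zero]
      have h2 := (hline 0 hwA).div_const w
      simp only [zero_mul, add_zero] at h2
      refine (h2.congr_of_eventuallyEq ?_).deriv.symm
      exact (Continuous.tendsto (by fun_prop : Continuous fun t : ℂ => (t, u, w)) τ).eventually hwS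
    have h2 : (fun z => deriv (fun w => dSigmaFun τ u w) z) =O[𝓝[≠] 0] fun _ => (1 : ℝ) := by
      refine (hb hβ.analyticAt_dslope.deriv).congr' ?_ EventuallyEq.rfl
      have h3 : ∀ᶠ w in 𝓝[≠] (0 : ℂ), dslope β 0 w = dSigmaFun τ u w := by
        filter_upwards [hev] with w ⟨hw0, hwA, hwS⟩
        rw [dslope_of_ne _ hw0, slope_def_field]
        simp only [hβdef, hβ0, sub_zero]
        refine (((hlineu hwA).div_const w).congr_of_eventuallyEq ?_).deriv.symm
        exact (Continuous.tendsto (by fun_prop : Continuous fun v : ℂ => (τ, v, w)) u).eventually hwS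
      rw [eventually_nhdsWithin_iff] at h3
      have h4 := h3.eventually_nhds
      filter_upwards [nhdsWithin_le_nhds h4, self_mem_nhdsWithin] with w hw hw0
      refine EventuallyEq.deriv_eq ?_
      filter_upwards [hw, isOpen_compl_singleton.mem_nhds hw0] with y hy hy0 using hy hy0
    have h3 := ((isBigO_const_const (2 * Real.pi * I : ℂ) (one_ne_zero (α := ℝ)) (𝓝[≠] 0) :
      (fun _ : ℂ => (2 * Real.pi * I : ℂ)) =O[𝓝[≠] 0] fun _ => (1 : ℝ)).mul h1).add
      (h2.congr_right (g₂ := fun _ => (1 : ℝ) * 1) (by simp))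
    simpa using h3

/-- The derivative of `σ(u(τ), z)` with respect to `τ`. -/
theorem hasDerivAt_sigmaFun_tau {τ z u' : ℂ} (hτ : 0 < τ.im) {u : ℂ → ℂ}
    (hu : u τ ∉ periodLattice τ) (hz : z ∉ periodLattice τ) (hd : HasDerivAt u u' τ) :
    HasDerivAt (fun t => sigmaFun t (u t) z)
      (u' * dSigmaFun τ (u τ) z -
        (2 * Real.pi * I : ℂ)⁻¹ * deriv (fun w => dSigmaFun τ (u τ) w) z) τ := by
  have hS : AnalyticAt ℂ (fun y : ℂ × ℂ × ℂ => sigmaFun y.1 y.2.1 y.2.2) (τ, u τ, z) :=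
    analyticAt_sigmaFun_comp (analyticAt_proj₁ _) (analyticAt_proj₂ _) (analyticAt_proj₃ _) hτ hu hz
  have h0 := hS.differentiableAt.hasFDerivAt
  have h1 : HasDerivAt (fun t : ℂ => (t, u τ, z)) ((1 : ℂ), (0 : ℂ), (0 : ℂ)) τ :=
    (hasDerivAt_id _).prodMk ((hasDerivAt_const _ _).prodMk (hasDerivAt_const _ _))
  have h2 : HasDerivAt (fun v : ℂ => (τ, v, z)) ((0 : ℂ), (1 : ℂ), (0 : ℂ)) (u τ) :=
    (hasDerivAt_const _ _).prodMk ((hasDerivAt_id _).prodMk (hasDerivAt_const _ _))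
  have h3 : HasDerivAt (fun t : ℂ => (t, u t, z)) ((1 : ℂ), u', (0 : ℂ)) τ :=
    (hasDerivAt_id _).prodMk (hd.prodMk (hasDerivAt_const _ _))
  have e1 := (HasFDerivAt.comp_hasDerivAt (f := fun t : ℂ => (t, u τ, z)) τ h0 h1).deriv
  have e2 := (HasFDerivAt.comp_hasDerivAt (f := fun v : ℂ => (τ, v, z)) (u τ) h0 h2).deriv
  refine (HasFDerivAt.comp_hasDerivAt (f := fun t : ℂ => (t, u t, z)) τ h0 h3).congr_deriv ?_
  rw [show ((1 : ℂ), u', (0 : ℂ)) = (1, 0, 0) + u' • (0, 1, 0) by simp, map_add, map_smul,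
    ← e1, ← e2]
  have h4 := sigmaFun_heat hτ hu hz
  have h2pi : (2 * Real.pi * I : ℂ) ≠ 0 := by simp [Real.pi_ne_zero]
  simp only [Function.comp_def, smul_eq_mul]
  rw [dSigmaFun, eq_neg_of_add_eq_zero_right h4]
  field_simp
  ring

end Heat

/-! ## Holomorphic linear differential equations -/

section ODE

open Metric

variable {E : Type*} [NormedRing E] [NormedAlgebra ℂ E]

/-- `Ring.inverse Φ * f` is constant if `Φ` and `f` solve the same linear differential equation. -/
theorem exists_eq_mul_const {X : Type*} [NormedAddCommGroup X] [NormedSpace ℂ X] [CompleteSpace E]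
    {Φ f : X → E} {c : X} {r : ℝ} {a b : X → X →L[ℂ] E}
    (hu : ∀ x ∈ ball c r, IsUnit (Φ x)) (hΦ : ∀ x ∈ ball c r, HasFDerivAt Φ (a x) x)
    (hf : ∀ x ∈ ball c r, HasFDerivAt f (b x) x)
    (hab : ∀ x ∈ ball c r, ∀ v, b x v = a x v * Ring.inverse (Φ x) * f x) :
    ∃ C : E, ∀ x ∈ ball c r, f x = Φ x * C := by
  rcases le_or_gt r 0 with hr | hr
  · exact ⟨0, fun x hx => by simp [ball_eq_empty.2 hr] at hx⟩
  have hg : ∀ x ∈ ball c r, HasFDerivAt (fun y => Ring.inverse (Φ y) * f y) (0 : X →L[ℂ] E) x := by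
    intro x hx
    obtain ⟨u, hu'⟩ := hu x hx
    have h1 := hasFDerivAt_ringInverse (𝕜 := ℂ) u
    rw [hu'] at h1
    have h2 := (h1.comp x (hΦ x hx)).mul' (hf x hx)
    refine h2.congr_fderiv ?_
    ext v
    have h3 := hab x hx v
    simp only [add_apply, smul_apply,
      ContinuousLinearMap.comp_apply, neg_apply, Function.comp_apply,
      ContinuousLinearMap.mulLeftRight_apply, h3, ← hu', Ring.inverse_unit, smul_eq_mul,
      zero_apply, MulOpposite.smul_eq_mul_unop, MulOpposite.unop_op]
    noncomm_ring
  refine ⟨Ring.inverse (Φ c) * f c, fun x hx => ?_⟩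
  have h3 := (convex_ball c r).norm_image_sub_le_of_norm_hasFDerivWithin_le (𝕜 := ℂ) (C := 0)
    (fun y hy => (hg y hy).hasFDerivWithinAt) (fun y _ => by simp) (mem_ball_self hr) hx
  rw [zero_mul, norm_le_zero_iff, sub_eq_zero] at h3
  rw [← h3, ← mul_assoc, Ring.mul_inverse_cancel _ (hu x hx), one_mul]

theorem HasDerivAt.hasFDerivAt_smulRight {f : ℂ → E} {f' : E} {x : ℂ} (h : HasDerivAt f f' x) :
    HasFDerivAt f ((1 : ℂ →L[ℂ] ℂ).smulRight f') x := h.hasFDerivAt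

variable [CompleteSpace E]

/-- Holomorphic solutions of linear differential equations on a small disc. -/
theorem exists_hasDerivAt_mul_of_bound {A : ℂ → E} {c : ℂ} {r C : ℝ} (hr : 0 < r)
    (hA : DifferentiableOn ℂ A (ball c r)) (hC : ∀ z ∈ ball c r, ‖A z‖ ≤ C) (hCr : C * r ≤ 1 / 2)
    (Y₀ : E) : ∃ Y : ℂ → E, Y c = Y₀ ∧ ∀ z ∈ ball c r, HasDerivAt Y (A z * Y z) z := by
  -- `g` is the primitive of `A u` vanishing at the centre. Holomorphy of `u` is placed inside the
  -- existential so that `choose` gives a total function.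
  have hstep : ∀ u : ℂ → E, ∃ g : ℂ → E, DifferentiableOn ℂ u (ball c r) →
      g c = 0 ∧ ∀ z ∈ ball c r, HasDerivAt g (A z * u z) z := by
    intro u
    by_cases hu : DifferentiableOn ℂ u (ball c r)
    · obtain ⟨g, hg⟩ := (hA.mul hu).isExactOn_ball.with_val_at c 0
      exact ⟨g, fun _ => hg⟩
    · exact ⟨0, fun h => absurd h hu⟩
  choose g hg using hstep
  -- The increments of Picard's iteration: `u (n + 1)` is the primitive of `A u n`, and the solution
  -- is their sum.
  obtain ⟨u, hu_zero, hu_succ⟩ : ∃ u : ℕ → ℂ → E, u 0 = (fun _ => Y₀) ∧ ∀ n, u (n + 1) = g (u n) :=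
    ⟨fun n => Nat.rec (fun _ => Y₀) (fun _ v => g v) n, rfl, fun _ => rfl⟩
  have hud : ∀ n, DifferentiableOn ℂ (u n) (ball c r) := by
    intro n
    induction n with
    | zero => rw [hu_zero]; exact differentiableOn_const _
    | succ n ih =>
      rw [hu_succ]
      exact fun z hz => ((hg (u n) ih).2 z hz).differentiableAt.differentiableWithinAt
  have hu0 : ∀ n, u (n + 1) c = 0 := fun n => by rw [hu_succ]; exact (hg (u n) (hud n)).1
  have hus : ∀ n, ∀ z ∈ ball c r, HasDerivAt (u (n + 1)) (A z * u n z) z :=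
    fun n => by rw [hu_succ]; exact (hg (u n) (hud n)).2
  have hC0 : 0 ≤ C := (norm_nonneg _).trans (hC c (mem_ball_self hr))
  -- Each integration costs a factor `C r ≤ 1/2`.
  have hbd : ∀ n, ∀ z ∈ ball c r, ‖u n z‖ ≤ ‖Y₀‖ * (1 / 2) ^ n := by
    intro n
    induction n with
    | zero => intro z _; simp [hu_zero]
    | succ n ih =>
      intro z hz
      have h1 := (convex_ball c r).norm_image_sub_le_of_norm_hasDerivWithin_le
        (C := C * (‖Y₀‖ * (1 / 2) ^ n)) (fun y hy => (hus n y hy).hasDerivWithinAt)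
        (fun y hy => (norm_mul_le _ _).trans
          (mul_le_mul (hC y hy) (ih y hy) (norm_nonneg _) hC0)) (mem_ball_self hr) hz
      rw [hu0, sub_zero] at h1
      refine h1.trans ?_
      have h2 : ‖z - c‖ ≤ r := (mem_ball_iff_norm.1 hz).le
      have h3 : 0 ≤ ‖Y₀‖ * (1 / 2) ^ n := by positivity
      calc C * (‖Y₀‖ * (1 / 2) ^ n) * ‖z - c‖ ≤ C * (‖Y₀‖ * (1 / 2) ^ n) * r := by gcongr
        _ = (C * r) * (‖Y₀‖ * (1 / 2) ^ n) := by ring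
        _ ≤ 1 / 2 * (‖Y₀‖ * (1 / 2) ^ n) := by gcongr
        _ = ‖Y₀‖ * (1 / 2) ^ (n + 1) := by ring
  have hsum : Summable fun n : ℕ => ‖Y₀‖ * (1 / 2 : ℝ) ^ n :=
    (summable_geometric_of_lt_one (by norm_num) (by norm_num)).mul_left _
  have hsu : ∀ z ∈ ball c r, Summable fun n => u n z := fun z hz =>
    Summable.of_norm_bounded hsum fun n => hbd n z hz
  obtain ⟨g', hg0, hgs⟩ : ∃ g' : ℕ → ℂ → E, g' 0 = 0 ∧ ∀ n, g' (n + 1) = fun z => A z * u n z :=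
    ⟨fun n => Nat.casesOn n 0 fun k z => A z * u k z, rfl, fun _ => rfl⟩
  refine ⟨fun z => ∑' n, u n z, ?_, fun z hz => ?_⟩
  · have h := (hsu c (mem_ball_self hr)).tsum_eq_zero_add
    simp only [hu0, tsum_zero, add_zero, hu_zero] at h
    exact h
  -- The derivative of `u n` is governed by `u (n - 1)`; for `n = 0` it is zero and the truncated
  -- subtraction is harmless.
  · have hb : Summable fun n : ℕ => C * (‖Y₀‖ * (1 / 2 : ℝ) ^ (n - 1)) := by
      refine Summable.mul_left _ ((summable_nat_add_iff 1).1 ?_)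
      simpa using hsum
    have h1 : ∀ n y, y ∈ ball c r → HasDerivAt (u n) (g' n y) y := by
      intro n y hy
      cases n with
      | zero => rw [hg0, hu_zero]; exact hasDerivAt_const y Y₀
      | succ n => rw [hgs]; exact hus n y hy
    have h2 : ∀ n y, y ∈ ball c r → ‖g' n y‖ ≤ C * (‖Y₀‖ * (1 / 2 : ℝ) ^ (n - 1)) := by
      intro n y hy
      cases n with
      | zero => rw [hg0, Pi.zero_apply, norm_zero]; positivity
      | succ n =>
        rw [hgs]
        exact (norm_mul_le _ _).trans
          (mul_le_mul (hC y hy) (hbd n y hy) (norm_nonneg _) hC0)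
    have h := hasDerivAt_tsum_of_isPreconnected hb isOpen_ball
      (convex_ball c r).isPreconnected h1 h2 (mem_ball_self hr) (hsu c (mem_ball_self hr)) hz
    refine h.congr_deriv ?_
    have h3 : Summable fun n => g' (n + 1) z := by
      simp only [hgs]
      exact (hsu z hz).mul_left (A z)
    have h4 : Summable fun n => g' n z := (summable_nat_add_iff (f := fun n => g' n z) 1).1 h3
    have h5 := h4.tsum_eq_zero_add
    simp only [hg0, hgs, Pi.zero_apply, zero_add] at h5
    rw [h5]
    exact (hsu z hz).tsum_mul_left (A z)

/-- Local holomorphic solutions of linear differential equations. -/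
theorem AnalyticAt.exists_hasDerivAt_mul {A : ℂ → E} {c : ℂ} (hA : AnalyticAt ℂ A c) (Y₀ : E) :
    ∃ Y : ℂ → E, Y c = Y₀ ∧ ∀ᶠ z in 𝓝 c, HasDerivAt Y (A z * Y z) z := by
  have h1 : ∀ᶠ z in 𝓝 c, DifferentiableAt ℂ A z ∧ ‖A z‖ ≤ ‖A c‖ + 1 :=
    (hA.eventually_analyticAt.mono fun z hz => hz.differentiableAt).and
      ((hA.continuousAt.norm.eventually_lt_const (lt_add_one _)).mono fun z hz => hz.le)
  obtain ⟨R, hR, h2⟩ := Metric.eventually_nhds_iff_ball.1 h1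
  -- The second entry makes the bound `‖A c‖ + 1` times `r` at most `1/2`.
  set r := min R (1 / (2 * (‖A c‖ + 1))) with hr
  have hpos : 0 < ‖A c‖ + 1 := by positivity
  have hr0 : 0 < r := lt_min hR (by positivity)
  obtain ⟨Y, hY, hY2⟩ := exists_hasDerivAt_mul_of_bound (A := A) (c := c) (C := ‖A c‖ + 1) hr0
    (fun z hz => (h2 z (ball_subset_ball (min_le_left _ _) hz)).1.differentiableWithinAt)
    (fun z hz => (h2 z (ball_subset_ball (min_le_left _ _) hz)).2) (by
      calc (‖A c‖ + 1) * r ≤ (‖A c‖ + 1) * (1 / (2 * (‖A c‖ + 1))) := by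
            gcongr; exact min_le_right _ _
        _ = 1 / 2 := by field_simp) Y₀
  exact ⟨Y, hY, eventually_of_mem (ball_mem_nhds c hr0) hY2⟩

/-- A solution near `z` is a right multiple of any invertible solution. -/
theorem IsFundamentalNear.exists_eventuallyEq_mul {A : ℂ → E} {Φ f : ℂ → E} {z : ℂ}
    (hΦ : IsFundamentalNear A Φ z) (hf : IsSolutionNear A f z) :
    ∃ C : E, f =ᶠ[𝓝 z] fun w => Φ w * C := by
  have hu : ∀ᶠ w in 𝓝 z, IsUnit (Φ w) :=
    (hΦ.1.self_of_nhds.continuousAt).eventually (Units.isOpen.mem_nhds hΦ.2)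
  obtain ⟨r, hr, h⟩ := Metric.eventually_nhds_iff_ball.1 (hu.and (hΦ.1.and hf))
  obtain ⟨C, hC⟩ := exists_eq_mul_const (fun x hx => (h x hx).1)
    (fun x hx => (h x hx).2.1.hasFDerivAt_smulRight)
    (fun x hx => (h x hx).2.2.hasFDerivAt_smulRight) (fun x hx v => by
      simp only [ContinuousLinearMap.smulRight_apply, one_apply_eq_self,
        smul_mul_assoc]
      rw [mul_assoc (A x), Ring.mul_inverse_cancel _ (h x hx).1, mul_one])
  exact ⟨C, eventually_of_mem (ball_mem_nhds z hr) hC⟩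

theorem IsSolutionNear.analyticAt {A : ℂ → E} {f : ℂ → E} {z : ℂ} (hf : IsSolutionNear A f z) :
    AnalyticAt ℂ f z :=
  analyticAt_iff_eventually_differentiableAt.2 (hf.mono fun _ h => h.differentiableAt)

/-- A solution on a disc vanishing at the center vanishes. -/
theorem eq_zero_of_hasDerivAt_mul {A f : ℂ → E} {c : ℂ} {r : ℝ}
    (hA : AnalyticAt ℂ A c) (hf : ∀ z ∈ ball c r, HasDerivAt f (A z * f z) z) (h0 : f c = 0) :
    ∀ z ∈ ball c r, f z = 0 := by
  intro z hz
  have hr : 0 < r := pos_of_mem_ball hz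
  -- Comparison with a fundamental solution gives vanishing near `c`; the identity theorem for `f`,
  -- which is holomorphic on the whole disc, does the rest.
  obtain ⟨Φ, hΦ1, hΦ⟩ := hA.exists_hasDerivAt_mul 1
  have hfund : IsFundamentalNear A Φ c := ⟨hΦ, by rw [hΦ1]; exact isUnit_one⟩
  obtain ⟨C, hC⟩ := hfund.exists_eventuallyEq_mul (f := f)
    (eventually_of_mem (ball_mem_nhds c hr) hf)
  have hC0 : C = 0 := by
    have : f c = Φ c * C := hC.self_of_nhds
    rw [h0, hΦ1, one_mul] at this
    exact this.symm
  have hfa : AnalyticOnNhd ℂ f (ball c r) :=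
    DifferentiableOn.analyticOnNhd (fun z hz => (hf z hz).differentiableAt.differentiableWithinAt)
      isOpen_ball
  exact hfa.eqOn_zero_of_preconnected_of_eventuallyEq_zero (convex_ball c r).isPreconnected
    (mem_ball_self hr) (hC.mono fun w hw => by simpa [hC0] using hw) hz

end ODE

/-! ## Holomorphic dependence on parameters -/

section Parameters

open Metric

variable {E : Type*} [NormedRing E] [NormedAlgebra ℂ E]

open Classical in
/-- Extension by zero of a function on a disc. -/
def extendDisc {a : ℂ} {R : ℝ} (g : C(closedBall a R, E)) (t : ℂ) : E :=
  if h : t ∈ closedBall a R then g ⟨t, h⟩ else 0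

omit [NormedAlgebra ℂ E] in
theorem extendDisc_apply {a : ℂ} {R : ℝ} (g : C(closedBall a R, E)) {t : ℂ}
    (h : t ∈ closedBall a R) : extendDisc g t = g ⟨t, h⟩ := dif_pos h

/-- The disc algebra: continuous functions on a closed disc, holomorphic in its interior. -/
def discAlgebra (E : Type*) [NormedRing E] [NormedAlgebra ℂ E] (a : ℂ) (R : ℝ) :
    Subalgebra ℂ C(closedBall a R, E) where
  carrier := {g | DifferentiableOn ℂ (extendDisc g) (ball a R)}
  mul_mem' {f g} hf hg := by
    refine DifferentiableOn.congr (DifferentiableOn.mul hf hg) fun t ht => ?_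
    simp [extendDisc_apply _ (ball_subset_closedBall ht)]
  add_mem' {f g} hf hg := by
    refine DifferentiableOn.congr (DifferentiableOn.add hf hg) fun t ht => ?_
    simp [extendDisc_apply _ (ball_subset_closedBall ht)]
  algebraMap_mem' c := by
    refine DifferentiableOn.congr (differentiableOn_const (algebraMap ℂ E c)) fun t ht => ?_
    simp [extendDisc_apply _ (ball_subset_closedBall ht), Algebra.algebraMap_eq_smul_one]

/-- Uniform limits of holomorphic functions are holomorphic. The resulting completeness makes the
disc algebra an admissible coefficient algebra for the existence theorem for differential equations.
-/
theorem isClosed_discAlgebra (a : ℂ) (R : ℝ) [CompleteSpace E] :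
    IsClosed (discAlgebra E a R : Set C(closedBall a R, E)) := by
  refine isClosed_of_closure_subset fun g hg => ?_
  obtain ⟨u, hu, hug⟩ := mem_closure_iff_seq_limit.1 hg
  have h1 : TendstoLocallyUniformlyOn (fun n => extendDisc (u n)) (extendDisc g) atTop
      (ball a R) := by
    refine TendstoUniformlyOn.tendstoLocallyUniformlyOn ?_
    rw [Metric.tendstoUniformlyOn_iff]
    intro ε hε
    filter_upwards [Metric.tendsto_nhds.1 hug ε hε] with n hn t ht
    rw [extendDisc_apply _ (ball_subset_closedBall ht),
      extendDisc_apply _ (ball_subset_closedBall ht), dist_comm]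
    exact (ContinuousMap.dist_apply_le_dist _).trans_lt hn
  exact h1.differentiableOn (Eventually.of_forall hu) isOpen_ball

instance (a : ℂ) (R : ℝ) [CompleteSpace E] : CompleteSpace (discAlgebra E a R) :=
  (isClosed_discAlgebra a R).completeSpace_coe

/-- Evaluation on the disc algebra. -/
def discEval {a : ℂ} {R : ℝ} (t : closedBall a R) : discAlgebra E a R →L[ℂ] E :=
  (ContinuousMap.evalCLM ℂ t : C(closedBall a R, E) →L[ℂ] E).comp
    (discAlgebra E a R).toSubmodule.subtypeL

theorem discEval_apply {a : ℂ} {R : ℝ} (t : closedBall a R) (g : discAlgebra E a R) :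
    discEval t g = (g : C(closedBall a R, E)) t := rfl

/-- Solutions of linear differential equations depend holomorphically on parameters. -/
theorem AnalyticAt.exists_hasDerivAt_mul_prod [CompleteSpace E] {A : ℂ × ℂ → E} {y : ℂ → E}
    {a b : ℂ} (hA : AnalyticAt ℂ A (a, b)) (hy : AnalyticAt ℂ y a) :
    ∃ Y : ℂ × ℂ → E, AnalyticAt ℂ Y (a, b) ∧ (∀ᶠ t in 𝓝 a, Y (t, b) = y t) ∧
      ∀ᶠ x in 𝓝 (a, b), HasDerivAt (fun w => Y (x.1, w)) (A x * Y x) x.2 := by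
  classical
  obtain ⟨R, hR, hsub⟩ := exists_closedBall_prod_subset
    (hA.eventually_analyticAt.and ((continuous_fst.tendsto (a, b)).eventually
      hy.eventually_analyticAt))
  have hAy : ∀ t ∈ closedBall a R, ∀ z ∈ closedBall b R, AnalyticAt ℂ A (t, z) ∧
    AnalyticAt ℂ y t := fun t ht z hz => hsub (show (t, z) ∈ _ from ⟨ht, hz⟩)
  have hbR : b ∈ closedBall b R := mem_closedBall_self hR.le
  -- The parameter is absorbed into the coefficients: `z ↦ A (·, z)` is an analytic curve in the
  -- disc algebra, and one equation there solves the problem for all parameters at once.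
  let F' : C(closedBall b R × closedBall a R, E) :=
    ⟨fun x => A (x.2, x.1), continuous_iff_continuousAt.2 fun x =>
      ContinuousAt.comp (f := fun x : closedBall b R × closedBall a R => ((x.2 : ℂ), (x.1 : ℂ)))
        (hAy x.2 x.2.2 x.1 x.1.2).1.continuousAt (by fun_prop)⟩
  have hmem : ∀ z : closedBall b R, F'.curry z ∈ discAlgebra E a R := by
    intro z
    have h1 : DifferentiableOn ℂ (fun t => A (t, (z : ℂ))) (ball a R) := fun t ht =>
      (AnalyticAt.fun_comp (f := fun t : ℂ => (t, (z : ℂ)))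
        (hAy t (ball_subset_closedBall ht) z z.2).1
        (by fun_prop)).differentiableAt.differentiableWithinAt
    refine h1.congr fun t ht => ?_
    rw [extendDisc_apply _ (ball_subset_closedBall ht)]
    rfl
  let F : ℂ → discAlgebra E a R := fun z =>
    if h : z ∈ closedBall b R then ⟨F'.curry ⟨z, h⟩, hmem _⟩ else 0
  have hFap : ∀ z ∈ closedBall b R, ∀ t, (F z : C(closedBall a R, E)) t = A (t, z) := by
    intro z hz t
    simp only [F, dif_pos hz]
    rfl
  have hFc : ContinuousOn F (closedBall b R) := by
    rw [continuousOn_iff_continuous_domRestrict]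
    refine (F'.curry.continuous.subtype_mk hmem).congr fun x => ?_
    simp only [F, Set.domRestrict_apply, dif_pos x.2]
  have hFa : AnalyticAt ℂ F b := by
    refine analyticOnNhd_ball_of_separating (fun t : closedBall a R => discEval t)
      (fun g g' h => Subtype.ext (ContinuousMap.ext h)) hR hFc (fun t => ?_) b (mem_ball_self hR)
    have h1 : DifferentiableOn ℂ (fun z => A ((t : ℂ), z)) (closedBall b R) := fun z hz =>
      (AnalyticAt.fun_comp (f := fun z : ℂ => ((t : ℂ), z)) (hAy t t.2 z hz).1
        (by fun_prop)).differentiableAt.differentiableWithinAt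
    exact h1.congr fun z hz => hFap z hz t
  let y₀ : C(closedBall a R, E) := ⟨fun t => y t, continuous_iff_continuousAt.2 fun t =>
    ContinuousAt.comp (f := fun t : closedBall a R => (t : ℂ))
      (hAy t t.2 b hbR).2.continuousAt (by fun_prop)⟩
  have hy₀ : y₀ ∈ discAlgebra E a R := by
    have h1 : DifferentiableOn ℂ y (ball a R) := fun t ht =>
      (hAy t (ball_subset_closedBall ht) b hbR).2.differentiableAt.differentiableWithinAt
    refine h1.congr fun t ht => ?_
    rw [extendDisc_apply _ (ball_subset_closedBall ht)]
    rfl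
  obtain ⟨Y, hYb, hY⟩ := hFa.exists_hasDerivAt_mul ⟨y₀, hy₀⟩
  obtain ⟨r, hr, hYr⟩ := Metric.eventually_nhds_iff_ball.1 (hY.and (closedBall_mem_nhds b hR))
  have hapl : ∀ t (ht : t ∈ closedBall a R) (z : ℂ),
      extendDisc (Y z : C(closedBall a R, E)) t = discEval ⟨t, ht⟩ (Y z) :=
    fun t ht z => extendDisc_apply _ ht
  have hD : ball a R ×ˢ ball b r ∈ 𝓝 (a, b) :=
    prod_mem_nhds (ball_mem_nhds a hR) (ball_mem_nhds b hr)
  have hz : ∀ x ∈ ball a R ×ˢ ball b r, HasDerivAt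
      (fun w => extendDisc (Y w : C(closedBall a R, E)) x.1)
      (A x * extendDisc (Y x.2 : C(closedBall a R, E)) x.1) x.2 := by
    intro x hx
    have hx1 := ball_subset_closedBall hx.1
    have h1 := (discEval ⟨x.1, hx1⟩).hasFDerivAt.comp_hasDerivAt x.2 (hYr x.2 hx.2).1
    simp only [hapl x.1 hx1]
    refine h1.congr_deriv ?_
    simp only [discEval_apply, MulMemClass.coe_mul, ContinuousMap.mul_apply,
      hFap x.2 (hYr x.2 hx.2).2]
  refine ⟨fun x => extendDisc (Y x.2 : C(closedBall a R, E)) x.1, ?_, ?_, eventually_of_mem hD hz⟩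
  -- Osgood's lemma: in `t` the values lie in the disc algebra, and in `z` they solve the equation.
  · refine analyticAt_of_continuousOn_of_separately_differentiable hD ?_ (fun x hx => ?_)
      fun x hx => (hz x hx).differentiableAt
    · rw [continuousOn_iff_continuous_domRestrict]
      have hYc : Continuous fun x : ↥(ball a R ×ˢ ball b r) =>
          ((Y x.1.2 : C(closedBall a R, E)), (⟨x.1.1, ball_subset_closedBall x.2.1⟩ :
            closedBall a R)) := by
        refine Continuous.prodMk (continuous_subtype_val.comp ?_)
          (Continuous.subtype_mk (by fun_prop) _)
        refine continuous_iff_continuousAt.2 fun x => ?_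
        exact ContinuousAt.comp (f := fun x : ↥(ball a R ×ˢ ball b r) => x.1.2)
          (hYr x.1.2 x.2.2).1.continuousAt (by fun_prop)
      exact (ContinuousEval.continuous_eval.comp hYc).congr fun x =>
        (extendDisc_apply _ (ball_subset_closedBall x.2.1)).symm
    · exact ((Y x.2).2 : DifferentiableOn ℂ _ _).differentiableAt (isOpen_ball.mem_nhds hx.1)
  · filter_upwards [closedBall_mem_nhds a hR] with t ht
    simp only [hYb, extendDisc_apply _ ht]
    rfl

end Parameters

/-! ## The joint linear system of a Lax pair -/

section JointSystem

open Metric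

variable {E : Type*} [NormedRing E] [NormedAlgebra ℂ E]

theorem two_pi_I_ne_zero' : (2 * Real.pi * I : ℂ) ≠ 0 := two_pi_I_ne_zero

/-- `f(τ, z)` is a holomorphic solution of `∂f/∂z = L f`, `2 π i ∂f/∂τ + M f = 0` near `p`. -/
def IsJointNear (L M : ℂ → ℂ → E) (f : ℂ × ℂ → E) (p : ℂ × ℂ) : Prop :=
  AnalyticAt ℂ f p ∧ ∀ᶠ x : ℂ × ℂ in 𝓝 p,
    HasDerivAt (fun w => f (x.1, w)) (L x.1 x.2 * f x) x.2 ∧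
    TwoPiIDeriv (fun t => f (t, x.2)) (-(M x.1 x.2 * f x)) x.1

/-- A Lax pair whose first member is quasi-periodic with multiplier `exp(2 π i Q)`,
where the `Q(τ)` commute with each other and with the `P(τ) = 2 π i dQ/dτ`. -/
structure IsLaxPair (U : Set ℂ) (L M : ℂ → ℂ → E) (P Q : ℂ → E) : Prop where
  isOpen : IsOpen U
  im_pos : ∀ τ ∈ U, 0 < τ.im
  analyticAt_L : ∀ τ ∈ U, ∀ z, z ∉ periodLattice τ →
    AnalyticAt ℂ (fun x : ℂ × ℂ => L x.1 x.2) (τ, z)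
  analyticAt_M : ∀ τ ∈ U, ∀ z, z ∉ periodLattice τ →
    AnalyticAt ℂ (fun x : ℂ × ℂ => M x.1 x.2) (τ, z)
  lax : LaxEquation U L M
  quasiPeriodic : LaxQuasiPeriodic U L M P Q
  deriv_Q : ∀ τ ∈ U, TwoPiIDeriv Q (P τ) τ
  commute_Q : ∀ s t, Commute (Q s) (Q t)
  commute_P : ∀ s t, Commute (P s) (Q t)

variable {U : Set ℂ} {L M : ℂ → ℂ → E} {P Q : ℂ → E} {f g Φ : ℂ × ℂ → E} {p : ℂ × ℂ}

theorem hasDerivAt_prodMk_left' {F : Type*} [NormedAddCommGroup F] [NormedSpace ℂ F]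
    {f : ℂ × ℂ → F} {p : ℂ × ℂ} (hf : AnalyticAt ℂ f p) :
    HasDerivAt (fun t => f (t, p.2)) (fderiv ℂ f p (1, 0)) p.1 :=
  HasFDerivAt.comp_hasDerivAt (f := fun t : ℂ => (t, p.2)) p.1 hf.differentiableAt.hasFDerivAt
    ((hasDerivAt_id p.1).prodMk (hasDerivAt_const _ _))

theorem hasDerivAt_prodMk_right' {F : Type*} [NormedAddCommGroup F] [NormedSpace ℂ F]
    {f : ℂ × ℂ → F} {p : ℂ × ℂ} (hf : AnalyticAt ℂ f p) :
    HasDerivAt (fun w => f (p.1, w)) (fderiv ℂ f p (0, 1)) p.2 :=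
  HasFDerivAt.comp_hasDerivAt (f := fun w : ℂ => (p.1, w)) p.2 hf.differentiableAt.hasFDerivAt
    ((hasDerivAt_const _ _).prodMk (hasDerivAt_id p.2))

theorem IsJointNear.eventually [CompleteSpace E] (hf : IsJointNear L M f p) :
    ∀ᶠ x in 𝓝 p, IsJointNear L M f x :=
  hf.1.eventually_analyticAt.and hf.2.eventually_nhds

theorem IsJointNear.mul_const (hf : IsJointNear L M f p) (C : E) :
    IsJointNear L M (fun x => f x * C) p := by
  refine ⟨hf.1.mul analyticAt_const, hf.2.mono fun x hx => ⟨?_, ?_⟩⟩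
  · exact (hx.1.mul_const C).congr_deriv (mul_assoc _ _ _)
  · refine (HasDerivAt.mul_const hx.2 C).congr_deriv ?_
    simp only [smul_mul_assoc, neg_mul, mul_assoc]

theorem IsJointNear.isSolutionNear (hf : IsJointNear L M f p) :
    IsSolutionNear (L p.1) (fun w => f (p.1, w)) p.2 := by
  have h : Tendsto (fun w : ℂ => (p.1, w)) (𝓝 p.2) (𝓝 p) := by
    have : Continuous fun w : ℂ => (p.1, w) := by fun_prop
    exact this.tendsto' _ _ rfl
  exact (h.eventually hf.2).mono fun w hw => hw.1

/-- The total derivative is left multiplication by a form that does not depend on the solution,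
which is the shape `exists_eq_mul_const` needs. -/
theorem IsJointNear.hasFDerivAt (hf : IsJointNear L M f p) :
    HasFDerivAt f (fderiv ℂ f p) p ∧ ∀ v : ℂ × ℂ, fderiv ℂ f p v =
      (v.2 • L p.1 p.2 - v.1 • (2 * Real.pi * I : ℂ)⁻¹ • M p.1 p.2) * f p := by
  refine ⟨hf.1.differentiableAt.hasFDerivAt, fun v => ?_⟩
  have h1 := (hasDerivAt_prodMk_left' hf.1).unique hf.2.self_of_nhds.2
  have h2 := (hasDerivAt_prodMk_right' hf.1).unique hf.2.self_of_nhds.1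
  have h3 : v = v.1 • ((1, 0) : ℂ × ℂ) + v.2 • ((0, 1) : ℂ × ℂ) := by ext <;> simp
  rw [h3, map_add, map_smul, map_smul, h1, h2]
  simp only [Prod.smul_mk, Prod.mk_add_mk, smul_eq_mul, mul_one, mul_zero, add_zero, zero_add,
    sub_mul, smul_mul_assoc, smul_neg]
  abel

/-- Two joint solutions on a ball differ by a constant factor. -/
theorem IsJointNear.exists_eq_mul [CompleteSpace E] {r : ℝ}
    (hΦ : ∀ x ∈ ball p r, IsJointNear L M Φ x) (hu : ∀ x ∈ ball p r, IsUnit (Φ x))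
    (hf : ∀ x ∈ ball p r, IsJointNear L M f x) : ∃ C : E, ∀ x ∈ ball p r, f x = Φ x * C := by
  refine exists_eq_mul_const hu (fun x hx => (hΦ x hx).hasFDerivAt.1)
    (fun x hx => (hf x hx).hasFDerivAt.1) fun x hx v => ?_
  rw [(hΦ x hx).hasFDerivAt.2, (hf x hx).hasFDerivAt.2, mul_assoc _ (Φ x),
    Ring.mul_inverse_cancel _ (hu x hx), mul_one]

theorem IsLaxPair.eventually_mem (h : IsLaxPair U L M P Q) (hτ : p.1 ∈ U)
    (hz : p.2 ∉ periodLattice p.1) :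
    ∀ᶠ x : ℂ × ℂ in 𝓝 p, x.1 ∈ U ∧ x.2 ∉ periodLattice x.1 := by
  have h1 : ∀ᶠ x : ℂ × ℂ in 𝓝 p, x.1 ∈ U :=
    (continuous_fst.tendsto p).eventually (h.isOpen.mem_nhds hτ)
  have h2 : ∀ᶠ x : ℂ × ℂ in 𝓝 p, x ∈ {x : ℂ × ℂ | 0 < x.1.im ∧ x.2 ∉ periodLattice x.1} :=
    isOpen_offLattice.mem_nhds ⟨h.im_pos _ hτ, hz⟩
  exact h1.and (h2.mono fun x hx => hx.2)

/-- The Lax equation in terms of Fréchet derivatives. -/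
theorem IsLaxPair.fderiv_eq (h : IsLaxPair U L M P Q) (hτ : p.1 ∈ U)
    (hz : p.2 ∉ periodLattice p.1) :
    (2 * Real.pi * I : ℂ) • fderiv ℂ (fun x : ℂ × ℂ => L x.1 x.2) p (1, 0)
      + fderiv ℂ (fun x : ℂ × ℂ => M x.1 x.2) p (0, 1) =
    L p.1 p.2 * M p.1 p.2 - M p.1 p.2 * L p.1 p.2 := by
  obtain ⟨a, b, ha, hb, hab⟩ := h.lax p.1 hτ p.2 hz
  rw [← hab, (hasDerivAt_prodMk_left' (p := p) (h.analyticAt_L p.1 hτ p.2 hz)).unique ha,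
    (hasDerivAt_prodMk_right' (p := p) (h.analyticAt_M p.1 hτ p.2 hz)).unique hb]

variable [CompleteSpace E]

theorem IsJointNear.exists_ball (hΦ : IsJointNear L M Φ p) (hu : IsUnit (Φ p)) :
    ∃ r > 0, ∀ x ∈ ball p r, IsJointNear L M Φ x ∧ IsUnit (Φ x) :=
  Metric.eventually_nhds_iff_ball.1
    (hΦ.eventually.and (hΦ.1.continuousAt.eventually (Units.isOpen.mem_nhds hu)))

theorem IsJointNear.exists_eventuallyEq_mul (hΦ : IsJointNear L M Φ p) (hu : IsUnit (Φ p))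
    (hf : IsJointNear L M f p) : ∃ C : E, f =ᶠ[𝓝 p] fun x => Φ x * C := by
  obtain ⟨r, hr, h⟩ := Metric.eventually_nhds_iff_ball.1 ((hΦ.eventually.and
    (hΦ.1.continuousAt.eventually (Units.isOpen.mem_nhds hu))).and hf.eventually)
  obtain ⟨C, hC⟩ := IsJointNear.exists_eq_mul (fun x hx => (h x hx).1.1) (fun x hx => (h x hx).1.2)
    fun x hx => (h x hx).2
  exact ⟨C, eventually_of_mem (ball_mem_nhds p hr) hC⟩

/-- The linear system of a Lax pair has local solutions with arbitrary initial values. -/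
theorem IsLaxPair.exists_isJointNear (h : IsLaxPair U L M P Q) (hτ : p.1 ∈ U)
    (hz : p.2 ∉ periodLattice p.1) (Y₀ : E) : ∃ f, IsJointNear L M f p ∧ f p = Y₀ := by
  obtain ⟨a, b⟩ := p
  simp only at hτ hz
  have hLa := h.analyticAt_L a hτ b hz
  have hMa := h.analyticAt_M a hτ b hz
  -- The `τ`-equation is solved along the line `z = b`, and the result serves as initial value for
  -- the `z`-equation with `τ` as parameter.
  have hN : AnalyticAt ℂ (fun t => -((2 * Real.pi * I : ℂ)⁻¹ • M t b)) a :=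
    (analyticAt_const.fun_smul
      (AnalyticAt.fun_comp (f := fun t : ℂ => (t, b)) hMa (by fun_prop))).fun_neg
  obtain ⟨y, hya, hy⟩ := hN.exists_hasDerivAt_mul Y₀
  obtain ⟨Y, hYa, hYb, hYz⟩ := hLa.exists_hasDerivAt_mul_prod (IsSolutionNear.analyticAt hy)
  have hτY := hYa.eventually_analyticAt
  obtain ⟨R, hR, hsub⟩ := exists_closedBall_prod_subset (hτY.and (hYz.eventually_nhds.and
    (h.eventually_mem (p := (a, b)) hτ hz)))
  obtain ⟨R', hR', hsub'⟩ := Metric.eventually_nhds_iff_ball.1 (hYb.eventually_nhds.and hy)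
  -- The defect of the `τ`-equation. By the Lax equation it satisfies `∂W/∂z = L W`, and it vanishes
  -- on `z = b`, hence everywhere nearby.
  set W : ℂ × ℂ → E := fun x => fderiv ℂ Y x (1, 0)
    + (2 * Real.pi * I : ℂ)⁻¹ • M x.1 x.2 * Y x with hW
  have hWz : ∀ x ∈ closedBall a R ×ˢ closedBall b R,
      HasDerivAt (fun w => W (x.1, w)) (L x.1 x.2 * W x) x.2 := by
    intro x hx
    obtain ⟨hx1, hx2, hx3⟩ := hsub hx
    have hLx : AnalyticAt ℂ (fun x : ℂ × ℂ => L x.1 x.2) x := h.analyticAt_L _ hx3.1 _ hx3.2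
    have hMx : AnalyticAt ℂ (fun x : ℂ × ℂ => M x.1 x.2) x := h.analyticAt_M _ hx3.1 _ hx3.2
    have hfl := h.fderiv_eq hx3.1 hx3.2
    have hsymm : fderiv ℂ (fun y => fderiv ℂ Y y (1, 0)) x (0, 1) =
        fderiv ℂ (fun y => fderiv ℂ Y y (0, 1)) x (1, 0) := by
      have h1 := (hx1.contDiffAt (n := 2)).isSymmSndFDerivAt (by simp)
      have h2 : ∀ v, HasFDerivAt (fun y => fderiv ℂ Y y v)
          ((ContinuousLinearMap.apply ℂ E v).comp (fderiv ℂ (fderiv ℂ Y) x)) x := fun v =>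
        (ContinuousLinearMap.apply ℂ E v).hasFDerivAt.comp x
          hx1.fderiv.differentiableAt.hasFDerivAt
      rw [(h2 _).fderiv, (h2 _).fderiv]
      exact h1 (0, 1) (1, 0)
    have hYzx : ∀ᶠ y in 𝓝 x, fderiv ℂ Y y (0, 1) = L y.1 y.2 * Y y := by
      filter_upwards [hx2, hx1.eventually_analyticAt] with y hy hy'
      exact (hasDerivAt_prodMk_right' hy').unique hy
    have hmix : fderiv ℂ (fun y => fderiv ℂ Y y (0, 1)) x (1, 0) =
        fderiv ℂ (fun y : ℂ × ℂ => L y.1 y.2) x (1, 0) * Y x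
          + L x.1 x.2 * fderiv ℂ Y x (1, 0) := by
      have h1 := hLx.differentiableAt.hasFDerivAt.mul' hx1.differentiableAt.hasFDerivAt
      rw [(h1.congr_of_eventuallyEq hYzx).fderiv]
      simp [add_comm]
    have h3 := (hasDerivAt_prodMk_right' (analyticAt_fderiv_apply hx1 (1, 0))).add
      (((hasDerivAt_prodMk_right' (p := x) hMx).const_smul (2 * Real.pi * I : ℂ)⁻¹).mul
        (hasDerivAt_prodMk_right' hx1))
    refine h3.congr_deriv ?_
    rw [hsymm, hmix, hYzx.self_of_nhds]
    have h4 : fderiv ℂ (fun x : ℂ × ℂ => L x.1 x.2) x (1, 0) = (2 * Real.pi * I : ℂ)⁻¹ •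
        (L x.1 x.2 * M x.1 x.2 - M x.1 x.2 * L x.1 x.2
          - fderiv ℂ (fun x : ℂ × ℂ => M x.1 x.2) x (0, 1)) := by
      rw [← hfl, add_sub_cancel_right, smul_smul, inv_mul_cancel₀ two_pi_I_ne_zero', one_smul]
    rw [h4]
    simp only [hW, mul_add, smul_mul_assoc, mul_smul_comm, sub_mul, smul_sub, Prod.mk.eta,
      mul_assoc, Pi.smul_apply]
    abel
  have hW0 : ∀ t ∈ closedBall a R ∩ ball a R', W (t, b) = 0 := by
    intro t ht
    have h1 := hsub (show (t, b) ∈ _ from ⟨ht.1, mem_closedBall_self hR.le⟩)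
    have h2 := hsub' t ht.2
    have h3 := ((hasDerivAt_prodMk_left' h1.1).congr_of_eventuallyEq
      (EventuallyEq.symm h2.1)).unique h2.2
    have h4 : Y (t, b) = y t := h2.1.self_of_nhds
    simp only [hW, h3, h4, neg_mul, neg_add_cancel]
  refine ⟨Y, ⟨hYa, ?_⟩, by rw [hYb.self_of_nhds, hya]⟩
  have hmem : (ball a R ∩ ball a R') ×ˢ ball b R ∈ 𝓝 (a, b) :=
    prod_mem_nhds (inter_mem (ball_mem_nhds a hR) (ball_mem_nhds a hR')) (ball_mem_nhds b hR)
  filter_upwards [hmem] with x hx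
  have hx1 := hsub (show x ∈ _ from
    ⟨ball_subset_closedBall hx.1.1, ball_subset_closedBall hx.2⟩)
  refine ⟨hx1.2.1.self_of_nhds, ?_⟩
  have hx0 := hsub (show (x.1, b) ∈ _ from
    ⟨ball_subset_closedBall hx.1.1, mem_closedBall_self hR.le⟩)
  have h1 : W (x.1, x.2) = 0 := by
    refine eq_zero_of_hasDerivAt_mul (A := L x.1) (f := fun w => W (x.1, w)) (c := b) (r := R)
      ?_ (fun z hz' => ?_) ?_ x.2 hx.2
    · exact AnalyticAt.fun_comp (f := fun w : ℂ => (x.1, w))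
        (h.analyticAt_L _ hx0.2.2.1 _ hx0.2.2.2) (by fun_prop)
    · exact hWz (x.1, z) ⟨ball_subset_closedBall hx.1.1, ball_subset_closedBall hz'⟩
    · exact hW0 x.1 ⟨ball_subset_closedBall hx.1.1, hx.1.2⟩
  have h2 := hasDerivAt_prodMk_left' hx1.1
  refine h2.congr_deriv ?_
  have h3 : fderiv ℂ Y x (1, 0) + (2 * Real.pi * I : ℂ)⁻¹ • M x.1 x.2 * Y x = 0 := h1
  rw [smul_neg, eq_neg_iff_add_eq_zero, ← h3, smul_mul_assoc]

end JointSystem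

/-! ## Analytic continuation along paths -/

section Continuation

open Metric

variable {E : Type*} [NormedRing E] [NormedAlgebra ℂ E]

/-- `Y₁` is the analytic continuation of `Y` along `γ` up to time `s`. -/
def ContinuesUpTo (A : ℂ → E) (γ : unitInterval → ℂ) (s : unitInterval) (Y Y₁ : ℂ → E) : Prop :=
  ∃ y : unitInterval → ℂ → E,
    (∀ t ≤ s, IsSolutionNear A (y t) (γ t)) ∧
    (∀ t ≤ s, ∀ᶠ t' in 𝓝 t, t' ≤ s → y t' =ᶠ[𝓝 (γ t')] y t) ∧
    y 0 =ᶠ[𝓝 (γ 0)] Y ∧ y s =ᶠ[𝓝 (γ s)] Y₁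

variable {A : ℂ → E} {γ : unitInterval → ℂ} {s s' : unitInterval} {Y Y' Y₁ Y₁' f : ℂ → E}

theorem ContinuesUpTo.continuesTo (h : ContinuesUpTo A γ 1 Y Y₁) : ContinuesTo A γ Y Y₁ := by
  obtain ⟨y, h1, h2, h3, h4⟩ := h
  exact ⟨y, fun s => h1 s unitInterval.le_one', fun s =>
    (h2 s unitInterval.le_one').mono fun t ht => ht unitInterval.le_one', h3, h4⟩

/-- A single function serves for all times after `s`. The time `s` itself needs care: the germs of
`y s` and `f` agree on a neighbourhood of `γ s`, which contains `γ t` for `t` near `s`. -/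
theorem ContinuesUpTo.extend (hγ : Continuous γ) (h : ContinuesUpTo A γ s Y Y₁) (hs : s ≤ s')
    (hf : ∀ t ∈ Set.Icc s s', IsSolutionNear A f (γ t)) (heq : Y₁ =ᶠ[𝓝 (γ s)] f) :
    ContinuesUpTo A γ s' Y f := by
  classical
  obtain ⟨y, h1, h2, h3, h4⟩ := h
  have hyf : y s =ᶠ[𝓝 (γ s)] f := h4.trans heq
  refine ⟨fun t => if t ≤ s then y t else f, fun t ht => ?_, fun t ht => ?_, ?_, ?_⟩
  · by_cases hts : t ≤ s
    · simp only [if_pos hts]; exact h1 t hts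
    · simp only [if_neg hts]; exact hf t ⟨(not_le.1 hts).le, ht⟩
  · rcases lt_trichotomy t s with hts | rfl | hts
    · filter_upwards [h2 t hts.le, eventually_lt_nhds hts] with t' h5 h6 _
      simp only [if_pos h6.le, if_pos hts.le]
      exact h5 h6.le
    · filter_upwards [h2 t le_rfl, (hγ.tendsto t).eventually hyf.eventuallyEq_nhds] with t' h5 h6 _
      simp only [if_pos le_rfl]
      by_cases h7 : t' ≤ t
      · simp only [if_pos h7]; exact h5 h7
      · simp only [if_neg h7]; exact h6.symm
    · filter_upwards [eventually_gt_nhds hts] with t' h5 _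
      simp only [if_neg (not_le.2 h5), if_neg (not_le.2 hts)]
      exact EventuallyEq.rfl
  · simp only [if_pos unitInterval.nonneg']; exact h3
  · by_cases hss : s' ≤ s
    · obtain rfl := le_antisymm hs hss
      simp only [if_pos le_rfl]; exact hyf
    · simp only [if_neg hss]; exact EventuallyEq.rfl

theorem IsSolutionNear.mul_const {z : ℂ} (h : IsSolutionNear A Y z) (C : E) :
    IsSolutionNear A (fun w => Y w * C) z :=
  h.mono fun _ hw => (hw.mul_const C).congr_deriv (mul_assoc _ _ _)

theorem ContinuesTo.mul_const (h : ContinuesTo A γ Y Y₁) (C : E) :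
    ContinuesTo A γ (fun w => Y w * C) fun w => Y₁ w * C := by
  obtain ⟨y, h1, h2, h3, h4⟩ := h
  have key : ∀ {g g' : ℂ → E} {z : ℂ}, g =ᶠ[𝓝 z] g' →
    (fun w => g w * C) =ᶠ[𝓝 z] fun w => g' w * C := fun h => h.mono fun w hw => by simp only [hw]
  exact ⟨fun s w => y s w * C, fun s => (h1 s).mul_const C,
    fun s => (h2 s).mono fun t ht => key ht, key h3, key h4⟩

theorem ContinuesTo.congr_left (h : ContinuesTo A γ Y Y₁) (hY : Y =ᶠ[𝓝 (γ 0)] Y') :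
    ContinuesTo A γ Y' Y₁ := by
  obtain ⟨y, h1, h2, h3, h4⟩ := h
  exact ⟨y, h1, h2, h3.trans hY, h4⟩

/-- Analytic continuation along a path is unique. -/
theorem ContinuesTo.unique [CompleteSpace E] (hγ : Continuous γ) (h : ContinuesTo A γ Y Y₁)
    (h' : ContinuesTo A γ Y Y₁') : Y₁ =ᶠ[𝓝 (γ 1)] Y₁' := by
  obtain ⟨y, h1, h2, h3, h4⟩ := h
  obtain ⟨y', h1', h2', h3', h4'⟩ := h'
  -- The set of times at which both continuations agree is open by definition of germs, closed by
  -- the identity theorem on a disc, and contains `0`.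
  set T : Set unitInterval := {s | y s =ᶠ[𝓝 (γ s)] y' s} with hT
  have hopen : IsOpen T := by
    rw [isOpen_iff_mem_nhds]
    intro s hs
    filter_upwards [h2 s, h2' s, (hγ.tendsto s).eventually (EventuallyEq.eventuallyEq_nhds hs)]
      with t ht ht' ht''
    exact ht.trans (ht''.trans ht'.symm)
  have hclosed : IsClosed T := by
    rw [← isOpen_compl_iff, isOpen_iff_mem_nhds]
    intro s hs
    obtain ⟨r, hr, hball⟩ := Metric.eventually_nhds_iff_ball.1
      ((h1 s).analyticAt.eventually_analyticAt.and (h1' s).analyticAt.eventually_analyticAt)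
    filter_upwards [h2 s, h2' s, (hγ.tendsto s).eventually (ball_mem_nhds _ hr)]
      with t ht ht' ht'' htT
    refine hs ?_
    have heq := AnalyticOnNhd.eqOn_of_preconnected_of_eventuallyEq
      (fun z hz => (hball z hz).1) (fun z hz => (hball z hz).2) (convex_ball _ _).isPreconnected
      ht'' (ht.symm.trans (EventuallyEq.trans htT ht'))
    exact eventually_of_mem (ball_mem_nhds _ hr) heq
  have huniv : T = Set.univ := IsClopen.eq_univ ⟨hclosed, hopen⟩ ⟨0, h3.trans h3'.symm⟩
  have h1T : (1 : unitInterval) ∈ T := huniv ▸ Set.mem_univ _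
  exact h4.symm.trans (EventuallyEq.trans h1T h4')

theorem continuous_torusPoint {X : Type*} [TopologicalSpace X] {τ : X → ℂ} {a : X → ℝ × ℝ}
    (hτ : Continuous τ) (ha : Continuous a) : Continuous fun x => torusPoint (τ x) (a x) := by
  unfold torusPoint
  fun_prop

theorem torusPoint_add (τ : ℂ) (b : ℝ × ℝ) (m n : ℤ) :
    torusPoint τ (b.1 + m, b.2 + n) = torusPoint τ b + (m + n * τ) := by
  simp only [torusPoint, ofReal_add, ofReal_intCast]
  ring

theorem OffLattice.torusPoint_notMem {a : ℝ × ℝ} (ha : OffLattice a) {τ : ℂ} (hτ : 0 < τ.im) :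
    torusPoint τ a ∉ periodLattice τ := by
  rintro ⟨k, l, h⟩
  have h2 : a.2 = l := by
    have := congrArg Complex.im h
    simp only [torusPoint, add_im, ofReal_im, mul_im, ofReal_re, zero_mul, zero_add, add_zero,
      intCast_re, intCast_im] at this
    exact mul_right_cancel₀ hτ.ne' this
  have h1 : a.1 = k := by
    have := congrArg Complex.re h
    simpa [torusPoint, h2] using this
  exact ha k l (Prod.ext h1 h2)

variable [CompleteSpace E] {U : Set ℂ} {L M : ℂ → ℂ → E} {P Q : ℂ → E}

/-- Joint solutions can be continued along paths in the real coordinates, uniformly for all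
nearby `τ`. -/
theorem IsLaxPair.exists_continuesTo (h : IsLaxPair U L M P Q) {τ₀ : ℂ} (hτ₀ : τ₀ ∈ U)
    {a : unitInterval → ℝ × ℝ} (ha : Continuous a) (hoff : ∀ s, OffLattice (a s)) {Y : ℂ × ℂ → E}
    (hY : IsJointNear L M Y (τ₀, torusPoint τ₀ (a 0))) (hu : IsUnit (Y (τ₀, torusPoint τ₀ (a 0)))) :
    ∃ f : ℂ × ℂ → E, IsJointNear L M f (τ₀, torusPoint τ₀ (a 1)) ∧
      IsUnit (f (τ₀, torusPoint τ₀ (a 1))) ∧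
      ∀ᶠ τ in 𝓝 τ₀, ContinuesTo (L τ) (fun s => torusPoint τ (a s)) (fun z => Y (τ, z))
        fun z => f (τ, z) := by
  have hcont : Continuous fun x : ℂ × unitInterval => ((x.1, torusPoint x.1 (a x.2)) : ℂ × ℂ) :=
    continuous_fst.prodMk (continuous_torusPoint continuous_fst (ha.comp continuous_snd))
  have hcs : ∀ τ, Continuous fun s : unitInterval => torusPoint τ (a s) := fun τ =>
    continuous_torusPoint continuous_const ha
  have hcτ : ∀ s, Continuous fun τ : ℂ => (τ, torusPoint τ (a s)) := fun s =>
    hcont.comp (by fun_prop : Continuous fun τ : ℂ => (τ, s))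
  -- Charts are balls in `(τ, z)`-space carrying an invertible joint solution, so one chart serves a
  -- whole range of `τ`.
  have hchart : ∀ s, ∃ Φ : ℂ × ℂ → E, ∃ r > 0, ∀ x ∈ ball (τ₀, torusPoint τ₀ (a s)) r,
      IsJointNear L M Φ x ∧ IsUnit (Φ x) := by
    intro s
    obtain ⟨Φ, hΦ, hΦ1⟩ := h.exists_isJointNear (p := (τ₀, torusPoint τ₀ (a s))) hτ₀
      ((hoff s).torusPoint_notMem (h.im_pos _ hτ₀)) 1
    obtain ⟨r, hr, hr'⟩ := hΦ.exists_ball (by rw [hΦ1]; exact isUnit_one)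
    exact ⟨Φ, r, hr, hr'⟩
  choose Φ r hr hΦ using hchart
  set c : unitInterval → Set unitInterval := fun s =>
    (fun t => (τ₀, torusPoint τ₀ (a t))) ⁻¹' ball (τ₀, torusPoint τ₀ (a s)) (r s) with hc
  have hco : ∀ s, IsOpen (c s) := fun s =>
    isOpen_ball.preimage (hcont.comp (by fun_prop : Continuous fun t : unitInterval => (τ₀, t)))
  obtain ⟨t, ht0, htm, ⟨N, hN⟩, htc⟩ := exists_monotone_Icc_subset_open_cover_unitInterval hco
    fun s _ => Set.mem_iUnion.2 ⟨s, mem_ball_self (hr s)⟩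
  have key : ∀ n, ∃ f : ℂ × ℂ → E, IsJointNear L M f (τ₀, torusPoint τ₀ (a (t n))) ∧
      IsUnit (f (τ₀, torusPoint τ₀ (a (t n)))) ∧
      ∀ᶠ τ in 𝓝 τ₀, ContinuesUpTo (L τ) (fun s => torusPoint τ (a s)) (t n) (fun z => Y (τ, z))
        fun z => f (τ, z) := by
    intro n
    induction n with
    | zero =>
      rw [ht0]
      refine ⟨Y, hY, hu, ?_⟩
      filter_upwards [((hcτ 0).tendsto τ₀).eventually hY.eventually] with τ hτ
      refine ⟨fun _ z => Y (τ, z), fun s hs => ?_, fun s hs => ?_, EventuallyEq.rfl,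
        EventuallyEq.rfl⟩
      · obtain rfl := le_antisymm hs unitInterval.nonneg'
        exact hτ.isSolutionNear
      · exact Eventually.of_forall fun _ _ => EventuallyEq.rfl
    | succ n ih =>
      obtain ⟨f, hf, hfu, hfc⟩ := ih
      obtain ⟨i, hi⟩ := htc n
      have hle : t n ≤ t (n + 1) := htm (Nat.le_succ n)
      have hb : ∀ s ∈ Set.Icc (t n) (t (n + 1)), (τ₀, torusPoint τ₀ (a s)) ∈
        ball (τ₀, torusPoint τ₀ (a i)) (r i) := fun s hs => hi hs
      have hn := hb (t n) ⟨le_rfl, hle⟩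
      have hn' := hb (t (n + 1)) ⟨hle, le_rfl⟩
      -- The transition factor between charts depends neither on `z` nor on `τ`; this is where the
      -- joint system is essential.
      obtain ⟨C, hC⟩ := (hΦ i _ hn).1.exists_eventuallyEq_mul (hΦ i _ hn).2 hf
      have hCu : IsUnit C := by
        have h1 := hC.self_of_nhds
        rw [h1] at hfu
        exact ((hΦ i _ hn).2.mul_left_iff).1 hfu
      refine ⟨fun x => Φ i x * C, (hΦ i _ hn').1.mul_const C, (hΦ i _ hn').2.mul hCu, ?_⟩
      -- By compactness of the time interval, the deformed path segment stays in the same chart for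
      -- all `τ` near `τ₀`.
      have h1 : ∀ᶠ τ in 𝓝 τ₀, ∀ s ∈ Set.Icc (t n) (t (n + 1)),
          (τ, torusPoint τ (a s)) ∈ ball (τ₀, torusPoint τ₀ (a i)) (r i) :=
        isCompact_Icc.eventually_forall_of_forall_eventually fun s hs =>
          (hcont.tendsto (τ₀, s)).eventually (isOpen_ball.mem_nhds (hb s hs))
      filter_upwards [hfc, h1, ((hcτ (t n)).tendsto τ₀).eventually hC.eventuallyEq_nhds]
        with τ h2 h3 h4
      refine h2.extend (hcs τ) hle (fun s hs => ?_) ?_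
      · exact ((hΦ i _ (h3 s hs)).1.mul_const C).isSolutionNear
      · have h5 : Continuous fun w : ℂ => (τ, w) := by fun_prop
        exact (h5.tendsto (torusPoint τ (a (t n)))).eventually h4
  obtain ⟨f, hf, hfu, hfc⟩ := key N
  rw [hN N le_rfl] at hf hfu hfc
  exact ⟨f, hf, hfu, hfc.mono fun τ hτ => hτ.continuesTo⟩

end Continuation

/-! ## Isomonodromy of Lax pairs -/

section Exponential

variable {E : Type*} [NormedRing E] [NormedAlgebra ℂ E] [CompleteSpace E]

theorem exp_add_of_commute' {x y : E} (h : Commute x y) :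
    NormedSpace.exp (x + y) = NormedSpace.exp x * NormedSpace.exp y :=
  letI := NormedAlgebra.restrictScalars ℚ ℂ E
  NormedSpace.exp_add_of_commute h

theorem semiconjBy_exp_right {x a b : E} (h : SemiconjBy x a b) :
    SemiconjBy x (NormedSpace.exp a) (NormedSpace.exp b) :=
  letI := NormedAlgebra.restrictScalars ℚ ℂ E
  h.exp_right

theorem exp_mul_exp_neg (x : E) : NormedSpace.exp x * NormedSpace.exp (-x) = 1 := by
  rw [← exp_add_of_commute' (Commute.refl x).neg_right, add_neg_cancel, NormedSpace.exp_zero]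

theorem exp_neg_mul_exp (x : E) : NormedSpace.exp (-x) * NormedSpace.exp x = 1 := by
  rw [← exp_add_of_commute' (Commute.refl x).neg_left, neg_add_cancel, NormedSpace.exp_zero]

/-- The derivative of the exponential of a commuting family. -/
theorem hasDerivAt_exp_of_commute {q : ℂ → E} {q' : E} {τ : ℂ} (h : ∀ t, Commute (q t) (q τ))
    (hq : HasDerivAt q q' τ) :
    HasDerivAt (fun t => NormedSpace.exp (q t)) (q' * NormedSpace.exp (q τ)) τ := by
  have h1 : HasDerivAt (fun t => NormedSpace.exp (q t - q τ)) q' τ := by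
    have h2 : HasFDerivAt NormedSpace.exp (1 : E →L[ℂ] E) (q τ - q τ) := by
      rw [sub_self]; exact hasFDerivAt_exp_zero
    exact h2.comp_hasDerivAt τ (hq.sub_const (q τ))
  refine (h1.mul_const (NormedSpace.exp (q τ))).congr_of_eventuallyEq
    (Eventually.of_forall fun t => ?_)
  simp only
  rw [← exp_add_of_commute' ((h t).sub_left (Commute.refl _)), sub_add_cancel]

end Exponential

/-! ### Iterated quasi-periodicity -/

section Isomonodromy

open Metric

variable {E : Type*} [NormedRing E] [NormedAlgebra ℂ E] [CompleteSpace E]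
  {U : Set ℂ} {L M : ℂ → ℂ → E} {P Q : ℂ → E}

/-- The multiplier `exp(-2 π i n Q)`. -/
def multiplier (Q : E) (n : ℤ) : E := NormedSpace.exp (-((2 * Real.pi * I * n : ℂ) • Q))

omit [CompleteSpace E] in
theorem multiplier_zero (Q : E) : multiplier Q 0 = 1 := by
  simp [multiplier, NormedSpace.exp_zero]

theorem multiplier_add (Q : E) (m n : ℤ) :
    multiplier Q (m + n) = multiplier Q m * multiplier Q n := by
  unfold multiplier
  rw [← exp_add_of_commute']
  · congr 1
    rw [← neg_add, ← add_smul]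
    congr 2
    push_cast
    ring
  · exact (((Commute.refl Q).smul_left _).smul_right _).neg_left.neg_right

theorem exp_mul_multiplier (Q : E) (n : ℤ) :
    NormedSpace.exp ((2 * Real.pi * I * n : ℂ) • Q) * multiplier Q n = 1 := exp_mul_exp_neg _

theorem multiplier_mul_exp (Q : E) (n : ℤ) :
    multiplier Q n * NormedSpace.exp ((2 * Real.pi * I * n : ℂ) • Q) = 1 := exp_neg_mul_exp _

theorem isUnit_multiplier (Q : E) (n : ℤ) : IsUnit (multiplier Q n) :=
  ⟨⟨_, _, multiplier_mul_exp Q n, exp_mul_multiplier Q n⟩, rfl⟩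

theorem commute_multiplier {P Q : E} (h : Commute P Q) (n : ℤ) : Commute P (multiplier Q n) :=
  semiconjBy_exp_right ((h.smul_right _).neg_right)

theorem add_intCast_mul_notMem {τ z : ℂ} (hz : z ∉ periodLattice τ) (n : ℤ) :
    z + n * τ ∉ periodLattice τ := by
  have := int_mem_periodLattice τ 0 n
  rw [Int.cast_zero, zero_add] at this
  rwa [add_mem_periodLattice_iff this]

/-- The conjugation formula is recast as an intertwining relation, with the multiplier on one side
of each factor. In this form it iterates and inverts without tracking inverse exponentials. -/
theorem multiplier_step (Q : E) {a b c : E}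
    (h : a = NormedSpace.exp ((2 * Real.pi * I : ℂ) • Q) * b *
      NormedSpace.exp (-((2 * Real.pi * I : ℂ) • Q)) - c) (hc : Commute c Q) :
    multiplier Q 1 * a = b * multiplier Q 1 - c * multiplier Q 1 := by
  have h1 : NormedSpace.exp (-((2 * Real.pi * I : ℂ) • Q)) = multiplier Q 1 := by
    simp [multiplier]
  have h2 := multiplier_mul_exp Q 1
  rw [Int.cast_one, mul_one] at h2
  rw [h, h1, mul_sub, ← mul_assoc, ← mul_assoc, h2, one_mul, (commute_multiplier hc 1).eq]

theorem multiplier_step_neg (Q : E) {a b c : E}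
    (h : multiplier Q 1 * a = b * multiplier Q 1 - c * multiplier Q 1) (hc : Commute c Q) :
    multiplier Q (-1) * b = a * multiplier Q (-1) + c * multiplier Q (-1) := by
  have h1 : multiplier Q (-1) * multiplier Q 1 = 1 := by
    rw [← multiplier_add, neg_add_cancel, multiplier_zero]
  have h2 : multiplier Q 1 * multiplier Q (-1) = 1 := by
    rw [← multiplier_add, add_neg_cancel, multiplier_zero]
  have h3 : b * multiplier Q 1 = multiplier Q 1 * a + c * multiplier Q 1 := by rw [h]; abel
  calc multiplier Q (-1) * b = multiplier Q (-1) * (b * multiplier Q 1) * multiplier Q (-1) := by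
        rw [mul_assoc, mul_assoc, h2, mul_one]
    _ = multiplier Q (-1) * multiplier Q 1 * a * multiplier Q (-1) +
        multiplier Q (-1) * c * (multiplier Q 1 * multiplier Q (-1)) := by
        rw [h3]; noncomm_ring
    _ = _ := by rw [h1, h2, one_mul, mul_one, (commute_multiplier hc (-1)).eq]

/-- Induction on `n` in both directions. Each shift by `τ` adds `2πi (L - P)` to `M`, and `P` passes
through the multipliers because it commutes with `Q`. -/
theorem LaxQuasiPeriodic.multiplier_mul (h : LaxQuasiPeriodic U L M P Q)
    (hPQ : ∀ t, Commute (P t) (Q t)) {τ : ℂ} (hτ : τ ∈ U) (n : ℤ) :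
    ∀ z, z ∉ periodLattice τ → multiplier (Q τ) n * L τ (z + n * τ) = L τ z * multiplier (Q τ) n ∧
      multiplier (Q τ) n * M τ (z + n * τ) =
        (M τ z + (2 * Real.pi * I * n : ℂ) • L τ z) * multiplier (Q τ) n
          - (2 * Real.pi * I * n : ℂ) • P τ * multiplier (Q τ) n := by
  have hc : Commute ((2 * Real.pi * I : ℂ) • P τ) (Q τ) := (hPQ τ).smul_left _
  have hL : ∀ z, z ∉ periodLattice τ → multiplier (Q τ) 1 * L τ (z + τ) =
      L τ z * multiplier (Q τ) 1 - 0 * multiplier (Q τ) 1 := fun z hz =>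
    multiplier_step (Q τ) (by rw [sub_zero]; exact h.L_tau τ hτ z hz) (Commute.zero_left _)
  have hM : ∀ z, z ∉ periodLattice τ → multiplier (Q τ) 1 * M τ (z + τ) =
      (M τ z + (2 * Real.pi * I : ℂ) • L τ z) * multiplier (Q τ) 1
        - (2 * Real.pi * I : ℂ) • P τ * multiplier (Q τ) 1 := fun z hz =>
    multiplier_step (Q τ) (h.M_tau τ hτ z hz) hc
  induction n with
  | zero => intro z hz; simp [multiplier_zero]
  | succ n ih =>
    intro z hz
    have hz' := add_intCast_mul_notMem hz n
    obtain ⟨h1, h2⟩ := ih z hz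
    have h3 := hL _ hz'
    have h4 := hM _ hz'
    rw [Int.cast_natCast] at h1 h2 h3 h4
    have h5 : z + ((n + 1 : ℤ) : ℂ) * τ = z + n * τ + τ := by push_cast; ring
    rw [multiplier_add, h5, mul_assoc, h3, mul_assoc, h4]
    refine ⟨?_, ?_⟩
    · rw [zero_mul, sub_zero, ← mul_assoc, h1, mul_assoc]
    · rw [mul_sub, ← mul_assoc, mul_add, h2, mul_smul_comm, h1, ← mul_assoc,
        ← (commute_multiplier hc n).eq]
      push_cast
      simp only [mul_add, add_smul, add_mul, sub_mul, smul_mul_assoc, mul_assoc, mul_one]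
      abel
  | pred n ih =>
    intro z hz
    have hz' : z + ((-(n : ℤ) - 1 : ℤ) : ℂ) * τ ∉ periodLattice τ := add_intCast_mul_notMem hz _
    obtain ⟨h1, h2⟩ := ih z hz
    set w := z + ((-(n : ℤ) - 1 : ℤ) : ℂ) * τ with hw
    have h5 : z + ((-(n : ℤ) : ℤ) : ℂ) * τ = w + τ := by rw [hw]; push_cast; ring
    rw [h5] at h1 h2
    have h3 := multiplier_step_neg (Q τ) (hL w hz') (Commute.zero_left _)
    have h4 := multiplier_step_neg (Q τ) (hM w hz') hc
    rw [zero_mul, add_zero] at h3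
    have h6 : multiplier (Q τ) (-(n : ℤ) - 1) =
        multiplier (Q τ) (-(n : ℤ)) * multiplier (Q τ) (-1) := by
      rw [← multiplier_add]; rfl
    have h7 : multiplier (Q τ) (-1) * M τ w = M τ (w + τ) * multiplier (Q τ) (-1) +
        (2 * Real.pi * I : ℂ) • P τ * multiplier (Q τ) (-1) -
        (2 * Real.pi * I : ℂ) • (L τ (w + τ) * multiplier (Q τ) (-1)) := by
      rw [← h4, mul_add, mul_smul_comm, h3, add_sub_cancel_right]
    rw [h6, mul_assoc, h3, mul_assoc, h7]
    refine ⟨by rw [← mul_assoc, h1, mul_assoc], ?_⟩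
    rw [mul_sub, mul_add, mul_smul_comm, ← mul_assoc, ← mul_assoc, ← mul_assoc, h1, h2,
      ← (commute_multiplier hc _).eq]
    push_cast
    simp only [mul_sub, sub_smul, add_mul, sub_mul, smul_mul_assoc, mul_assoc, mul_one]
    abel

end Isomonodromy

/-! ### Translation of joint solutions by periods -/

section Isomonodromy

open Metric

variable {E : Type*} [NormedRing E] [NormedAlgebra ℂ E] [CompleteSpace E]
  {U : Set ℂ} {L M : ℂ → ℂ → E} {P Q : ℂ → E}

/-- Since `2πi dQ/dτ = P`, the multiplier contributes `-n P`, exactly compensating the `P`-term in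
the quasi-periodicity of `M`. -/
theorem IsLaxPair.hasDerivAt_multiplier (h : IsLaxPair U L M P Q) {τ : ℂ} (hτ : τ ∈ U) (n : ℤ) :
    HasDerivAt (fun t => multiplier (Q t) n) (-(n : ℂ) • P τ * multiplier (Q τ) n) τ := by
  have h1 := (HasDerivAt.const_smul (2 * Real.pi * I * n : ℂ) (h.deriv_Q τ hτ)).neg
  refine (hasDerivAt_exp_of_commute (fun t => ?_) h1).congr_deriv ?_
  · exact (((h.commute_Q t τ).smul_left _).smul_right _).neg_left.neg_right
  · congr 1
    rw [smul_smul, neg_smul, mul_right_comm, mul_inv_cancel₀ two_pi_I_ne_zero', one_mul]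

/-- The translate of a joint solution by a period, multiplied by `exp(-2 π i n Q)`, is a joint
solution. -/
theorem IsLaxPair.isJointNear_translate (h : IsLaxPair U L M P Q) {τ₀ z₀ : ℂ} (hτ₀ : τ₀ ∈ U)
    (hz₀ : z₀ ∉ periodLattice τ₀) (m n : ℤ) {f : ℂ × ℂ → E}
    (hf : IsJointNear L M f (τ₀, z₀ + (m + n * τ₀))) :
    IsJointNear L M (fun x => multiplier (Q x.1) n * f (x.1, x.2 + (m + n * x.1))) (τ₀, z₀) := by
  have hmul : AnalyticAt ℂ (fun t => multiplier (Q t) n) τ₀ :=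
    analyticAt_iff_eventually_differentiableAt.2 (by
      filter_upwards [h.isOpen.mem_nhds hτ₀] with t ht
      exact (h.hasDerivAt_multiplier ht n).differentiableAt)
  have hshift : AnalyticAt ℂ (fun x : ℂ × ℂ => (x.1, x.2 + (m + n * x.1))) (τ₀, z₀) :=
    analyticAt_fst.prod
      (analyticAt_snd.add (analyticAt_const.add (analyticAt_const.mul analyticAt_fst)))
  refine ⟨(AnalyticAt.fun_comp (f := fun x : ℂ × ℂ => x.1) hmul analyticAt_fst).mul
    (AnalyticAt.fun_comp (f := fun x : ℂ × ℂ => (x.1, x.2 + (m + n * x.1))) hf.1 hshift), ?_⟩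
  filter_upwards [hshift.continuousAt.eventually hf.eventually,
    h.eventually_mem (p := (τ₀, z₀)) hτ₀ hz₀] with x hx hxU
  obtain ⟨hτ, hz⟩ := hxU
  have hz1 : x.2 + m ∉ periodLattice x.1 := by
    have := int_mem_periodLattice x.1 m 0
    rw [Int.cast_zero, zero_mul, add_zero] at this
    rwa [add_mem_periodLattice_iff this]
  obtain ⟨h1, h2⟩ := h.quasiPeriodic.multiplier_mul (fun t => h.commute_P t t) hτ n _ hz1
  have h0 : ∀ A : ℂ → ℂ → E, (∀ z, z ∉ periodLattice x.1 → A x.1 (z + 1) = A x.1 z) →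
      A x.1 (x.2 + m) = A x.1 x.2 := by
    intro A hA
    have key : ∀ k : ℤ, ∀ z, z ∉ periodLattice x.1 → A x.1 (z + k) = A x.1 z := by
      have hk : ∀ (k : ℤ) z, z ∉ periodLattice x.1 → z + k ∉ periodLattice x.1 := by
        intro k z hz
        have := int_mem_periodLattice x.1 k 0
        rw [Int.cast_zero, zero_mul, add_zero] at this
        rwa [add_mem_periodLattice_iff this]
      intro k
      induction k with
      | zero => intro z _; simp
      | succ k ih =>
        intro z hz
        rw [← ih z hz, ← hA _ (hk k z hz)]
        push_cast
        rw [add_assoc]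
      | pred k ih =>
        intro z hz
        rw [← ih z hz, ← hA _ (hk _ z hz)]
        push_cast
        congr 1
        ring
    exact key m x.2 hz
  rw [h0 L (h.quasiPeriodic.L_one x.1 hτ), add_assoc] at h1 h2
  rw [h0 M (h.quasiPeriodic.M_one x.1 hτ)] at h2
  have hd := hx.hasFDerivAt.1
  have hfd := hx.hasFDerivAt.2
  constructor
  · have h3 : HasDerivAt (fun w => f (x.1, w + (m + n * x.1)))
        (fderiv ℂ f (x.1, x.2 + (m + n * x.1)) (0, 1)) x.2 :=
      HasFDerivAt.comp_hasDerivAt (f := fun w : ℂ => (x.1, w + (m + n * x.1))) x.2 hd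
        ((hasDerivAt_const _ _).prodMk ((hasDerivAt_id x.2).add_const _))
    refine (HasDerivAt.const_mul (multiplier (Q x.1) n) h3).congr_deriv ?_
    rw [hfd]
    simp only [one_smul, zero_smul, sub_zero]
    rw [← mul_assoc, h1, mul_assoc]
  · have h3 : HasDerivAt (fun t => f (t, x.2 + (m + n * t)))
        (fderiv ℂ f (x.1, x.2 + (m + n * x.1)) (1, n)) x.1 := by
      have h4 : HasDerivAt (fun t : ℂ => x.2 + (m + n * t)) n x.1 := by
        simpa using (((hasDerivAt_id x.1).const_mul (n : ℂ)).const_add (m : ℂ)).const_add x.2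
      exact HasFDerivAt.comp_hasDerivAt (f := fun t : ℂ => (t, x.2 + (m + n * t))) x.1 hd
        ((hasDerivAt_id x.1).prodMk h4)
    refine (HasDerivAt.mul (h.hasDerivAt_multiplier hτ n) h3).congr_deriv ?_
    rw [hfd]
    simp only [one_smul]
    rw [← mul_assoc (multiplier (Q x.1) n), mul_sub, mul_smul_comm, mul_smul_comm, h1, h2]
    simp only [neg_smul, add_mul, sub_mul, smul_mul_assoc, smul_sub, smul_add, smul_smul, smul_neg,
      neg_mul, mul_assoc]
    have h5 : (2 * (Real.pi * I) : ℂ)⁻¹ * (2 * (Real.pi * (I * n))) = n := by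
      have h6 : (2 * (Real.pi * (I * n)) : ℂ) = 2 * (Real.pi * I) * n := by ring
      rw [h6, ← mul_assoc (2 : ℂ), inv_mul_cancel_left₀ two_pi_I_ne_zero']
    simp only [h5]
    abel

/-- The monodromy of a joint solution does locally not depend on `τ`. -/
theorem IsLaxPair.exists_hasMonodromy (h : IsLaxPair U L M P Q) {τ₀ : ℂ} (hτ₀ : τ₀ ∈ U)
    {b : ℝ × ℝ} {m n : ℤ} (c : TorusCycle b m n) {Y : ℂ × ℂ → E}
    (hY : IsJointNear L M Y (τ₀, torusPoint τ₀ b)) (hu : IsUnit (Y (τ₀, torusPoint τ₀ b))) :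
    ∃ Γ : E, IsUnit Γ ∧ ∀ᶠ τ in 𝓝 τ₀, HasMonodromy L Q τ c (fun z => Y (τ, z)) Γ := by
  have hb : OffLattice b := by simpa using c.off 0
  have ha0 : c.path 0 = b := c.path.source
  obtain ⟨f, hf, hfu, hfc⟩ := h.exists_continuesTo hτ₀ c.path.continuous c.off (by rwa [ha0])
    (by rwa [ha0])
  rw [c.path.target, torusPoint_add] at hf hfu
  -- Both are joint solutions near the same point, so the monodromy is their constant ratio.
  obtain ⟨C, hC⟩ := hY.exists_eventuallyEq_mul hu (h.isJointNear_translate hτ₀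
    (hb.torusPoint_notMem (h.im_pos _ hτ₀)) m n hf)
  have hcτ : Continuous fun τ : ℂ => (τ, torusPoint τ b) :=
    continuous_id.prodMk (continuous_torusPoint continuous_id continuous_const)
  have hCu : IsUnit C := by
    have h1 := (isUnit_multiplier (Q τ₀) n).mul hfu
    have h2 := hC.self_of_nhds
    simp only at h2
    rw [h2] at h1
    exact (hu.mul_left_iff).1 h1
  refine ⟨C, hCu, ?_⟩
  filter_upwards [hfc, (hcτ.tendsto τ₀).eventually hC.eventuallyEq_nhds] with τ h1 h2
  refine ⟨_, h1, ?_⟩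
  have h5 : Continuous fun w : ℂ => (τ, w) := by fun_prop
  refine ((h5.tendsto (torusPoint τ b)).eventually h2).mono fun w hw => ?_
  simp only at hw
  rw [mul_assoc, ← hw, ← mul_assoc, exp_mul_multiplier, one_mul]

end Isomonodromy

/-! ### Constancy of the monodromy -/

section Isomonodromy

open Metric

variable {E : Type*} [NormedRing E] [NormedAlgebra ℂ E] [CompleteSpace E]
  {U : Set ℂ} {L M : ℂ → ℂ → E} {P Q : ℂ → E}

theorem HasMonodromy.unique {τ : ℂ} {b : ℝ × ℝ} {m n : ℤ} {c : TorusCycle b m n} {Y : ℂ → E}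
    {Γ Γ' : E} (h : HasMonodromy L Q τ c Y Γ) (h' : HasMonodromy L Q τ c Y Γ')
    (hu : IsUnit (Y (torusPoint τ b))) : Γ = Γ' := by
  obtain ⟨Y₁, h1, h2⟩ := h
  obtain ⟨Y₁', h1', h2'⟩ := h'
  have h3 := h1.unique (continuous_torusPoint continuous_const c.path.continuous) h1'
  rw [c.path.target, torusPoint_add] at h3
  have h4 := h2.self_of_nhds
  rw [h3.self_of_nhds, h2'.self_of_nhds, mul_assoc, mul_assoc] at h4
  have h6 := congrArg (multiplier (Q τ) n * ·) h4
  simp only [← mul_assoc, multiplier_mul_exp, one_mul] at h6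
  exact (hu.mul_left_cancel h6).symm

omit [CompleteSpace E] in
theorem HasMonodromy.mul_const {τ : ℂ} {b : ℝ × ℝ} {m n : ℤ} {c : TorusCycle b m n}
    {Y Y' : ℂ → E} {Γ : E} (h : HasMonodromy L Q τ c Y Γ) (C : Eˣ)
    (hY : Y' =ᶠ[𝓝 (torusPoint τ b)] fun z => Y z * C) :
    HasMonodromy L Q τ c Y' (↑C⁻¹ * Γ * C) := by
  obtain ⟨Y₁, h1, h2⟩ := h
  refine ⟨_, (h1.mul_const (C : E)).congr_left ?_, ?_⟩
  · simp only [c.path.source]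
    exact hY.symm
  · filter_upwards [h2, hY] with z h3 h4
    rw [h3, h4]
    simp only [mul_assoc, Units.mul_inv_cancel_left]

/-- Every fundamental solution has an invertible monodromy along each cycle. -/
theorem IsLaxPair.monodromy_exists (h : IsLaxPair U L M P Q) {τ : ℂ} (hτ : τ ∈ U) {b : ℝ × ℝ}
    {Y : ℂ → E} (hY : IsFundamentalNear (L τ) Y (torusPoint τ b)) {m n : ℤ}
    (c : TorusCycle b m n) : ∃ Γ : E, IsUnit Γ ∧ HasMonodromy L Q τ c Y Γ := by
  have hb : OffLattice b := by simpa using c.off 0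
  obtain ⟨Φ, hΦ, hΦ1⟩ := h.exists_isJointNear (p := (τ, torusPoint τ b)) hτ
    (hb.torusPoint_notMem (h.im_pos _ hτ)) 1
  have hu : IsUnit (Φ (τ, torusPoint τ b)) := by rw [hΦ1]; exact isUnit_one
  obtain ⟨Γ, hΓ, hmon⟩ := h.exists_hasMonodromy hτ c hΦ hu
  have hfund : IsFundamentalNear (L τ) (fun z => Φ (τ, z)) (torusPoint τ b) :=
    ⟨hΦ.isSolutionNear, hu⟩
  obtain ⟨C, hC⟩ := hfund.exists_eventuallyEq_mul hY.1
  have hCu : IsUnit C := by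
    have h1 := hY.2
    rw [hC.self_of_nhds] at h1
    exact (hu.mul_left_iff).1 h1
  obtain ⟨C, rfl⟩ := hCu
  exact ⟨_, (C⁻¹.isUnit.mul hΓ).mul C.isUnit, hmon.self_of_nhds.mul_const C hC⟩

theorem IsLaxPair.joint_exists (h : IsLaxPair U L M P Q) {τ₀ : ℂ} (hτ₀ : τ₀ ∈ U) {b : ℝ × ℝ}
    (hb : OffLattice b) {Y₀ : E} (hY₀ : IsUnit Y₀) :
    ∃ W : Set ℂ, IsOpen W ∧ τ₀ ∈ W ∧ W ⊆ U ∧ ∃ Y : ℂ → ℂ → E,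
      IsJointSolution L M W b Y ∧ Y τ₀ (torusPoint τ₀ b) = Y₀ := by
  obtain ⟨f, hf, hf0⟩ := h.exists_isJointNear (p := (τ₀, torusPoint τ₀ b)) hτ₀
    (hb.torusPoint_notMem (h.im_pos _ hτ₀)) Y₀
  obtain ⟨r, hr, hball⟩ := hf.exists_ball (hf0 ▸ hY₀)
  have hcτ : Continuous fun τ : ℂ => (τ, torusPoint τ b) :=
    continuous_id.prodMk (continuous_torusPoint continuous_id continuous_const)
  exact ⟨U ∩ (fun τ : ℂ => (τ, torusPoint τ b)) ⁻¹' ball (τ₀, torusPoint τ₀ b) r,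
    h.isOpen.inter (isOpen_ball.preimage hcτ), ⟨hτ₀, mem_ball_self hr⟩, Set.inter_subset_left,
    fun t z => f (t, z), fun τ hτ => ⟨(hball _ hτ.2).1.1, (hball _ hτ.2).2, (hball _ hτ.2).1.2⟩,
    hf0⟩

/-- Near each `τ` a single `Γ₀` is a monodromy for all neighbouring values, and monodromies are
unique; so `Γ` is locally constant. -/
theorem IsLaxPair.monodromy_deriv_eq_zero (h : IsLaxPair U L M P Q) {W : Set ℂ} (hW : IsOpen W)
    (hWU : W ⊆ U) {b : ℝ × ℝ} {Y : ℂ → ℂ → E} (hY : IsJointSolution L M W b Y) {m n : ℤ}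
    (c : TorusCycle b m n) {Γ : ℂ → E} (hΓ : ∀ τ ∈ W, HasMonodromy L Q τ c (Y τ) (Γ τ)) :
    ∀ τ ∈ W, HasDerivAt Γ 0 τ := by
  intro τ hτ
  obtain ⟨Γ₀, -, hmon⟩ := h.exists_hasMonodromy (Y := fun x => Y x.1 x.2) (hWU hτ) c
    ⟨(hY τ hτ).1, (hY τ hτ).2.2⟩ (hY τ hτ).2.1
  refine (hasDerivAt_const τ Γ₀).congr_of_eventuallyEq ?_
  filter_upwards [hmon, hW.mem_nhds hτ] with t h1 h2
  exact (hΓ t h2).unique h1 (hY t h2).2.1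

/-- Locally in `τ`, the equations `dY/dz = L Y` have fundamental solutions with the same monodromy
along all cycles. -/
theorem IsLaxPair.exists_ball_hasMonodromy (h : IsLaxPair U L M P Q) {τ₀ : ℂ} (hτ₀ : τ₀ ∈ U)
    {b : ℝ × ℝ} (hb : OffLattice b) : ∃ r > 0, ball τ₀ r ⊆ U ∧ ∃ Y : ℂ → ℂ → E,
      (∀ τ ∈ ball τ₀ r, IsFundamentalNear (L τ) (Y τ) (torusPoint τ b)) ∧
      ∀ (m n : ℤ) (c : TorusCycle b m n), ∃ Γ : E, ∀ τ ∈ ball τ₀ r,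
        HasMonodromy L Q τ c (Y τ) Γ := by
  obtain ⟨W, hW, hτW, hWU, Y, hY, -⟩ := h.joint_exists hτ₀ hb (Y₀ := 1) isUnit_one
  obtain ⟨r, hr, hrW⟩ := Metric.isOpen_iff.1 hW τ₀ hτW
  have hfund : ∀ τ ∈ ball τ₀ r, IsFundamentalNear (L τ) (Y τ) (torusPoint τ b) := fun τ hτ =>
    ⟨IsJointNear.isSolutionNear (f := fun x : ℂ × ℂ => Y x.1 x.2) (M := M)
      (p := (τ, torusPoint τ b)) ⟨(hY τ (hrW hτ)).1, (hY τ (hrW hτ)).2.2⟩, (hY τ (hrW hτ)).2.1⟩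
  refine ⟨r, hr, hrW.trans hWU, Y, hfund, fun m n c => ?_⟩
  have hex : ∀ τ, ∃ Γ : E, τ ∈ ball τ₀ r → HasMonodromy L Q τ c (Y τ) Γ := by
    intro τ
    by_cases hτ : τ ∈ ball τ₀ r
    · obtain ⟨Γ, -, hΓ⟩ := h.monodromy_exists (hWU (hrW hτ)) (hfund τ hτ) c
      exact ⟨Γ, fun _ => hΓ⟩
    · exact ⟨0, fun h => absurd h hτ⟩
  choose Γ hΓ using hex
  -- The neighbourhood in `exists_hasMonodromy` depends on the cycle. Vanishing of the derivative on
  -- the whole ball yields a radius that works for all cycles at once.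
  have hd := h.monodromy_deriv_eq_zero isOpen_ball (hrW.trans hWU)
    (fun τ hτ => hY τ (hrW hτ)) c hΓ
  refine ⟨Γ τ₀, fun τ hτ => ?_⟩
  have h3 := (convex_ball τ₀ r).norm_image_sub_le_of_norm_hasDerivWithin_le (C := 0)
    (fun y hy => (hd y hy).hasDerivWithinAt) (fun y _ => by simp) (mem_ball_self hr) hτ
  rw [zero_mul, norm_le_zero_iff, sub_eq_zero] at h3
  exact h3 ▸ hΓ τ hτ

/-- The data `Γ` are fixed at one point. Whether some fundamental solution at `τ` realizes them is a
locally constant property of `τ`, so it spreads over the preconnected set `U`. -/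
theorem IsLaxPair.monodromy_const (h : IsLaxPair U L M P Q) (hU : IsPreconnected U) {b : ℝ × ℝ}
    (hb : OffLattice b) : ∃ Γ : ∀ m n : ℤ, TorusCycle b m n → Eˣ, ∀ τ ∈ U, ∃ Y : ℂ → E,
      IsFundamentalNear (L τ) Y (torusPoint τ b) ∧
      ∀ (m n : ℤ) (c : TorusCycle b m n), HasMonodromy L Q τ c Y (Γ m n c) := by
  rcases U.eq_empty_or_nonempty with rfl | ⟨τ₁, hτ₁⟩
  · exact ⟨fun _ _ _ => 1, fun τ hτ => absurd hτ (Set.notMem_empty τ)⟩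
  obtain ⟨r, hr, hrU, Y, hY, -⟩ := h.exists_ball_hasMonodromy hτ₁ hb
  have hex : ∀ (m n : ℤ) (c : TorusCycle b m n), ∃ Γ : Eˣ, HasMonodromy L Q τ₁ c (Y τ₁) Γ := by
    intro m n c
    obtain ⟨_, ⟨Γ, rfl⟩, hΓ⟩ := h.monodromy_exists hτ₁ (hY τ₁ (mem_ball_self hr)) c
    exact ⟨Γ, hΓ⟩
  choose Γ hΓ using hex
  refine ⟨Γ, fun τ hτ => ?_⟩
  set good : ℂ → Prop := fun τ => ∃ Y : ℂ → E, IsFundamentalNear (L τ) Y (torusPoint τ b) ∧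
    ∀ (m n : ℤ) (c : TorusCycle b m n), HasMonodromy L Q τ c Y (Γ m n c) with hgood
  -- If the solution `Z` at `s` equals `Y s` times `C`, then `Y t` times the same `C` has the same
  -- conjugated monodromies at `t`.
  have hstep : ∀ τ₀ ∈ U, ∃ r > 0, ∀ s ∈ ball τ₀ r, ∀ t ∈ ball τ₀ r, good s → good t := by
    intro τ₀ hτ₀
    obtain ⟨r, hr, hrU, Y, hY, hmon⟩ := h.exists_ball_hasMonodromy hτ₀ hb
    refine ⟨r, hr, fun s hs t ht ⟨Z, hZ, hZm⟩ => ?_⟩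
    obtain ⟨C, hC⟩ := (hY s hs).exists_eventuallyEq_mul hZ.1
    have hCu : IsUnit C := by
      have h1 := hZ.2
      rw [hC.self_of_nhds] at h1
      exact ((hY s hs).2.mul_left_iff).1 h1
    obtain ⟨C, rfl⟩ := hCu
    refine ⟨fun z => Y t z * C, ⟨(hY t ht).1.mul_const _, (hY t ht).2.mul C.isUnit⟩,
      fun m n c => ?_⟩
    obtain ⟨G, hG⟩ := hmon m n c
    rw [(hZm m n c).unique ((hG s hs).mul_const C hC) hZ.2]
    exact (hG t ht).mul_const C EventuallyEq.rfl
  refine hU.induction₂ (fun s t => good s ↔ good t) (fun s hs => ?_)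
    (fun s t u _ _ _ h1 h2 => h1.trans h2) (fun s t _ _ h1 => h1.symm) hτ₁ hτ |>.1
    ⟨Y τ₁, hY τ₁ (mem_ball_self hr), hΓ⟩
  obtain ⟨r, hr, hst⟩ := hstep s hs
  refine mem_nhdsWithin_of_mem_nhds (mem_of_superset (ball_mem_nhds s hr) fun t ht => ?_)
  exact ⟨hst s (mem_ball_self hr) t ht, hst t ht s (mem_ball_self hr)⟩

/-- A Lax pair on the torus is isomonodromic. -/
theorem IsLaxPair.isomonodromic (h : IsLaxPair U L M P Q) : Isomonodromic U L M Q where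
  monodromy_exists τ hτ b Y hY m n c := by
    obtain ⟨Γ, hΓ, hmon⟩ := h.monodromy_exists hτ hY c
    exact ⟨Γ, hΓ, fun Γ' => ⟨fun h' => h'.unique hmon hY.2, fun h' => h' ▸ hmon⟩⟩
  joint_exists τ₀ hτ₀ b hb Y₀ hY₀ := h.joint_exists hτ₀ hb hY₀
  deriv_eq_zero W hW hWU b Y hY m n c Γ hΓ := h.monodromy_deriv_eq_zero hW hWU hY c hΓ
  monodromy_const hU b hb := h.monodromy_const hU hb
  standard_data_const hU := by
    obtain ⟨Γ, hΓ⟩ := h.monodromy_const hU (b := (1 / 2, 1 / 2))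
      fun k _ hk => half_ne_intCast k (congrArg Prod.fst hk)
    refine ⟨Γ 0 0 cycleZero, Γ 1 0 cycleAlpha, Γ 0 1 cycleBeta, fun τ hτ => ?_⟩
    obtain ⟨Y, hY, hmon⟩ := hΓ τ hτ
    exact ⟨Y, hY, hmon _ _ _, hmon _ _ _, hmon _ _ _⟩

end Isomonodromy

/-! ## Root bases -/

section RootBases

variable {𝔤 : Type*} [LieRing 𝔤] [LieAlgebra ℂ 𝔤] [FiniteDimensional ℂ 𝔤]
  [LieAlgebra.IsSimple ℂ 𝔤] {H : LieSubalgebra ℂ 𝔤} [H.IsCartanSubalgebra]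
  {ι : Type*} [Fintype ι] [DecidableEq ι] (B : RootBasis H ι)

omit [LieAlgebra.IsSimple ℂ 𝔤] in
theorem mem_root_iff {α : Weight ℂ H 𝔤} : α ∈ H.root ↔ (α : H → ℂ) ≠ 0 := by
  rw [LieSubalgebra.root, Finset.mem_filter_univ]
  rfl

theorem neg_mem_root {α : Weight ℂ H 𝔤} (hα : α ∈ H.root) : -α ∈ H.root := by
  rw [mem_root_iff] at hα ⊢
  simpa using hα

namespace RootBasis

theorem pair_neg (α : Weight ℂ H 𝔤) (q : ι → ℂ) : B.pair (-α) q = -B.pair α q := by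
  simp [pair, Finset.sum_neg_distrib]

theorem pair_add {α β γ : Weight ℂ H 𝔤} (h : (γ : H → ℂ) = α + β) (q : ι → ℂ) :
    B.pair γ q = B.pair α q + B.pair β q := by
  simp only [pair, h, Pi.add_apply, add_mul, Finset.sum_add_distrib]

/-- `∑ c_μ h_μ`. -/
def cartan (c : ι → ℂ) : 𝔤 := ∑ μ, c μ • (B.h μ : 𝔤)

theorem lie_h_e {α : Weight ℂ H 𝔤} (hα : α ∈ H.root) (μ : ι) :
    ⁅(B.h μ : 𝔤), B.e α⁆ = α (B.h μ) • B.e α :=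
  LieAlgebra.IsKilling.lie_eq_smul_of_mem_rootSpace (B.e_mem α hα) (B.h μ)

theorem lie_cartan_e {α : Weight ℂ H 𝔤} (hα : α ∈ H.root) (c : ι → ℂ) :
    ⁅B.cartan c, B.e α⁆ = B.pair α c • B.e α := by
  simp only [cartan, pair, sum_lie, smul_lie, B.lie_h_e hα, Finset.sum_smul, smul_smul, mul_comm]

theorem lie_cartan_cartan (c d : ι → ℂ) : ⁅B.cartan c, B.cartan d⁆ = 0 := by
  have h : ∀ μ ν, ⁅(B.h μ : 𝔤), (B.h ν : 𝔤)⁆ = 0 := fun μ ν => by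
    rw [← LieSubalgebra.coe_bracket, trivial_lie_zero]
    rfl
  simp only [cartan, sum_lie, lie_sum, smul_lie, lie_smul, h, smul_zero, Finset.sum_const_zero]

/-- A root does not vanish on all the `h_μ`. -/
theorem exists_apply_h_ne_zero {α : Weight ℂ H 𝔤} (hα : α ∈ H.root) : ∃ μ, α (B.h μ) ≠ 0 := by
  by_contra! h
  refine mem_root_iff.1 hα ?_
  have h1 : Weight.toLinear ℂ H 𝔤 α = 0 := B.h.ext fun μ => by simpa using h μ
  ext x
  exact LinearMap.congr_fun h1 x

/-- Pairing `[e_α, e_{-α}] = h_α` with some `h_ν` such that `α(h_ν) ≠ 0`, invariance of the form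
gives `α(h_ν) κ(e_α, e_{-α}) = α(h_ν)`. -/
theorem killingForm_e_neg {α : Weight ℂ H 𝔤} (hα : α ∈ H.root) :
    killingForm ℂ 𝔤 (B.e α) (B.e (-α)) = 1 := by
  obtain ⟨ν, hν⟩ := B.exists_apply_h_ne_zero hα
  have h1 := LieModule.traceForm_apply_lie_apply ℂ 𝔤 𝔤 (B.h ν : 𝔤) (B.e α) (B.e (-α))
  rw [B.lie_e_neg α hα, B.lie_h_e hα] at h1
  have h2 : killingForm ℂ 𝔤 (B.h ν : 𝔤) (∑ μ, α (B.h μ) • (B.h μ : 𝔤)) = α (B.h ν) := by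
    simp [B.killing_h]
  have h3 : killingForm ℂ 𝔤 (α (B.h ν) • B.e α) (B.e (-α)) = α (B.h ν) := h1.trans h2
  rw [map_smul, LinearMap.smul_apply, smul_eq_mul] at h3
  exact mul_left_cancel₀ hν (h3.trans (mul_one _).symm)

theorem e_ne_zero {α : Weight ℂ H 𝔤} (hα : α ∈ H.root) : B.e α ≠ 0 := by
  intro h
  have := B.killingForm_e_neg hα
  simp [h] at this

theorem N_antisymm {α β γ : Weight ℂ H 𝔤} (hα : α ∈ H.root) (hβ : β ∈ H.root) (hγ : γ ∈ H.root)
    (h : (γ : H → ℂ) = α + β) : B.N β α = -B.N α β := by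
  have h1 := B.lie_e α hα β hβ γ hγ h
  have h2 := B.lie_e β hβ α hα γ hγ (by rw [h, add_comm])
  rw [← lie_skew, h1, ← neg_smul] at h2
  exact (smul_left_injective ℂ (B.e_ne_zero hγ) h2).symm

/-- The cyclic symmetry of the structure constants. -/
theorem N_neg_eq {α β γ : Weight ℂ H 𝔤} (hα : α ∈ H.root) (hβ : β ∈ H.root) (hγ : γ ∈ H.root)
    (h : (γ : H → ℂ) = α + β) : B.N (-γ) β = -B.N α β := by
  have h1 := B.lie_e (-γ) (neg_mem_root hγ) β hβ (-α) (neg_mem_root hα) (by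
    rw [Weight.coe_neg, Weight.coe_neg, h]; abel)
  have h2 := B.lie_e β hβ α hα γ hγ (by rw [h, add_comm])
  -- Invariance of the Killing form on `e_{-γ}, e_β, e_α`; both remaining pairings equal `1`.
  have h3 := LieModule.traceForm_apply_lie_apply ℂ 𝔤 𝔤 (B.e (-γ)) (B.e β) (B.e α)
  rw [h1, h2, map_smul, map_smul, LinearMap.smul_apply] at h3
  have h4 := B.killingForm_e_neg (neg_mem_root hα)
  have h5 := B.killingForm_e_neg (neg_mem_root hγ)
  rw [neg_neg] at h4 h5
  have h6 : B.N (-γ) β * killingForm ℂ 𝔤 (B.e (-α)) (B.e α) =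
    B.N β α * killingForm ℂ 𝔤 (B.e (-γ)) (B.e γ) := h3
  rw [h4, h5, mul_one, mul_one] at h6
  rw [h6, B.N_antisymm hα hβ hγ h]

/-- The bracket of two root vectors. -/
theorem lie_e_e {α β : Weight ℂ H 𝔤} (hα : α ∈ H.root) (hβ : β ∈ H.root) (hne : β ≠ -α)
    (hnot : ∀ γ ∈ H.root, (γ : H → ℂ) ≠ α + β) : ⁅B.e α, B.e β⁆ = 0 := by
  have h1 : ⁅B.e α, B.e β⁆ ∈ rootSpace H ((α : H → ℂ) + β) :=
    lie_mem_genWeightSpace_of_mem_genWeightSpace (B.e_mem α hα) (B.e_mem β hβ)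
  by_contra h0
  have hbot : rootSpace H ((α : H → ℂ) + β) ≠ ⊥ := by
    intro hb
    rw [hb] at h1
    exact h0 (by simpa using h1)
  -- A nonzero bracket makes `α + β` a weight. It is not a root by assumption, so it is zero, which
  -- forces `β = -α`.
  let γ : Weight ℂ H 𝔤 := ⟨(α : H → ℂ) + β, hbot⟩
  refine hnot γ (mem_root_iff.2 fun hz => hne ?_) rfl
  have hz' : (α : H → ℂ) + β = 0 := hz
  refine Weight.ext fun x => ?_
  have := congrFun hz' x
  rw [Weight.coe_neg, Pi.neg_apply, eq_neg_iff_add_eq_zero, add_comm]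
  exact this

open Classical in
/-- The roots equal to `α + β`: a set with at most one element. -/
def sumRoots (α β : Weight ℂ H 𝔤) : Finset (Weight ℂ H 𝔤) :=
  H.root.filter fun δ : Weight ℂ H 𝔤 => (δ : H → ℂ) = α + β

omit [LieAlgebra.IsSimple ℂ 𝔤] in
theorem mem_sumRoots {α β γ : Weight ℂ H 𝔤} :
    γ ∈ sumRoots α β ↔ γ ∈ H.root ∧ (γ : H → ℂ) = α + β := by
  classical
  simp [sumRoots]

omit [LieAlgebra.IsSimple ℂ 𝔤] in
theorem sum_sumRoots_eq {G : Type*} [AddCommMonoid G] {α β γ : Weight ℂ H 𝔤} (hγ : γ ∈ H.root)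
    (h : (γ : H → ℂ) = α + β) (f : Weight ℂ H 𝔤 → G) : ∑ δ ∈ sumRoots α β, f δ = f γ := by
  have h1 : sumRoots α β = {γ} := by
    ext δ
    rw [mem_sumRoots, Finset.mem_singleton, ← h]
    exact ⟨fun h' => DFunLike.coe_injective h'.2, fun h' => by rw [h']; exact ⟨hγ, rfl⟩⟩
  rw [h1, Finset.sum_singleton]

end RootBasis

end RootBases

/-! ## Equations of motion -/

section UpdateDerivatives

theorem hasDerivAt_update_apply {κ : Type*} [DecidableEq κ] (f : κ → ℂ) (i j : κ)
    (s : ℂ) : HasDerivAt (fun t => Function.update f i t j) (if j = i then 1 else 0) s := by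
  by_cases h : j = i
  · subst h
    simpa using hasDerivAt_id' s
  · simpa [h] using hasDerivAt_const s (f j)

end UpdateDerivatives

/-! ### Derivatives of the Hamiltonian and brackets with it -/

section RootBases

variable {𝔤 : Type*} [LieRing 𝔤] [LieAlgebra ℂ 𝔤] [FiniteDimensional ℂ 𝔤]
  [LieAlgebra.IsSimple ℂ 𝔤] {H : LieSubalgebra ℂ 𝔤} [H.IsCartanSubalgebra]
  {ι : Type*} [Fintype ι] [DecidableEq ι] (B : RootBasis H ι)

namespace RootBasis

theorem dp_hamiltonian (τ : ℂ) (μ : ι) (x : SpinPoint ι (Weight ℂ H 𝔤)) :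
    SpinPoint.dp (B.hamiltonian τ) μ x = x.p μ := by
  classical
  have h := ((HasDerivAt.fun_sum (u := Finset.univ) fun ν _ =>
    (hasDerivAt_update_apply x.p μ ν (x.p μ)).fun_pow 2).const_mul (1 / 2 : ℂ)).sub_const
      (1 / 2 * ∑ α ∈ H.root, wpFun τ (B.pair α x.q) * x.F (-α) * x.F α)
  refine Eq.trans ?_ (h.deriv.trans ?_)
  · simp only [SpinPoint.dp, hamiltonian]
    congr!
  · simp

theorem dG_hamiltonian (τ : ℂ) (μ : ι) (x : SpinPoint ι (Weight ℂ H 𝔤)) :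
    SpinPoint.dG (B.hamiltonian τ) μ x = 0 := by
  simp only [SpinPoint.dG, hamiltonian]
  exact deriv_const _ _

theorem hasDerivAt_pair_update (α : Weight ℂ H 𝔤) (q : ι → ℂ) (μ : ι) (s : ℂ) :
    HasDerivAt (fun t => B.pair α (Function.update q μ t)) (α (B.h μ)) s := by
  have h := HasDerivAt.fun_sum (u := Finset.univ) fun ν _ =>
    (hasDerivAt_update_apply q μ ν s).const_mul (α (B.h ν))
  refine h.congr_deriv ?_
  simp

theorem dq_hamiltonian {τ : ℂ} (hτ : 0 < τ.im) (μ : ι) (x : SpinPoint ι (Weight ℂ H 𝔤))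
    (hx : ∀ α ∈ H.root, B.pair α x.q ∉ periodLattice τ) :
    -SpinPoint.dq (B.hamiltonian τ) μ x = 1 / 2 * ∑ α ∈ H.root, α (B.h μ) *
      deriv (wpFun τ) (B.pair α x.q) * x.F (-α) * x.F α := by
  have h1 : ∀ α ∈ H.root, HasDerivAt
      (fun s => wpFun τ (B.pair α (Function.update x.q μ s)) * x.F (-α) * x.F α)
      (α (B.h μ) * deriv (wpFun τ) (B.pair α x.q) * x.F (-α) * x.F α) (x.q μ) := by
    intro α hα
    have h2 : HasDerivAt (wpFun τ) (deriv (wpFun τ) (B.pair α x.q))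
        (B.pair α (Function.update x.q μ (x.q μ))) := by
      rw [Function.update_eq_self]
      exact (differentiableAt_wpFun hτ (hx α hα)).hasDerivAt
    refine (((h2.comp (x.q μ) (B.hasDerivAt_pair_update α x.q μ (x.q μ))).mul_const
      (x.F (-α))).mul_const (x.F α)).congr_deriv ?_
    ring
  have h := ((HasDerivAt.fun_sum h1).const_mul (1 / 2 : ℂ)).const_sub (1 / 2 * ∑ μ, x.p μ ^ 2)
  rw [neg_eq_iff_eq_neg]
  refine Eq.trans ?_ h.deriv
  simp only [SpinPoint.dq, hamiltonian]
  congr!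

/-- The coordinate `F_β` occurs in the summands `α = β` and `α = -β`, which contribute equally
because `℘` is even; this absorbs the factor `1/2`. -/
theorem dF_hamiltonian {τ : ℂ} (hτ : 0 < τ.im) {β : Weight ℂ H 𝔤} (hβ : β ∈ H.root)
    (x : SpinPoint ι (Weight ℂ H 𝔤)) :
    SpinPoint.dF (B.hamiltonian τ) β x = -(wpFun τ (B.pair β x.q) * x.F (-β)) := by
  classical
  have h1 : ∀ α ∈ H.root, HasDerivAt
      (fun s => wpFun τ (B.pair α x.q) * Function.update x.F β s (-α) * Function.update x.F β s α)
      (wpFun τ (B.pair α x.q) * (if -α = β then 1 else 0) * x.F α +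
        wpFun τ (B.pair α x.q) * x.F (-α) * (if α = β then 1 else 0)) (x.F β) := by
    intro α _
    refine (((hasDerivAt_update_apply x.F β (-α) (x.F β)).const_mul
      (wpFun τ (B.pair α x.q))).fun_mul (hasDerivAt_update_apply x.F β α (x.F β))).congr_deriv ?_
    simp only [Function.update_eq_self]
  have h := ((HasDerivAt.fun_sum h1).const_mul (1 / 2 : ℂ)).const_sub (1 / 2 * ∑ μ, x.p μ ^ 2)
  refine Eq.trans ?_ (h.deriv.trans ?_)
  · simp only [SpinPoint.dF, hamiltonian]
  · simp only [Finset.sum_add_distrib, mul_ite, mul_one, mul_zero, ite_mul, zero_mul,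
      neg_eq_iff_eq_neg]
    rw [Finset.sum_ite_eq_of_mem' _ _ _ (neg_mem_root hβ), Finset.sum_ite_eq_of_mem' _ _ _ hβ,
      pair_neg, wpFun_neg hτ]
    ring

/-- Reindexing a sum over the roots by `α ↦ -α`. -/
theorem sum_root_neg {G : Type*} [AddCommMonoid G] (f : Weight ℂ H 𝔤 → G) :
    ∑ α ∈ H.root, f (-α) = ∑ α ∈ H.root, f α :=
  Finset.sum_nbij' (fun α => -α) (fun α => -α) (fun _ => neg_mem_root) (fun _ => neg_mem_root)
    (fun _ _ => neg_neg _) (fun _ _ => neg_neg _) fun _ _ => rfl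

/-- On the constraint surface the Cartan term of the bracket vanishes. The substitution `β ↦ -β`
turns the remaining sum into the stated form. -/
theorem bracketF_hamiltonian {τ : ℂ} (hτ : 0 < τ.im) (α : Weight ℂ H 𝔤)
    (x : SpinPoint ι (Weight ℂ H 𝔤)) (hG : ∀ μ, x.G μ = 0) :
    B.bracketF α (B.hamiltonian τ) x = -∑ β ∈ H.root, ∑ γ ∈ sumRoots α (-β),
      wpFun τ (B.pair β x.q) * x.F γ * x.F β * B.N α (-β) := by
  classical
  simp only [bracketF, B.dG_hamiltonian, mul_zero, Finset.sum_const_zero, sub_zero]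
  rw [← sum_root_neg, ← Finset.sum_neg_distrib]
  refine Finset.sum_congr rfl fun β hβ => ?_
  rw [B.dF_hamiltonian hτ (neg_mem_root hβ), neg_neg, pair_neg, wpFun_neg hτ]
  simp only [bracketFF]
  split_ifs with h
  · rw [Finset.sum_eq_zero (s := sumRoots α (-β))]
    · simp [hG]
    · intro γ hγ
      rw [mem_sumRoots, mem_root_iff, h, Weight.coe_neg, add_neg_cancel] at hγ
      exact absurd hγ.2 hγ.1
  · rw [Finset.sum_mul, ← Finset.sum_neg_distrib]
    refine Finset.sum_congr ?_ fun γ _ => by ring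
    ext γ
    simp [sumRoots]

theorem IsSolution.equationsOfMotion {B : RootBasis H ι} {U : Set ℂ}
    {x : ℂ → SpinPoint ι (Weight ℂ H 𝔤)} (hx : B.IsSolution U x) (hU : ∀ τ ∈ U, 0 < τ.im) :
    B.EquationsOfMotion U x where
  deriv_q τ hτ μ := B.dp_hamiltonian τ μ (x τ) ▸ hx.deriv_q τ hτ μ
  deriv_p τ hτ μ := by
    rw [← B.dq_hamiltonian (hU τ hτ) μ (x τ) (hx.regular τ hτ)]
    exact hx.deriv_p τ hτ μ
  deriv_F τ hτ α hα := by
    have h := hx.deriv_F τ hτ α hα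
    rw [B.bracketF_hamiltonian (hU τ hτ) α (x τ) (hx.constraint τ hτ)] at h
    convert! h using 6

end RootBasis

end RootBases

/-! ## The Lax equation for root bases -/

section RootBases

variable {𝔤 : Type*} [LieRing 𝔤] [LieAlgebra ℂ 𝔤] [FiniteDimensional ℂ 𝔤]
  [LieAlgebra.IsSimple ℂ 𝔤] {H : LieSubalgebra ℂ 𝔤} [H.IsCartanSubalgebra]
  {ι : Type*} [Fintype ι] [DecidableEq ι] (B : RootBasis H ι)

namespace RootBasis

omit [LieAlgebra.IsSimple ℂ 𝔤] in
theorem sumRoots_comm (α β : Weight ℂ H 𝔤) : sumRoots α β = sumRoots β α := by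
  ext γ
  rw [mem_sumRoots, mem_sumRoots, add_comm]

/-- Summation over all triples of roots with `δ = α + β`. -/
theorem sum_sumRoots_comm {G : Type*} [AddCommMonoid G]
    (f : Weight ℂ H 𝔤 → Weight ℂ H 𝔤 → Weight ℂ H 𝔤 → G) :
    ∑ α ∈ H.root, ∑ β ∈ H.root, ∑ δ ∈ sumRoots α β, f α β δ =
      ∑ δ ∈ H.root, ∑ β ∈ H.root, ∑ γ ∈ sumRoots (-δ) β, f (-γ) β δ := by
  classical
  -- Both sides become sums over triples of roots weighted by the indicator of `δ = α + β`, here via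
  -- `γ = -α`.
  have h1 : ∀ δ β : Weight ℂ H 𝔤, ∑ γ ∈ sumRoots (-δ) β, f (-γ) β δ =
      ∑ α ∈ H.root, if (δ : H → ℂ) = α + β then f α β δ else 0 := by
    intro δ β
    rw [sumRoots, Finset.sum_filter, ← sum_root_neg]
    refine Finset.sum_congr rfl fun γ _ => ?_
    rw [neg_neg, Weight.coe_neg, Weight.coe_neg]
    congr 1
    rw [neg_eq_iff_eq_neg, neg_add, neg_neg, ← sub_eq_add_neg, eq_sub_iff_add_eq]
    exact propext eq_comm
  have h2 : ∀ α β : Weight ℂ H 𝔤, ∑ δ ∈ sumRoots α β, f α β δ =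
      ∑ δ ∈ H.root, if (δ : H → ℂ) = α + β then f α β δ else 0 := by
    intro α β
    rw [sumRoots, Finset.sum_filter]
  simp only [h1, h2]
  calc _ = ∑ α ∈ H.root, ∑ δ ∈ H.root, ∑ β ∈ H.root,
        (if (δ : H → ℂ) = α + β then f α β δ else 0) :=
        Finset.sum_congr rfl fun α _ => Finset.sum_comm
    _ = ∑ δ ∈ H.root, ∑ α ∈ H.root, ∑ β ∈ H.root,
        (if (δ : H → ℂ) = α + β then f α β δ else 0) := Finset.sum_comm
    _ = _ := Finset.sum_congr rfl fun δ _ => Finset.sum_comm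

/-- The antisymmetrized structure of brackets of root vectors. -/
theorem smul_lie_e_e {s d w w' : Weight ℂ H 𝔤 → ℂ}
    (hneg : ∀ α ∈ H.root, s α * d (-α) - s (-α) * d α = w' α)
    (hadd : ∀ α ∈ H.root, ∀ β ∈ H.root, ∀ γ ∈ H.root, (γ : H → ℂ) = α + β →
      s α * d β - s β * d α = s γ * (w β - w α))
    {α β : Weight ℂ H 𝔤} (hα : α ∈ H.root) (hβ : β ∈ H.root) (c : ℂ) [Decidable (β = -α)] :
    ((s α * d β - s β * d α) * c) • ⁅B.e α, B.e β⁆ =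
      (if β = -α then (w' α * c) • B.cartan (fun μ => α (B.h μ)) else 0) +
        ∑ γ ∈ sumRoots α β, (s γ * (w β - w α) * c * B.N α β) • B.e γ := by
  by_cases h : β = -α
  · rw [if_pos h, Finset.sum_eq_zero, add_zero, h, hneg α hα, B.lie_e_neg α hα]
    · rfl
    · intro γ hγ
      rw [mem_sumRoots, mem_root_iff, h, Weight.coe_neg, add_neg_cancel] at hγ
      exact absurd hγ.2 hγ.1
  · rw [if_neg h, zero_add]
    by_cases hex : ∃ γ ∈ H.root, (γ : H → ℂ) = α + β
    · obtain ⟨γ, hγ, hsum⟩ := hex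
      rw [sum_sumRoots_eq hγ hsum, B.lie_e α hα β hβ γ hγ hsum, smul_smul,
        hadd α hα β hβ γ hγ hsum]
    · push Not at hex
      rw [B.lie_e_e hα hβ h hex, smul_zero, Finset.sum_eq_zero]
      intro γ hγ
      rw [mem_sumRoots] at hγ
      exact absurd hγ.2 (hex γ hγ.1)

theorem cartan_sum_smul {κ : Type*} (t : Finset κ) (a : κ → ℂ) (c : κ → ι → ℂ) :
    B.cartan (fun μ => ∑ k ∈ t, a k * c k μ) = ∑ k ∈ t, a k • B.cartan (c k) := by
  simp only [cartan, Finset.sum_smul, Finset.smul_sum, smul_smul]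
  exact Finset.sum_comm

/-- The commutator in the Lax equation. -/
theorem lie_lax {s d w w' F : Weight ℂ H 𝔤 → ℂ} (p : ι → ℂ)
    (hneg : ∀ α ∈ H.root, s α * d (-α) - s (-α) * d α = w' α)
    (hadd : ∀ α ∈ H.root, ∀ β ∈ H.root, ∀ γ ∈ H.root, (γ : H → ℂ) = α + β →
      s α * d β - s β * d α = s γ * (w β - w α))
    (hw : ∀ α ∈ H.root, w (-α) = w α) :
    ⁅B.cartan p + ∑ α ∈ H.root, (s α * F (-α)) • B.e α, ∑ α ∈ H.root, (d α * F (-α)) • B.e α⁆ =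
      B.cartan (fun μ => 1 / 2 * ∑ α ∈ H.root, α (B.h μ) * w' α * F (-α) * F α) +
      ∑ α ∈ H.root, (B.pair α p * d α * F (-α) +
        s α * -∑ β ∈ H.root, ∑ γ ∈ sumRoots (-α) (-β), w β * F γ * F β * B.N (-α) (-β)) • B.e α := by
  classical
  rw [add_lie]
  have h1 : ⁅B.cartan p, ∑ α ∈ H.root, (d α * F (-α)) • B.e α⁆ =
      ∑ α ∈ H.root, (B.pair α p * d α * F (-α)) • B.e α := by
    rw [lie_sum]
    refine Finset.sum_congr rfl fun α hα => ?_
    rw [lie_smul, B.lie_cartan_e hα, smul_smul]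
    congr 1
    ring
  set X := ⁅∑ α ∈ H.root, (s α * F (-α)) • B.e α, ∑ α ∈ H.root, (d α * F (-α)) • B.e α⁆ with hX
  set Z := ∑ α ∈ H.root, ∑ β ∈ H.root, ∑ γ ∈ sumRoots α β,
    (s γ * w β * (F (-α) * F (-β)) * B.N α β) • B.e γ with hZ
  have hX1 : X = ∑ α ∈ H.root, ∑ β ∈ H.root,
      (s α * d β * (F (-α) * F (-β))) • ⁅B.e α, B.e β⁆ := by
    rw [hX, sum_lie]
    refine Finset.sum_congr rfl fun α _ => ?_
    rw [lie_sum]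
    refine Finset.sum_congr rfl fun β _ => ?_
    rw [smul_lie, lie_smul, smul_smul]
    congr 1
    ring
  -- The double sum with `α` and `β` exchanged. Adding the two expressions antisymmetrizes the
  -- coefficients, so that `hneg` and `hadd` apply to `2X`.
  have hX2 : X = -∑ α ∈ H.root, ∑ β ∈ H.root,
      (s β * d α * (F (-α) * F (-β))) • ⁅B.e α, B.e β⁆ := by
    rw [hX1, Finset.sum_comm, ← Finset.sum_neg_distrib]
    refine Finset.sum_congr rfl fun α _ => ?_
    rw [← Finset.sum_neg_distrib]
    refine Finset.sum_congr rfl fun β _ => ?_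
    rw [← lie_skew, smul_neg, mul_comm (F (-β))]
  have hXX : X + X = ∑ α ∈ H.root, ∑ β ∈ H.root,
      ((s α * d β - s β * d α) * (F (-α) * F (-β))) • ⁅B.e α, B.e β⁆ := by
    nth_rewrite 1 [hX1]
    rw [hX2, ← sub_eq_add_neg, ← Finset.sum_sub_distrib]
    refine Finset.sum_congr rfl fun α _ => ?_
    rw [← Finset.sum_sub_distrib]
    refine Finset.sum_congr rfl fun β _ => ?_
    rw [← sub_smul]
    congr 1
    ring
  have hXX2 : X + X = ∑ α ∈ H.root, (w' α * (F (-α) * F α)) • B.cartan (fun μ => α (B.h μ)) +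
      ∑ α ∈ H.root, ∑ β ∈ H.root, ∑ γ ∈ sumRoots α β,
        (s γ * (w β - w α) * (F (-α) * F (-β)) * B.N α β) • B.e γ := by
    rw [hXX, ← Finset.sum_add_distrib]
    refine Finset.sum_congr rfl fun α hα => ?_
    rw [Finset.sum_congr rfl fun β hβ => B.smul_lie_e_e hneg hadd hα hβ _,
      Finset.sum_add_distrib, Finset.sum_ite_eq_of_mem' _ _ _ (neg_mem_root hα), neg_neg]
  -- The terms with `w α` equal those with `w β` after exchanging the roots, by antisymmetry of `N`.
  have hY : ∑ α ∈ H.root, ∑ β ∈ H.root, ∑ γ ∈ sumRoots α β,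
      (s γ * (w β - w α) * (F (-α) * F (-β)) * B.N α β) • B.e γ = Z + Z := by
    have h2 : Z = -∑ α ∈ H.root, ∑ β ∈ H.root, ∑ γ ∈ sumRoots α β,
        (s γ * w α * (F (-α) * F (-β)) * B.N α β) • B.e γ := by
      rw [hZ, Finset.sum_comm, ← Finset.sum_neg_distrib]
      refine Finset.sum_congr rfl fun α hα => ?_
      rw [← Finset.sum_neg_distrib]
      refine Finset.sum_congr rfl fun β hβ => ?_
      rw [← Finset.sum_neg_distrib, sumRoots_comm]
      refine Finset.sum_congr rfl fun γ hγ => ?_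
      rw [mem_sumRoots] at hγ
      rw [B.N_antisymm hα hβ hγ.1 hγ.2, ← neg_smul]
      congr 1
      ring
    nth_rewrite 2 [h2]
    rw [hZ, ← sub_eq_add_neg, ← Finset.sum_sub_distrib]
    refine Finset.sum_congr rfl fun α _ => ?_
    rw [← Finset.sum_sub_distrib]
    refine Finset.sum_congr rfl fun β _ => ?_
    rw [← Finset.sum_sub_distrib]
    refine Finset.sum_congr rfl fun γ _ => ?_
    rw [← sub_smul]
    congr 1
    ring
  -- Reorganization by the resulting root; the cyclic symmetry of `N` produces the structure
  -- constants of the equation for `F_{-α}`.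
  have hZ2 : Z = ∑ α ∈ H.root, (s α * -∑ β ∈ H.root, ∑ γ ∈ sumRoots (-α) (-β),
      w β * F γ * F β * B.N (-α) (-β)) • B.e α := by
    rw [hZ, sum_sumRoots_comm]
    refine Finset.sum_congr rfl fun δ hδ => ?_
    rw [← sum_root_neg, ← Finset.sum_neg_distrib, Finset.mul_sum, Finset.sum_smul]
    refine Finset.sum_congr rfl fun β hβ => ?_
    rw [← Finset.sum_neg_distrib, Finset.mul_sum, Finset.sum_smul]
    refine Finset.sum_congr rfl fun γ hγ => ?_
    rw [mem_sumRoots] at hγ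
    have h3 := B.N_neg_eq (neg_mem_root hγ.1) (neg_mem_root hβ) hδ (by
      rw [Weight.coe_neg, hγ.2, Weight.coe_neg]; abel)
    rw [h3, hw β hβ, neg_neg, neg_neg]
    congr 1
    ring
  have hC : ∑ α ∈ H.root, (w' α * (F (-α) * F α)) • B.cartan (fun μ => α (B.h μ)) =
      B.cartan (fun μ => 1 / 2 * ∑ α ∈ H.root, α (B.h μ) * w' α * F (-α) * F α) +
      B.cartan (fun μ => 1 / 2 * ∑ α ∈ H.root, α (B.h μ) * w' α * F (-α) * F α) := by
    rw [← cartan_sum_smul]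
    simp only [cartan, ← Finset.sum_add_distrib, ← add_smul]
    refine Finset.sum_congr rfl fun μ _ => ?_
    congr 1
    rw [← add_mul, add_halves, one_mul]
    exact Finset.sum_congr rfl fun α _ => by ring
  rw [hY, hC] at hXX2
  have h2 : (2 : ℂ) • X = (2 : ℂ) • (B.cartan (fun μ => 1 / 2 * ∑ α ∈ H.root,
      α (B.h μ) * w' α * F (-α) * F α) + Z) := by
    rw [two_smul, two_smul, hXX2]
    abel
  rw [h1, smul_right_injective 𝔤 (two_ne_zero' ℂ) h2, hZ2]
  simp only [add_smul, Finset.sum_add_distrib]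
  abel

end RootBasis

end RootBases

/-! ## The Lax pair of a root basis -/

/-- `σ(u, ·)` has at most a simple pole at the origin. -/
theorem exists_analyticAt_sigmaFun_eq_inv_mul {τ u : ℂ} (hτ : 0 < τ.im)
    (hu : u ∉ periodLattice τ) : ∃ R : ℂ → ℂ, AnalyticAt ℂ R 0 ∧
      ∀ᶠ z in 𝓝[≠] (0 : ℂ), sigmaFun τ u z = z⁻¹ * R z := by
  obtain ⟨A, hA, -, hA2⟩ := exists_regular_part_sigmaFun hτ hu
  have hc : AnalyticAt ℂ (fun z : ℂ => (τ, u, z)) 0 :=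
    analyticAt_const.prod (analyticAt_const.prod analyticAt_id)
  refine ⟨fun z => A (τ, u, z), AnalyticAt.fun_comp (f := fun z : ℂ => (τ, u, z)) hA hc, ?_⟩
  filter_upwards [(hc.continuousAt.eventually hA2).filter_mono nhdsWithin_le_nhds,
    self_mem_nhdsWithin] with z hz hz0
  rw [hz hz0, div_eq_inv_mul]

theorem analyticAt_of_twoPiIDeriv {F : Type*} [NormedAddCommGroup F] [NormedSpace ℂ F]
    [CompleteSpace F] {U : Set ℂ} (hU : IsOpen U) {f v : ℂ → F}
    (h : ∀ τ ∈ U, TwoPiIDeriv f (v τ) τ) {τ : ℂ} (hτ : τ ∈ U) : AnalyticAt ℂ f τ :=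
  analyticAt_iff_eventually_differentiableAt.2
    (eventually_of_mem (hU.mem_nhds hτ) fun t ht => (h t ht).differentiableAt)

theorem AnalyticAt.smul_const {X F : Type*} [NormedAddCommGroup X] [NormedSpace ℂ X]
    [NormedAddCommGroup F] [NormedSpace ℂ F] {f : X → ℂ} {x : X} (hf : AnalyticAt ℂ f x) (v : F) :
    AnalyticAt ℂ (fun y => f y • v) x := hf.smul analyticAt_const

theorem AnalyticAt.comp_fst' {F : Type*} [NormedAddCommGroup F] [NormedSpace ℂ F] {f : ℂ → F}
    {τ z : ℂ} (hf : AnalyticAt ℂ f τ) : AnalyticAt ℂ (fun y : ℂ × ℂ => f y.1) (τ, z) :=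
  AnalyticAt.fun_comp (f := fun y : ℂ × ℂ => y.1) hf analyticAt_fst

section RootBases

variable {𝔤 : Type*} [LieRing 𝔤] [LieAlgebra ℂ 𝔤] [FiniteDimensional ℂ 𝔤]
  [LieAlgebra.IsSimple ℂ 𝔤] {H : LieSubalgebra ℂ 𝔤} [H.IsCartanSubalgebra]
  {ι : Type*} [Fintype ι] [DecidableEq ι] {B : RootBasis H ι}
  (V : Type*) [NormedAddCommGroup V] [NormedSpace ℂ V] [FiniteDimensional ℂ V]
  [LieRingModule 𝔤 V] [LieModule ℂ 𝔤 V]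

namespace RootBasis

/-- The representation as a linear map. -/
def repHom : 𝔤 →ₗ[ℂ] V →L[ℂ] V :=
  (LinearMap.toContinuousLinearMap (𝕜 := ℂ) (E := V) (F' := V)).toLinearMap ∘ₗ
    (LieModule.toEnd ℂ 𝔤 V : 𝔤 →ₗ[ℂ] Module.End ℂ V)

omit [FiniteDimensional ℂ 𝔤] [LieAlgebra.IsSimple ℂ 𝔤] in
theorem rep_eq (a : 𝔤) : rep V a = repHom V a := rfl

omit [FiniteDimensional ℂ 𝔤] [LieAlgebra.IsSimple ℂ 𝔤] in
theorem repHom_lie (a b : 𝔤) :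
    repHom V ⁅a, b⁆ = repHom V a * repHom V b - repHom V b * repHom V a := by
  ext v
  exact lie_lie a b v

variable (B) in
theorem cartanOp_eq (c : ι → ℂ) : B.cartanOp V c = repHom V (B.cartan c) := by
  simp only [cartanOp, cartan, map_sum, map_smul, rep_eq]

variable (B) in
theorem commute_cartanOp (c d : ι → ℂ) : Commute (B.cartanOp V c) (B.cartanOp V d) := by
  rw [cartanOp_eq, cartanOp_eq, Commute, SemiconjBy, ← sub_eq_zero, ← repHom_lie,
    lie_cartan_cartan, map_zero]

variable {U : Set ℂ} {x : ℂ → SpinPoint ι (Weight ℂ H 𝔤)}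

theorem laxL_eq (τ z : ℂ) : B.laxL V x τ z = repHom V (B.cartan (x τ).p +
    ∑ α ∈ H.root, (sigmaFun τ (B.pair α (x τ).q) z * (x τ).F (-α)) • B.e α) := by
  simp only [laxL, cartanOp_eq, map_add, map_sum, map_smul, rep_eq]

theorem laxM_eq (τ z : ℂ) : B.laxM V x τ z = repHom V
    (∑ α ∈ H.root, (dSigmaFun τ (B.pair α (x τ).q) z * (x τ).F (-α)) • B.e α) := by
  simp only [laxM, map_sum, map_smul, rep_eq]

theorem IsSolution.laxMFormula (hx : B.IsSolution U x) (hU : ∀ τ ∈ U, 0 < τ.im) :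
    B.LaxMFormula V U x := by
  intro τ hτ z _ hzu
  rw [laxM, ← Finset.sum_neg_distrib]
  refine Finset.sum_congr rfl fun α hα => ?_
  rw [dSigmaFun_eq_rho (hU τ hτ) (hx.regular τ hτ α hα) (hzu α hα), ← neg_smul, neg_mul]

theorem IsSolution.hasDerivAt_pair (hx : B.IsSolution U x) (hU : ∀ τ ∈ U, 0 < τ.im) {τ : ℂ}
    (hτ : τ ∈ U) (α : Weight ℂ H 𝔤) : HasDerivAt (fun t => B.pair α (x t).q)
      ((2 * Real.pi * I : ℂ)⁻¹ * B.pair α (x τ).p) τ := by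
  have h := HasDerivAt.fun_sum (u := Finset.univ) fun μ _ =>
    ((hx.equationsOfMotion hU).deriv_q τ hτ μ).const_mul (α (B.h μ))
  refine h.congr_deriv ?_
  simp only [pair, Finset.mul_sum, smul_eq_mul]
  exact Finset.sum_congr rfl fun μ _ => by ring

/-- By `hasDerivAt_sigmaFun_tau` the explicit `τ`-derivative of `σ` cancels `∂M/∂z`. What remains is
`lie_lax` with `s = σ`, `d = ∂σ/∂u`, `w = ℘`, `w' = ℘'`, whose hypotheses are the identities for
`σ`. -/
theorem IsSolution.laxEquation (hx : B.IsSolution U x) (hU : ∀ τ ∈ U, 0 < τ.im) :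
    LaxEquation U (B.laxL V x) (B.laxM V x) := by
  intro τ hτ z hz
  have hτ0 := hU τ hτ
  have hE := hx.equationsOfMotion hU
  have hreg := hx.regular τ hτ
  have hP : HasDerivAt (fun t => B.cartanOp V (x t).p) (∑ μ, ((2 * Real.pi * I : ℂ)⁻¹ •
      (1 / 2 * ∑ α ∈ H.root, α (B.h μ) * deriv (wpFun τ) (B.pair α (x τ).q) *
        (x τ).F (-α) * (x τ).F α)) • rep V (B.h μ : 𝔤)) τ :=
    HasDerivAt.fun_sum fun μ _ =>
      HasDerivAt.smul_const (F := V →L[ℂ] V) (hE.deriv_p τ hτ μ) (rep V (B.h μ : 𝔤))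
  have hL := hP.fun_add (HasDerivAt.fun_sum (u := H.root) fun α hα =>
    HasDerivAt.smul_const ((hasDerivAt_sigmaFun_tau hτ0 (hreg α hα) hz
      (hx.hasDerivAt_pair hU hτ α)).fun_mul (hE.deriv_F τ hτ (-α) (neg_mem_root hα)))
      (rep V (B.e α)))
  have hM := HasDerivAt.fun_sum (u := H.root) fun α hα =>
    HasDerivAt.smul_const ((differentiableAt_dSigmaFun hτ0 (hreg α hα) hz).hasDerivAt.mul_const
      ((x τ).F (-α))) (rep V (B.e α))
  refine ⟨_, _, hL, hM, ?_⟩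
  rw [laxL_eq, laxM_eq, ← repHom_lie, B.lie_lax (w := fun α => wpFun τ (B.pair α (x τ).q))
    (w' := fun α => deriv (wpFun τ) (B.pair α (x τ).q))
    (s := fun α => sigmaFun τ (B.pair α (x τ).q) z)
    (d := fun α => dSigmaFun τ (B.pair α (x τ).q) z) (F := (x τ).F)]
  · simp only [cartan, map_add, map_sum, map_smul, ← rep_eq, smul_add, Finset.smul_sum]
    rw [add_assoc, ← Finset.sum_add_distrib]
    congr 1
    · refine Finset.sum_congr rfl fun μ _ => ?_
      rw [smul_smul, smul_eq_mul, mul_inv_cancel_left₀ two_pi_I_ne_zero']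
    · refine Finset.sum_congr rfl fun α _ => ?_
      rw [smul_smul, ← add_smul]
      congr 1
      classical
      have hfilter : ∀ β : Weight ℂ H 𝔤, (sumRoots (-α) (-β)) =
          H.root.filter (fun δ : Weight ℂ H 𝔤 => (δ : H → ℂ) = ⇑(-α) - β) := by
        intro β
        ext δ
        simp [sumRoots, sub_eq_add_neg]
      simp only [hfilter, smul_eq_mul]
      have h2 := two_pi_I_ne_zero'
      field_simp
      ring
  · intro α hα
    rw [pair_neg]
    exact sigmaFun_mul_dSigmaFun_neg_sub hτ0 (hreg α hα) hz
  · intro α hα β hβ γ hγ h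
    have h1 := hreg γ hγ
    rw [B.pair_add h] at h1 ⊢
    exact sigmaFun_mul_dSigmaFun_sub hτ0 (hreg α hα) (hreg β hβ) h1 hz
  · intro α _
    rw [pair_neg, wpFun_neg hτ0]

variable (B) in
theorem exp_mul_rep_e_mul_exp_neg {α : Weight ℂ H 𝔤} (hα : α ∈ H.root) (q : ι → ℂ) :
    NormedSpace.exp ((2 * Real.pi * I : ℂ) • B.cartanOp V q) * rep V (B.e α) *
      NormedSpace.exp (-((2 * Real.pi * I : ℂ) • B.cartanOp V q)) =
    Complex.exp (2 * Real.pi * I * B.pair α q) • rep V (B.e α) := by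
  have : CompleteSpace V := FiniteDimensional.complete ℂ V
  set T := (2 * Real.pi * I : ℂ) • B.cartanOp V q with hT
  set c : ℂ := 2 * Real.pi * I * B.pair α q with hc
  have h1 : B.cartanOp V q * rep V (B.e α) =
      rep V (B.e α) * B.cartanOp V q + B.pair α q • rep V (B.e α) := by
    have h2 := repHom_lie V (B.cartan q) (B.e α)
    rw [B.lie_cartan_e hα, map_smul] at h2
    rw [rep_eq, cartanOp_eq, h2]
    abel
  -- `E_α` shifts the eigenvalues of `Q` by `α · q`; exponentiating this intertwining relation gives
  -- the scalar factor.
  have h2 : SemiconjBy (rep V (B.e α)) (T + algebraMap ℂ (V →L[ℂ] V) c) T := by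
    rw [SemiconjBy, hT, smul_mul_assoc, h1, mul_add, mul_smul_comm, smul_add, smul_smul,
      Algebra.algebraMap_eq_smul_one, mul_smul_comm, mul_one, hc]
  have h3 := semiconjBy_exp_right h2
  rw [exp_add_of_commute' (Algebra.commutes c T).symm, ← NormedSpace.algebraMap_exp_comm,
    ← Complex.exp_eq_exp_ℂ] at h3
  rw [← h3.eq, mul_assoc, mul_assoc, Algebra.commutes, ← mul_assoc (NormedSpace.exp T),
    exp_mul_exp_neg, one_mul, Algebra.algebraMap_eq_smul_one, mul_smul_comm, mul_one]

theorem exp_mul_cartanOp_mul_exp_neg (p q : ι → ℂ) :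
    NormedSpace.exp ((2 * Real.pi * I : ℂ) • B.cartanOp V q) * B.cartanOp V p *
      NormedSpace.exp (-((2 * Real.pi * I : ℂ) • B.cartanOp V q)) = B.cartanOp V p := by
  have : CompleteSpace V := FiniteDimensional.complete ℂ V
  have h1 : Commute (B.cartanOp V p)
      (NormedSpace.exp ((2 * Real.pi * I : ℂ) • B.cartanOp V q)) :=
    semiconjBy_exp_right ((B.commute_cartanOp V p q).smul_right _)
  rw [← h1.eq, mul_assoc, exp_mul_exp_neg, mul_one]

theorem IsSolution.laxQuasiPeriodic (hx : B.IsSolution U x) (hU : ∀ τ ∈ U, 0 < τ.im) :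
    LaxQuasiPeriodic U (B.laxL V x) (B.laxM V x)
      (fun τ => B.cartanOp V (x τ).p) (fun τ => B.cartanOp V (x τ).q) where
  L_one τ _ z _ := by simp only [laxL, sigmaFun_add_one]
  M_one τ _ z _ := by simp only [laxM, dSigmaFun_add_one]
  L_tau τ hτ z _ := by
    simp only [laxL, mul_add, add_mul, exp_mul_cartanOp_mul_exp_neg, Finset.mul_sum,
      Finset.sum_mul, mul_smul_comm, smul_mul_assoc]
    congr 1
    refine Finset.sum_congr rfl fun α hα => ?_
    rw [B.exp_mul_rep_e_mul_exp_neg V hα, smul_smul, sigmaFun_add_tau]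
    congr 1
    ring
  M_tau τ hτ z _ := by
    simp only [laxL, laxM, mul_add, add_mul, smul_add, mul_smul_comm, smul_mul_assoc,
      exp_mul_cartanOp_mul_exp_neg, Finset.mul_sum, Finset.sum_mul, Finset.smul_sum]
    rw [add_left_comm, add_sub_cancel_left, ← Finset.sum_add_distrib]
    refine Finset.sum_congr rfl fun α hα => ?_
    rw [B.exp_mul_rep_e_mul_exp_neg V hα, smul_smul, smul_smul, smul_smul, ← add_smul,
      dSigmaFun_add_tau (hU τ hτ) (hx.regular τ hτ α hα)]
    congr 1
    ring

theorem IsSolution.analyticAt_pair (hx : B.IsSolution U x) (hUo : IsOpen U)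
    (hU : ∀ τ ∈ U, 0 < τ.im) {τ : ℂ} (hτ : τ ∈ U) (α : Weight ℂ H 𝔤) :
    AnalyticAt ℂ (fun t => B.pair α (x t).q) τ :=
  analyticAt_iff_eventually_differentiableAt.2 (eventually_of_mem (hUo.mem_nhds hτ)
    fun _ ht => (hx.hasDerivAt_pair hU ht α).differentiableAt)

theorem IsSolution.analyticAt_laxL (hx : B.IsSolution U x) (hUo : IsOpen U)
    (hU : ∀ τ ∈ U, 0 < τ.im) {τ z : ℂ} (hτ : τ ∈ U) (hz : z ∉ periodLattice τ) :
    AnalyticAt ℂ (fun y : ℂ × ℂ => B.laxL V x y.1 y.2) (τ, z) := by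
  have h1 : ∀ μ, AnalyticAt ℂ (fun y : ℂ × ℂ => (x y.1).p μ) (τ, z) := fun μ =>
    (analyticAt_of_twoPiIDeriv hUo (fun t ht => hx.deriv_p t ht μ) hτ).comp_fst'
  have h2 : ∀ α ∈ H.root, AnalyticAt ℂ (fun y : ℂ × ℂ =>
      sigmaFun y.1 (B.pair α (x y.1).q) y.2 * (x y.1).F (-α)) (τ, z) := fun α hα =>
    (analyticAt_sigmaFun_comp analyticAt_fst (hx.analyticAt_pair hUo hU hτ α).comp_fst'
      analyticAt_snd (hU τ hτ) (hx.regular τ hτ α hα) hz).fun_mul (analyticAt_of_twoPiIDeriv hUo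
        (fun t ht => hx.deriv_F t ht (-α) (neg_mem_root hα)) hτ).comp_fst'
  exact (Finset.analyticAt_fun_sum _ fun μ _ => (h1 μ).smul_const _).fun_add
    (Finset.analyticAt_fun_sum _ fun α hα => (h2 α hα).smul_const _)

theorem IsSolution.analyticAt_laxM (hx : B.IsSolution U x) (hUo : IsOpen U)
    (hU : ∀ τ ∈ U, 0 < τ.im) {τ z : ℂ} (hτ : τ ∈ U) (hz : z ∉ periodLattice τ) :
    AnalyticAt ℂ (fun y : ℂ × ℂ => B.laxM V x y.1 y.2) (τ, z) := by
  have h2 : ∀ α ∈ H.root, AnalyticAt ℂ (fun y : ℂ × ℂ =>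
      dSigmaFun y.1 (B.pair α (x y.1).q) y.2 * (x y.1).F (-α)) (τ, z) := fun α hα =>
    (analyticAt_dSigmaFun_comp analyticAt_fst (hx.analyticAt_pair hUo hU hτ α).comp_fst'
      analyticAt_snd (hU τ hτ) (hx.regular τ hτ α hα) hz).fun_mul (analyticAt_of_twoPiIDeriv hUo
        (fun t ht => hx.deriv_F t ht (-α) (neg_mem_root hα)) hτ).comp_fst'
  exact Finset.analyticAt_fun_sum _ fun α hα => (h2 α hα).smul_const _

theorem IsSolution.deriv_cartanOp (hx : B.IsSolution U x) (hU : ∀ τ ∈ U, 0 < τ.im) {τ : ℂ}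
    (hτ : τ ∈ U) :
    TwoPiIDeriv (fun τ => B.cartanOp V (x τ).q) (B.cartanOp V (x τ).p) τ := by
  have h := HasDerivAt.fun_sum (u := Finset.univ) fun μ _ =>
    HasDerivAt.smul_const (F := V →L[ℂ] V) ((hx.equationsOfMotion hU).deriv_q τ hτ μ)
      (rep V (B.h μ : 𝔤))
  refine h.congr_deriv ?_
  simp only [cartanOp, Finset.smul_sum, smul_assoc]

theorem IsSolution.isLaxPair (hx : B.IsSolution U x) (hUo : IsOpen U) (hU : ∀ τ ∈ U, 0 < τ.im) :
    IsLaxPair U (B.laxL V x) (B.laxM V x)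
      (fun τ => B.cartanOp V (x τ).p) (fun τ => B.cartanOp V (x τ).q) where
  isOpen := hUo
  im_pos := hU
  analyticAt_L _ hτ _ hz := hx.analyticAt_laxL V hUo hU hτ hz
  analyticAt_M _ hτ _ hz := hx.analyticAt_laxM V hUo hU hτ hz
  deriv_Q _ hτ := hx.deriv_cartanOp V hU hτ
  lax := hx.laxEquation V hU
  quasiPeriodic := hx.laxQuasiPeriodic V hU
  commute_Q _ _ := B.commute_cartanOp V _ _
  commute_P _ _ := B.commute_cartanOp V _ _

theorem IsSolution.onlyRegularSingularityAtZero (hx : B.IsSolution U x) (hUo : IsOpen U)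
    (hU : ∀ τ ∈ U, 0 < τ.im) : OnlyRegularSingularityAtZero U (B.laxL V x) := by
  intro τ hτ
  have : CompleteSpace V := FiniteDimensional.complete ℂ V
  refine ⟨fun z hz => AnalyticAt.fun_comp (f := fun z : ℂ => (τ, z))
    (hx.analyticAt_laxL V hUo hU hτ hz) (by fun_prop), ?_⟩
  have hex : ∀ α : Weight ℂ H 𝔤, ∃ R : ℂ → ℂ, α ∈ H.root → AnalyticAt ℂ R 0 ∧
      ∀ᶠ z in 𝓝[≠] (0 : ℂ), sigmaFun τ (B.pair α (x τ).q) z = z⁻¹ * R z := by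
    intro α
    by_cases hα : α ∈ H.root
    · obtain ⟨R, hR⟩ := exists_analyticAt_sigmaFun_eq_inv_mul (hU τ hτ) (hx.regular τ hτ α hα)
      exact ⟨R, fun _ => hR⟩
    · exact ⟨0, fun h => absurd h hα⟩
  choose R hR using hex
  refine ⟨fun z => z • B.cartanOp V (x τ).p +
    ∑ α ∈ H.root, (R α z * (x τ).F (-α)) • rep V (B.e α), ?_, ?_⟩
  · refine (analyticAt_id.fun_smul analyticAt_const).add
      (Finset.analyticAt_fun_sum _ fun α hα => ?_)
    exact ((hR α hα).1.fun_mul analyticAt_const).fun_smul analyticAt_const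
  · filter_upwards [(H.root.eventually_all).2 fun α hα => (hR α hα).2, self_mem_nhdsWithin]
      with z hz hz0
    rw [laxL, smul_add, smul_smul, inv_mul_cancel₀ hz0, one_smul, Finset.smul_sum]
    congr 1
    refine Finset.sum_congr rfl fun α hα => ?_
    rw [hz α hα, smul_smul, mul_assoc]

end RootBasis

end RootBases

/-! ## The spin system of `sl(ℓ)` -/

section MatrixCalculus

variable {l : ℕ}

theorem hasDerivAt_matrix {f : ℂ → Matrix (Fin l) (Fin l) ℂ} {f' : Matrix (Fin l) (Fin l) ℂ}
    {t : ℂ} (h : ∀ j k, HasDerivAt (fun s => f s j k) (f' j k) t) : HasDerivAt f f' t := by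
  have h1 : HasDerivAt (fun s => ∑ j, ∑ k, f s j k • Matrix.single j k (1 : ℂ))
      (∑ j, ∑ k, f' j k • Matrix.single j k (1 : ℂ)) t :=
    HasDerivAt.fun_sum fun j _ => HasDerivAt.fun_sum fun k _ => (h j k).smul_const _
  simpa [Matrix.smul_single, ← Matrix.matrix_eq_sum_single] using h1

theorem analyticAt_matrix {X : Type*} [NormedAddCommGroup X] [NormedSpace ℂ X]
    {f : X → Matrix (Fin l) (Fin l) ℂ} {t : X} (h : ∀ j k, AnalyticAt ℂ (fun s => f s j k) t) :
    AnalyticAt ℂ f t := by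
  have h1 : AnalyticAt ℂ (fun s => ∑ j, ∑ k, f s j k • Matrix.single j k (1 : ℂ)) t :=
    Finset.analyticAt_fun_sum _ fun j _ => Finset.analyticAt_fun_sum _ fun k _ =>
      (h j k).smul_const _
  simpa [Matrix.smul_single, ← Matrix.matrix_eq_sum_single] using h1

theorem exp_smul_diagonal (c : ℂ) (v : Fin l → ℂ) :
    NormedSpace.exp (c • Matrix.diagonal v : Matrix (Fin l) (Fin l) ℂ) =
      Matrix.diagonal fun j => Complex.exp (c * v j) := by
  rw [← Matrix.diagonal_smul, Matrix.exp_diagonal]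
  congr 1
  ext j
  rw [Pi.coe_exp, Complex.exp_eq_exp_ℂ]
  rfl

theorem commute_diagonal' (v w : Fin l → ℂ) :
    Commute (Matrix.diagonal v : Matrix (Fin l) (Fin l) ℂ) (Matrix.diagonal w) :=
  Matrix.commute_diagonal v w

/-- Conjugation with the exponential of a diagonal matrix. -/
theorem exp_mul_mul_exp_neg_apply (c : ℂ) (v : Fin l → ℂ) (A : Matrix (Fin l) (Fin l) ℂ)
    (j k : Fin l) : (NormedSpace.exp (c • Matrix.diagonal v) * A *
      NormedSpace.exp (-(c • Matrix.diagonal v))) j k = Complex.exp (c * (v j - v k)) * A j k := by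
  rw [← neg_smul, exp_smul_diagonal, exp_smul_diagonal, Matrix.mul_diagonal,
    Matrix.diagonal_mul, mul_sub, sub_eq_add_neg, Complex.exp_add, neg_mul]
  ring

end MatrixCalculus

namespace SlSpinPoint

variable {l : ℕ}

theorem dp_hamiltonian (τ : ℂ) (j : Fin l) (x : SlSpinPoint l) :
    dp (hamiltonian τ) j x = x.p j := by
  have h := ((HasDerivAt.fun_sum (u := Finset.univ) fun i _ =>
    (hasDerivAt_update_apply x.p j i (x.p j)).fun_pow 2).const_mul (1 / 2 : ℂ)).sub_const
      (1 / 2 * ∑ i, ∑ k, if i = k then 0 else wpFun τ (x.q i - x.q k) * x.F i k * x.F k i)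
  refine Eq.trans ?_ (h.deriv.trans ?_)
  · simp only [dp, hamiltonian]
  · simp

theorem dq_hamiltonian {τ : ℂ} (hτ : 0 < τ.im) (j : Fin l) (x : SlSpinPoint l)
    (hx : ∀ j k, j ≠ k → x.q j - x.q k ∉ periodLattice τ) :
    -dq (hamiltonian τ) j x = ∑ k, if k = j then 0 else
      deriv (wpFun τ) (x.q j - x.q k) * x.F j k * x.F k j := by
  set D : Fin l → Fin l → ℂ := fun a b => if a = b then 0 else
    deriv (wpFun τ) (x.q a - x.q b) * x.F a b * x.F b a with hD
  have h1 : ∀ a b, HasDerivAt (fun s => if a = b then 0 else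
      wpFun τ (Function.update x.q j s a - Function.update x.q j s b) * x.F a b * x.F b a)
      (((if a = j then 1 else 0) - (if b = j then 1 else 0)) * D a b) (x.q j) := by
    intro a b
    by_cases hab : a = b
    · simp only [if_pos hab, hD, mul_zero]
      exact hasDerivAt_const _ _
    · simp only [if_neg hab, hD]
      have h2 : HasDerivAt (wpFun τ) (deriv (wpFun τ) (x.q a - x.q b))
          (Function.update x.q j (x.q j) a - Function.update x.q j (x.q j) b) := by
        rw [Function.update_eq_self]
        exact (differentiableAt_wpFun hτ (hx a b hab)).hasDerivAt
      refine (((h2.comp (x.q j) ((hasDerivAt_update_apply x.q j a (x.q j)).sub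
        (hasDerivAt_update_apply x.q j b (x.q j)))).mul_const (x.F a b)).mul_const
        (x.F b a)).congr_deriv ?_
      ring
  have h := ((HasDerivAt.fun_sum (u := Finset.univ) fun a _ => HasDerivAt.fun_sum
    (u := Finset.univ) fun b _ => h1 a b).const_mul (1 / 2 : ℂ)).const_sub (1 / 2 * ∑ i, x.p i ^ 2)
  -- `℘'` is odd, so the row and the column of index `j` contribute equally and cancel the factor
  -- `1/2`.
  have hodd : ∀ a b, D b a = -D a b := by
    intro a b
    simp only [hD]
    by_cases hab : a = b
    · simp [hab]
    · rw [if_neg hab, if_neg (Ne.symm hab)]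
      have h3 : deriv (wpFun τ) (x.q b - x.q a) = -deriv (wpFun τ) (x.q a - x.q b) := by
        have h4 := deriv_comp_neg (wpFun τ) (x.q b - x.q a)
        simp only [wpFun_neg hτ, neg_sub] at h4
        exact h4
      rw [h3]
      ring
  have h5 : dq (hamiltonian τ) j x = _ := h.deriv
  rw [h5, neg_neg]
  simp only [sub_mul, ite_mul, one_mul, zero_mul, Finset.sum_sub_distrib, Finset.sum_ite_eq',
    Finset.mem_univ, if_true]
  have h6 : ∑ a, ∑ b, (if a = j then D a b else 0) = ∑ b, D j b := by
    rw [Finset.sum_comm]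
    simp
  rw [h6, Finset.sum_congr rfl fun a _ => hodd j a, Finset.sum_neg_distrib, sub_neg_eq_add,
    ← two_mul, ← mul_assoc]
  norm_num
  exact Finset.sum_congr rfl fun k _ => by simp only [hD, eq_comm]

theorem dF_hamiltonian {τ : ℂ} (hτ : 0 < τ.im) (m n : Fin l) (x : SlSpinPoint l) :
    dF (hamiltonian τ) m n x = if m = n then 0 else -(wpFun τ (x.q m - x.q n) * x.F n m) := by
  have hup : ∀ a b, HasDerivAt (fun s => Function.update x.F m (Function.update (x.F m) n s) a b)
      (if a = m ∧ b = n then 1 else 0) (x.F m n) := by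
    intro a b
    by_cases ha : a = m
    · subst ha
      simpa using hasDerivAt_update_apply (x.F a) n b (x.F a n)
    · simpa [ha] using hasDerivAt_const (x.F m n) (x.F a b)
  have h1 : ∀ a b, HasDerivAt (fun s => if a = b then 0 else wpFun τ (x.q a - x.q b) *
      Function.update x.F m (Function.update (x.F m) n s) a b *
      Function.update x.F m (Function.update (x.F m) n s) b a)
      (if a = b then 0 else wpFun τ (x.q a - x.q b) *
        ((if a = m ∧ b = n then 1 else 0) * x.F b a + x.F a b * if b = m ∧ a = n then 1 else 0))
      (x.F m n) := by
    intro a b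
    by_cases hab : a = b
    · simp only [if_pos hab]
      exact hasDerivAt_const _ _
    · simp only [if_neg hab]
      refine (((hup a b).const_mul (wpFun τ (x.q a - x.q b))).fun_mul (hup b a)).congr_deriv ?_
      simp only [Function.update_eq_self]
      ring
  have h := ((HasDerivAt.fun_sum (u := Finset.univ) fun a _ => HasDerivAt.fun_sum
    (u := Finset.univ) fun b _ => h1 a b).const_mul (1 / 2 : ℂ)).const_sub (1 / 2 * ∑ i, x.p i ^ 2)
  have h5 : dF (hamiltonian τ) m n x = _ := h.deriv
  rw [h5]
  have h6 : ∀ a b, (if a = b then 0 else wpFun τ (x.q a - x.q b) *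
        ((if a = m ∧ b = n then 1 else 0) * x.F b a + x.F a b * if b = m ∧ a = n then 1 else 0)) =
      (if a = m then if b = n then (if m = n then 0 else wpFun τ (x.q m - x.q n) * x.F n m) else 0
        else 0) +
      (if a = n then if b = m then (if m = n then 0 else wpFun τ (x.q m - x.q n) * x.F n m) else 0
        else 0) := by
    intro a b
    have hev : wpFun τ (x.q n - x.q m) = wpFun τ (x.q m - x.q n) := by
      rw [← wpFun_neg hτ, neg_sub]
    by_cases h1 : a = m <;> by_cases h2 : b = n <;> by_cases h3 : a = n <;> by_cases h4 : b = m <;>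
      simp_all
  simp only [h6, Finset.sum_add_distrib]
  simp only [Finset.sum_ite_irrel, Finset.sum_const_zero, Finset.sum_ite_eq', Finset.mem_univ,
    if_true]
  split_ifs
  · simp
  · ring

theorem bracketF_hamiltonian {τ : ℂ} (hτ : 0 < τ.im) (j k : Fin l) (x : SlSpinPoint l) :
    bracketF j k (hamiltonian τ) x =
      (∑ m, if m = j then 0 else wpFun τ (x.q j - x.q m) * x.F j m * x.F m k)
      - ∑ m, if m = k then 0 else wpFun τ (x.q m - x.q k) * x.F j m * x.F m k := by
  have hev : ∀ a b, wpFun τ (x.q b - x.q a) = wpFun τ (x.q a - x.q b) := fun a b => by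
    rw [← wpFun_neg hτ, neg_sub]
  simp only [bracketF, dF_hamiltonian hτ, sub_mul, ite_mul, zero_mul, Finset.sum_sub_distrib]
  have h1 : ∑ m, ∑ n, (if m = k then x.F j n *
      (if m = n then 0 else -(wpFun τ (x.q m - x.q n) * x.F n m)) else 0) =
      -∑ m, if m = k then 0 else wpFun τ (x.q m - x.q k) * x.F j m * x.F m k := by
    rw [Finset.sum_comm, ← Finset.sum_neg_distrib]
    refine Finset.sum_congr rfl fun n _ => ?_
    rw [Finset.sum_ite_eq' Finset.univ k, if_pos (Finset.mem_univ k), hev n k]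
    by_cases h : n = k
    · simp [h]
    · rw [if_neg h, if_neg (Ne.symm h)]
      ring
  have h2 : ∑ m, ∑ n, (if j = n then x.F m k *
      (if m = n then 0 else -(wpFun τ (x.q m - x.q n) * x.F n m)) else 0) =
      -∑ m, if m = j then 0 else wpFun τ (x.q j - x.q m) * x.F j m * x.F m k := by
    rw [← Finset.sum_neg_distrib]
    refine Finset.sum_congr rfl fun m _ => ?_
    rw [Finset.sum_ite_eq Finset.univ j, if_pos (Finset.mem_univ j), hev j m]
    by_cases h : m = j
    · simp [h]
    · rw [if_neg h, if_neg h]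
      ring
  rw [h1, h2]
  ring

variable {U : Set ℂ} {x : ℂ → SlSpinPoint l}

theorem IsSolution.equationsOfMotion (hx : IsSolution U x) (hU : ∀ τ ∈ U, 0 < τ.im) :
    EquationsOfMotion U x where
  deriv_q τ hτ j := dp_hamiltonian τ j (x τ) ▸ hx.deriv_q τ hτ j
  deriv_p τ hτ j := dq_hamiltonian (hU τ hτ) j (x τ) (hx.regular τ hτ) ▸ hx.deriv_p τ hτ j
  deriv_F τ hτ j k := bracketF_hamiltonian (hU τ hτ) j k (x τ) ▸ hx.deriv_F τ hτ j k

end SlSpinPoint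

/-! ### The Lax pair of `sl(ℓ)` -/

namespace SlSpinPoint

variable {l : ℕ} {U : Set ℂ} {x : ℂ → SlSpinPoint l}

theorem IsSolution.laxMFormula (hx : IsSolution U x) (hU : ∀ τ ∈ U, 0 < τ.im) :
    LaxMFormula U x := by
  intro τ hτ z _ hzu
  ext j k
  simp only [laxM, Matrix.of_apply]
  split_ifs with h
  · rfl
  · rw [dSigmaFun_eq_rho (hU τ hτ) (hx.regular τ hτ j k h) (hzu j k h), neg_mul, sub_add]

theorem IsSolution.hasDerivAt_q_sub (hx : IsSolution U x) (hU : ∀ τ ∈ U, 0 < τ.im) {τ : ℂ}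
    (hτ : τ ∈ U) (j k : Fin l) : HasDerivAt (fun t => (x t).q j - (x t).q k)
      ((2 * Real.pi * I : ℂ)⁻¹ * ((x τ).p j - (x τ).p k)) τ := by
  have hE := hx.equationsOfMotion hU
  refine (HasDerivAt.sub (hE.deriv_q τ hτ j) (hE.deriv_q τ hτ k)).congr_deriv ?_
  simp only [smul_eq_mul, mul_sub]

/-- The entries of the commutator in the Lax equation. -/
theorem lax_commutator_apply {τ z : ℂ} (hτ : 0 < τ.im) (hz : z ∉ periodLattice τ)
    (hreg : ∀ j k, j ≠ k → (x τ).q j - (x τ).q k ∉ periodLattice τ)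
    (hF : ∀ j, (x τ).F j j = 0) (j k : Fin l) :
    (laxL x τ z * laxM x τ z - laxM x τ z * laxL x τ z) j k =
      if j = k then ∑ m, if m = j then 0 else
        deriv (wpFun τ) ((x τ).q j - (x τ).q m) * (x τ).F j m * (x τ).F m j
      else ((x τ).p j - (x τ).p k) * dSigmaFun τ ((x τ).q j - (x τ).q k) z * (x τ).F k j +
        sigmaFun τ ((x τ).q j - (x τ).q k) z *
          ((∑ m, if m = k then 0 else wpFun τ ((x τ).q k - (x τ).q m) * (x τ).F k m * (x τ).F m j)
            - ∑ m, if m = j then 0 else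
              wpFun τ ((x τ).q m - (x τ).q j) * (x τ).F k m * (x τ).F m j) := by
  rw [Matrix.sub_apply, Matrix.mul_apply, Matrix.mul_apply, ← Finset.sum_sub_distrib]
  simp only [laxL, laxM, Matrix.of_apply]
  by_cases hjk : j = k
  · subst hjk
    rw [if_pos rfl]
    refine Finset.sum_congr rfl fun m _ => ?_
    by_cases hm : m = j
    · simp [hm]
    · have hm' : j ≠ m := Ne.symm hm
      have h := sigmaFun_mul_dSigmaFun_neg_sub hτ (hreg j m hm') hz
      rw [neg_sub] at h
      rw [if_neg hm, if_neg hm', if_neg hm, if_neg hm', if_neg hm, ← h]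
      ring
  · rw [if_neg hjk]
    -- The indices `m = j` and `m = k` give the contribution of `P`; there the extra `℘`-terms
    -- vanish because `F_{jj} = F_{kk} = 0`. All other `m` are the addition formula with `u = q_j -
    -- q_m` and `v = q_m - q_k`.
    have key : ∀ m, (if j = m then (x τ).p j else
          sigmaFun τ ((x τ).q j - (x τ).q m) z * (x τ).F m j) *
        (if m = k then 0 else dSigmaFun τ ((x τ).q m - (x τ).q k) z * (x τ).F k m) -
        (if j = m then 0 else dSigmaFun τ ((x τ).q j - (x τ).q m) z * (x τ).F m j) *
        (if m = k then (x τ).p m else sigmaFun τ ((x τ).q m - (x τ).q k) z * (x τ).F k m) =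
      (if m = j then (x τ).p j * dSigmaFun τ ((x τ).q j - (x τ).q k) z * (x τ).F k j else 0) -
      (if m = k then (x τ).p k * dSigmaFun τ ((x τ).q j - (x τ).q k) z * (x τ).F k j else 0) +
      sigmaFun τ ((x τ).q j - (x τ).q k) z *
        ((if m = k then 0 else wpFun τ ((x τ).q k - (x τ).q m) * (x τ).F k m * (x τ).F m j) -
          if m = j then 0 else
            wpFun τ ((x τ).q m - (x τ).q j) * (x τ).F k m * (x τ).F m j) := by
      intro m
      by_cases hmj : m = j
      · subst hmj
        simp only [if_true, if_neg hjk, hF]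
        ring
      · by_cases hmk : m = k
        · subst hmk
          simp only [if_true, if_neg hjk, if_neg hmj, hF]
          ring
        · have hjm : j ≠ m := Ne.symm hmj
          simp only [if_neg hmj, if_neg hmk, if_neg hjm]
          have h := sigmaFun_mul_dSigmaFun_sub hτ (hreg j m hjm) (hreg m k hmk)
            (by rw [sub_add_sub_cancel]; exact hreg j k hjk) hz
          rw [sub_add_sub_cancel] at h
          rw [← wpFun_neg hτ ((x τ).q k - (x τ).q m), ← wpFun_neg hτ ((x τ).q m - (x τ).q j),
            neg_sub, neg_sub]
          linear_combination (x τ).F m j * (x τ).F k m * h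
    rw [Finset.sum_congr rfl fun m _ => key m]
    simp only [Finset.sum_add_distrib, Finset.sum_sub_distrib, ← Finset.mul_sum,
      Finset.sum_ite_eq', Finset.mem_univ, if_true]
    ring

theorem IsSolution.laxEquation (hx : IsSolution U x) (hU : ∀ τ ∈ U, 0 < τ.im) :
    LaxEquation U (laxL x) (laxM x) := by
  intro τ hτ z hz
  have hτ0 := hU τ hτ
  have hE := hx.equationsOfMotion hU
  have hreg := hx.regular τ hτ
  let Lτ : Matrix (Fin l) (Fin l) ℂ := Matrix.of fun j k => if j = k then
    (2 * Real.pi * I : ℂ)⁻¹ * ∑ m, (if m = j then 0 else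
      deriv (wpFun τ) ((x τ).q j - (x τ).q m) * (x τ).F j m * (x τ).F m j)
    else ((2 * Real.pi * I : ℂ)⁻¹ * ((x τ).p j - (x τ).p k) *
        dSigmaFun τ ((x τ).q j - (x τ).q k) z -
      (2 * Real.pi * I : ℂ)⁻¹ * deriv (fun w => dSigmaFun τ ((x τ).q j - (x τ).q k) w) z) *
        (x τ).F k j + sigmaFun τ ((x τ).q j - (x τ).q k) z * ((2 * Real.pi * I : ℂ)⁻¹ *
      ((∑ m, if m = k then 0 else wpFun τ ((x τ).q k - (x τ).q m) * (x τ).F k m * (x τ).F m j)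
        - ∑ m, if m = j then 0 else
          wpFun τ ((x τ).q m - (x τ).q j) * (x τ).F k m * (x τ).F m j))
  let Mz : Matrix (Fin l) (Fin l) ℂ := Matrix.of fun j k => if j = k then 0 else
    deriv (fun w => dSigmaFun τ ((x τ).q j - (x τ).q k) w) z * (x τ).F k j
  refine ⟨Lτ, Mz, hasDerivAt_matrix fun j k => ?_, hasDerivAt_matrix fun j k => ?_, ?_⟩
  · simp only [laxL, Lτ, Matrix.of_apply]
    by_cases h : j = k
    · simp only [if_pos h]
      exact hE.deriv_p τ hτ j
    · simp only [if_neg h]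
      exact (hasDerivAt_sigmaFun_tau hτ0 (hreg j k h) hz (hx.hasDerivAt_q_sub hU hτ j k)).fun_mul
        (hE.deriv_F τ hτ k j)
  · simp only [laxM, Mz, Matrix.of_apply]
    by_cases h : j = k
    · simp only [if_pos h]
      exact hasDerivAt_const _ _
    · simp only [if_neg h]
      exact (differentiableAt_dSigmaFun hτ0 (hreg j k h) hz).hasDerivAt.mul_const _
  · ext j k
    rw [lax_commutator_apply hτ0 hz hreg (hx.constraint τ hτ), Matrix.add_apply, Matrix.smul_apply]
    simp only [Lτ, Mz, Matrix.of_apply, smul_eq_mul]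
    have h2 := two_pi_I_ne_zero'
    split_ifs
    · rw [mul_inv_cancel_left₀ h2, add_zero]
    · field_simp
      ring

theorem IsSolution.laxQuasiPeriodic (hx : IsSolution U x) (hU : ∀ τ ∈ U, 0 < τ.im) :
    LaxQuasiPeriodic U (laxL x) (laxM x)
      (fun τ => Matrix.diagonal (x τ).p) (fun τ => Matrix.diagonal (x τ).q) where
  L_one τ _ z _ := by simp only [laxL, sigmaFun_add_one]
  M_one τ _ z _ := by simp only [laxM, dSigmaFun_add_one]
  L_tau τ hτ z _ := by
    ext j k
    refine Eq.trans ?_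
      (exp_mul_mul_exp_neg_apply (2 * Real.pi * I) (x τ).q (laxL x τ z) j k).symm
    simp only [laxL, Matrix.of_apply, sigmaFun_add_tau]
    by_cases h : j = k
    · simp [h]
    · simp only [if_neg h, mul_assoc]
  M_tau τ hτ z _ := by
    ext j k
    refine Eq.trans ?_ (congrArg
      (· - ((2 * Real.pi * I : ℂ) • Matrix.diagonal (x τ).p : Matrix (Fin l) (Fin l) ℂ) j k)
      (exp_mul_mul_exp_neg_apply (2 * Real.pi * I) (x τ).q
        (laxM x τ z + (2 * Real.pi * I : ℂ) • laxL x τ z) j k)).symm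
    simp only [Matrix.add_apply, Matrix.smul_apply, Matrix.diagonal_apply]
    simp only [laxL, laxM, Matrix.of_apply, smul_eq_mul]
    by_cases h : j = k
    · simp [h]
    · simp only [if_neg h]
      rw [dSigmaFun_add_tau (hU τ hτ) (hx.regular τ hτ j k h)]
      ring

theorem IsSolution.analyticAt_q_sub (hx : IsSolution U x) (hUo : IsOpen U)
    (hU : ∀ τ ∈ U, 0 < τ.im) {τ : ℂ} (hτ : τ ∈ U) (j k : Fin l) :
    AnalyticAt ℂ (fun t => (x t).q j - (x t).q k) τ :=
  analyticAt_iff_eventually_differentiableAt.2 (eventually_of_mem (hUo.mem_nhds hτ)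
    fun _ ht => (hx.hasDerivAt_q_sub hU ht j k).differentiableAt)

theorem IsSolution.analyticAt_laxL (hx : IsSolution U x) (hUo : IsOpen U)
    (hU : ∀ τ ∈ U, 0 < τ.im) {τ z : ℂ} (hτ : τ ∈ U) (hz : z ∉ periodLattice τ) :
    AnalyticAt ℂ (fun y : ℂ × ℂ => laxL x y.1 y.2) (τ, z) := by
  refine analyticAt_matrix fun j k => ?_
  simp only [laxL, Matrix.of_apply]
  by_cases h : j = k
  · simp only [if_pos h]
    exact (analyticAt_of_twoPiIDeriv hUo (fun t ht => hx.deriv_p t ht j) hτ).comp_fst'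
  · simp only [if_neg h]
    exact (analyticAt_sigmaFun_comp analyticAt_fst (hx.analyticAt_q_sub hUo hU hτ j k).comp_fst'
      analyticAt_snd (hU τ hτ) (hx.regular τ hτ j k h) hz).fun_mul
      (analyticAt_of_twoPiIDeriv hUo (fun t ht => hx.deriv_F t ht k j) hτ).comp_fst'

theorem IsSolution.analyticAt_laxM (hx : IsSolution U x) (hUo : IsOpen U)
    (hU : ∀ τ ∈ U, 0 < τ.im) {τ z : ℂ} (hτ : τ ∈ U) (hz : z ∉ periodLattice τ) :
    AnalyticAt ℂ (fun y : ℂ × ℂ => laxM x y.1 y.2) (τ, z) := by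
  refine analyticAt_matrix fun j k => ?_
  simp only [laxM, Matrix.of_apply]
  by_cases h : j = k
  · simp only [if_pos h]
    exact analyticAt_const
  · simp only [if_neg h]
    exact (analyticAt_dSigmaFun_comp analyticAt_fst (hx.analyticAt_q_sub hUo hU hτ j k).comp_fst'
      analyticAt_snd (hU τ hτ) (hx.regular τ hτ j k h) hz).fun_mul
      (analyticAt_of_twoPiIDeriv hUo (fun t ht => hx.deriv_F t ht k j) hτ).comp_fst'

theorem IsSolution.isLaxPair (hx : IsSolution U x) (hUo : IsOpen U) (hU : ∀ τ ∈ U, 0 < τ.im) :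
    IsLaxPair U (laxL x) (laxM x)
      (fun τ => Matrix.diagonal (x τ).p) (fun τ => Matrix.diagonal (x τ).q) where
  isOpen := hUo
  im_pos := hU
  analyticAt_L _ hτ _ hz := hx.analyticAt_laxL hUo hU hτ hz
  analyticAt_M _ hτ _ hz := hx.analyticAt_laxM hUo hU hτ hz
  lax := hx.laxEquation hU
  quasiPeriodic := hx.laxQuasiPeriodic hU
  deriv_Q τ hτ := by
    refine hasDerivAt_matrix fun j k => ?_
    simp only [Matrix.smul_apply, Matrix.diagonal_apply]
    by_cases h : j = k
    · simp only [if_pos h]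
      exact (hx.equationsOfMotion hU).deriv_q τ hτ j
    · simp only [if_neg h, smul_zero]
      exact hasDerivAt_const _ _
  commute_Q _ _ := commute_diagonal' _ _
  commute_P _ _ := commute_diagonal' _ _

theorem IsSolution.onlyRegularSingularityAtZero (hx : IsSolution U x) (hUo : IsOpen U)
    (hU : ∀ τ ∈ U, 0 < τ.im) : OnlyRegularSingularityAtZero U (laxL x) := by
  intro τ hτ
  refine ⟨fun z hz => AnalyticAt.fun_comp (f := fun z : ℂ => (τ, z))
    (hx.analyticAt_laxL hUo hU hτ hz) (by fun_prop), ?_⟩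
  have hex : ∀ j k, ∃ R : ℂ → ℂ, j ≠ k → AnalyticAt ℂ R 0 ∧
      ∀ᶠ z in 𝓝[≠] (0 : ℂ), sigmaFun τ ((x τ).q j - (x τ).q k) z = z⁻¹ * R z := by
    intro j k
    by_cases h : j = k
    · exact ⟨0, fun h' => absurd h h'⟩
    · obtain ⟨R, hR⟩ := exists_analyticAt_sigmaFun_eq_inv_mul (hU τ hτ) (hx.regular τ hτ j k h)
      exact ⟨R, fun _ => hR⟩
  choose R hR using hex
  refine ⟨fun z => Matrix.of fun j k => if j = k then z * (x τ).p j else R j k z * (x τ).F k j,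
    analyticAt_matrix fun j k => ?_, ?_⟩
  · simp only [Matrix.of_apply]
    by_cases h : j = k
    · simp only [if_pos h]
      exact analyticAt_id.fun_mul analyticAt_const
    · simp only [if_neg h]
      exact (hR j k h).1.fun_mul analyticAt_const
  · have h1 : ∀ᶠ z in 𝓝[≠] (0 : ℂ), ∀ j k, j ≠ k →
        sigmaFun τ ((x τ).q j - (x τ).q k) z = z⁻¹ * R j k z := by
      refine eventually_all.2 fun j => eventually_all.2 fun k => ?_
      by_cases h : j = k
      · exact Eventually.of_forall fun z h' => absurd h h'
      · exact (hR j k h).2.mono fun z hz _ => hz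
    filter_upwards [h1, self_mem_nhdsWithin] with z hz hz0
    ext j k
    simp only [laxL, Matrix.smul_apply, Matrix.of_apply, smul_eq_mul]
    split_ifs with h
    · rw [inv_mul_cancel_left₀ hz0]
    · rw [hz j k h, mul_assoc]

end SlSpinPoint

end

theorem mainTheorem8 :
    -- general simple Lie algebra, arbitrary finite dimensional representation
    (∀ (𝔤 : Type*) [LieRing 𝔤] [LieAlgebra ℂ 𝔤] [FiniteDimensional ℂ 𝔤]
        [LieAlgebra.IsSimple ℂ 𝔤] (H : LieSubalgebra ℂ 𝔤) [H.IsCartanSubalgebra]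
        (ι : Type*) [Fintype ι] [DecidableEq ι] (B : RootBasis H ι)
        (V : Type*) [NormedAddCommGroup V] [NormedSpace ℂ V] [FiniteDimensional ℂ V]
        [LieRingModule 𝔤 V] [LieModule ℂ 𝔤 V]
        (U : Set ℂ) (x : ℂ → SpinPoint ι (LieModule.Weight ℂ H 𝔤)),
      IsOpen U → (∀ τ ∈ U, 0 < τ.im) → B.IsSolution U x →
        B.EquationsOfMotion U x ∧
        B.LaxMFormula V U x ∧
        LaxEquation U (B.laxL V x) (B.laxM V x) ∧
        LaxQuasiPeriodic U (B.laxL V x) (B.laxM V x)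
          (fun τ => B.cartanOp V (x τ).p) (fun τ => B.cartanOp V (x τ).q) ∧
        OnlyRegularSingularityAtZero U (B.laxL V x) ∧
        Isomonodromic U (B.laxL V x) (B.laxM V x) (fun τ => B.cartanOp V (x τ).q)) ∧
    -- the vector representation of `sl(ℓ)`
    (∀ (l : ℕ) (U : Set ℂ) (x : ℂ → SlSpinPoint l),
      IsOpen U → (∀ τ ∈ U, 0 < τ.im) → SlSpinPoint.IsSolution U x →
        SlSpinPoint.EquationsOfMotion U x ∧
        SlSpinPoint.LaxMFormula U x ∧
        LaxEquation U (SlSpinPoint.laxL x) (SlSpinPoint.laxM x) ∧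
        LaxQuasiPeriodic U (SlSpinPoint.laxL x) (SlSpinPoint.laxM x)
          (fun τ => Matrix.diagonal (x τ).p) (fun τ => Matrix.diagonal (x τ).q) ∧
        OnlyRegularSingularityAtZero U (SlSpinPoint.laxL x) ∧
        Isomonodromic U (SlSpinPoint.laxL x) (SlSpinPoint.laxM x)
          (fun τ => Matrix.diagonal (x τ).q)) := by
  refine ⟨?_, ?_⟩
  · intro 𝔤 _ _ _ _ H _ ι _ _ B V _ _ _ _ _ U x hUo hU hx
    have : CompleteSpace V := FiniteDimensional.complete ℂ V
    exact ⟨hx.equationsOfMotion hU, hx.laxMFormula V hU, hx.laxEquation V hU,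
      hx.laxQuasiPeriodic V hU, hx.onlyRegularSingularityAtZero V hUo hU,
      (hx.isLaxPair V hUo hU).isomonodromic⟩
  · intro l U x hUo hU hx
    have : CompleteSpace (Matrix (Fin l) (Fin l) ℂ) := FiniteDimensional.complete ℂ _
    exact ⟨hx.equationsOfMotion hU, hx.laxMFormula hU, hx.laxEquation hU,
      hx.laxQuasiPeriodic hU, hx.onlyRegularSingularityAtZero hUo hU,
      (hx.isLaxPair hUo hU).isomonodromic⟩
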